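/- \textbf{Conventions.} A binary string with content $(n_0,n_1)$ is a word with $n_0$ digits $\mathtt 0$ and $n_1$ digits $\mathtt 1$; the set of these is written $\binom{[n_0+n_1]}{n_1}$. Juxtaposition is concatenation, $\mathtt 0^m,\mathtt 1^m$ are constant words, and $\lambda^\vee$ is the reversal of $\lambda$. A \emph{puzzle piece} is a unit triangle, pointing up or down, with edges labeled by $\mathtt 0,\mathtt 1,\mathtt{10}$: either all three labels are $\mathtt 0$, or all three are $\mathtt 1$, or the labels are $\mathtt 1,\mathtt 0,\mathtt{10}$ in clockwise order (starting at any edge); equivalently, the upward triangles labeled $(\mathtt 0,\mathtt 0,\mathtt 0)$, $(\mathtt 1,\mathtt 1,\mathtt 1)$, $(\mathtt 1,\mathtt 0,\mathtt{10})$ on their NW, NE and South edges, with all rotations by multiples of $60^\circ$. This set of pieces is denoted $\mathfrak H$. For strings $\alpha,\beta$ of length $a$ and $\gamma,\delta$ of length $c$, a \emph{parallelogram puzzle with boundary $(\alpha,\gamma,\beta,\delta)$} is a tiling by puzzle pieces, with equal labels on glued edges, of the parallelogram that stands on a vertex with angle $60^\circ$, whose SW and NE sides have length $a$ and lie at $120^\circ$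 to the $x$-axis and whose NW and SE sides have length $c$ and lie at $60^\circ$ to the $x$-axis, such that the SW, NW, NE and SE sides, each read clockwise around the boundary, are labeled $\alpha,\gamma,\beta,\delta$ respectively. To a string with content $(n_0,n_1)$ associate the Young diagram whose boundary path starts at the NE corner of an $n_1\times n_0$ rectangle and steps one unit left for each $\mathtt 0$ and one unit down for each $\mathtt 1$. For strings $\lambda,\mu,\nu$ of the same content, $c_{\lambda,\mu}^{\nu}$ denotes the Littlewood--Richardson number of the associated Young diagrams, i.e. the coefficient of the Schur function $s_\nu$ in the expansion of $s_\lambda s_\mu$ in Schur functions. \textbf{Theorem.} Let $a_0,a_1,c_0,c_1$ be non-negative integers, $\alpha,\beta\in\binom{[a_0+a_1]}{a_1}$ and $\gamma,\delta\in\binom{[c_0+c_1]}{c_1}$. The number of parallelogram puzzles with boundary $(\alpha,\gamma,\beta,\delta)$, with pieces in $\mathfrak H$, is $$\begin{cases} \sum\limits_{\mu\in\binom{[c_0+c_1]}{c_1}} c_{\alpha,\beta}^{\mu\mathtt 1^{a_1-c_1}\mathtt 0^{a_0-c_0}}\cdot c_{\gamma,\delta}^{\mu^\vee} & \text{if } a_0\ge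 c_0 \text{ and } a_1>c_1,\\ \sum\limits_{\lambda\in\binom{[a_0+a_1]}{a_1}} c_{\alpha,\beta}^{\lambda^\vee}\cdot c_{\gamma,\delta}^{\mathtt 1^{c_1-a_1}\mathtt 0^{c_0-a_0}\lambda} & \text{if } c_1\ge a_1 \text{ and } c_0>a_0,\\ \sum\limits_{\eta\in\binom{[c_0+a_1]}{a_1}} c_{\alpha,\beta}^{\eta^\vee\mathtt 0^{a_0-c_0}}\cdot c_{\gamma,\delta}^{\mathtt 1^{c_1-a_1}\eta} & \text{if } a_0\ge c_0 \text{ and } c_1\ge a_1,\\ 0 & \text{if } c_0>a_0 \text{ and } a_1>c_1. \end{cases}$$ -/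

import Mathlib

noncomputable section

/-! ### Binary strings -/

/-- The finite set of binary strings with `n₀` digits `0` and `n₁` digits `1`
(`false` is the digit `0`, `true` is the digit `1`). -/
def binaryStrings (n₀ n₁ : ℕ) : Finset (List Bool) :=
  (List.replicate n₀ false ++ List.replicate n₁ true).permutations.toFinset

theorem mem_binaryStrings {n₀ n₁ : ℕ} {l : List Bool} :
    l ∈ binaryStrings n₀ n₁ ↔ l.count false = n₀ ∧ l.count true = n₁ := by
  rw [binaryStrings, List.mem_toFinset, List.mem_permutations, List.perm_iff_count]
  simp [List.count_append, List.count_replicate]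

/-- The string `0ᵐ`. -/
abbrev zeros (m : ℕ) : List Bool := List.replicate m false

/-- The string `1ᵐ`. -/
abbrev ones (m : ℕ) : List Bool := List.replicate m true

/-! ### Puzzle pieces and parallelogram-shaped puzzles -/

/-- The labels of the edges of puzzle pieces: `0`, `1` and `10`. -/
inductive EdgeLabel
  | zero
  | one
  | ten
  deriving DecidableEq

/-- The edge label of a binary digit. -/
def digitLabel : Bool → EdgeLabel
  | false => .zero
  | true => .one

/-- The puzzle pieces: `IsPiece x y z` says that `x, y, z`, read clockwise around a unit triangle,
are the labels of a puzzle piece. The starting edge does not matter (the relation is invariant under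
rotating `x, y, z`), and the same triples are allowed for upward- and for downward-pointing
triangles, since the set of pieces is closed under rotations by multiples of 60 degrees. The third
triple is the piece with NW, NE and South edges labeled `1`, `0` and `10`. -/
def IsPiece (x y z : EdgeLabel) : Prop :=
  (x, y, z) = (.zero, .zero, .zero) ∨ (x, y, z) = (.one, .one, .one) ∨
  (x, y, z) = (.one, .zero, .ten) ∨ (x, y, z) = (.zero, .ten, .one) ∨
  (x, y, z) = (.ten, .one, .zero)

/-- A tiling by puzzle pieces of the parallelogram that stands on its bottom vertex `B`, has SW and
NE sides of length `a`, and NW and SE sides of length `c`. Let `p` and `q` be the unit vectors at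
`120` and at `60` degrees from the positive `x`-axis. The lattice points of the parallelogram are
`B + i p + j q` with `0 ≤ i ≤ a` and `0 ≤ j ≤ c`.
* `u i j` labels the edge from `B + i p + j q` to `B + (i+1) p + j q`;
* `v i j` labels the edge from `B + i p + j q` to `B + i p + (j+1) q`;
* `h i j` labels the horizontal edge from `B + (i+1) p + j q` to `B + i p + (j+1) q`.

The horizontal edge cuts the unit rhombus with bottom vertex `B + i p + j q` into two triangles. -/
@[ext]
structure ParallelogramTiling (a c : ℕ) where
  u : Fin a → Fin (c + 1) → EdgeLabel
  v : Fin (a + 1) → Fin c → EdgeLabel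
  h : Fin a → Fin c → EdgeLabel
  /-- the downward-pointing triangles: SE, SW and North edge -/
  down : ∀ i j, IsPiece (v i.castSucc j) (u i j.castSucc) (h i j)
  /-- the upward-pointing triangles: NW, NE and South edge -/
  up : ∀ i j, IsPiece (v i.succ j) (u i j.succ) (h i j)

namespace ParallelogramTiling

variable {a c : ℕ} (P : ParallelogramTiling a c)

/-! The labels on the four sides, each side being read clockwise around the boundary. -/

/-- The SW side, from the bottom vertex to the left vertex. -/
def sw : List EdgeLabel := List.ofFn fun i => P.u i 0

/-- The NW side, from the left vertex to the top vertex. -/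
def nw : List EdgeLabel := List.ofFn fun j => P.v (Fin.last a) j

/-- The NE side, from the top vertex to the right vertex. -/
def ne : List EdgeLabel := List.ofFn fun i => P.u i.rev (Fin.last c)

/-- The SE side, from the right vertex to the bottom vertex. -/
def se : List EdgeLabel := List.ofFn fun j => P.v 0 j.rev

end ParallelogramTiling

/-- The parallelogram-shaped puzzles whose SW, NW, NE and SE sides are labeled, clockwise around the
boundary, by the binary strings `α`, `γ`, `β` and `δ`. -/
def ParallelogramPuzzle (α γ β δ : List Bool) : Type :=
  {P : ParallelogramTiling α.length γ.length //
    P.sw = α.map digitLabel ∧ P.nw = γ.map digitLabel ∧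
    P.ne = β.map digitLabel ∧ P.se = δ.map digitLabel}

/-! ### Littlewood-Richardson numbers -/

/-- The Schur function `s_ν`, a formal power series in countably many variables `x₀, x₁, …`: the
coefficient of the monomial `x ^ m` is the number of semistandard Young tableaux of shape `ν` that
have exactly `m i` entries `i` for every `i`. -/
def schurFunction (ν : YoungDiagram) : MvPowerSeries ℕ ℤ := fun m =>
  (Nat.card {T : SemistandardYoungTableau ν //
    ∀ i, (ν.cells.filter fun b => T b.1 b.2 = i).card = m i} : ℤ)

/-- `IsSchurExpansion f c` says that `f = ∑ ν, c ν • s_ν`, a finite sum over Young diagrams. -/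
def IsSchurExpansion (f : MvPowerSeries ℕ ℤ) (c : YoungDiagram →₀ ℤ) : Prop :=
  f = c.sum fun ν z => z • schurFunction ν

/-- The Littlewood-Richardson numbers, indexed by Young diagrams: the coefficients in the
(unique) expansion `s_κ * s_μ = ∑ ν, c ν • s_ν`. -/
def lrCoeff (κ μ : YoungDiagram) : YoungDiagram →₀ ℤ :=
  Classical.epsilon (IsSchurExpansion (schurFunction κ * schurFunction μ))

/-- For each digit `1` of a binary string, in order, the number of digits `0` to its right. -/
def rowLengths : List Bool → List ℕ
  | [] => []
  | false :: l => rowLengths l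
  | true :: l => l.count false :: rowLengths l

theorem le_of_mem_rowLengths {l : List Bool} {x : ℕ} (hx : x ∈ rowLengths l) :
    x ≤ l.count false := by
  induction l with
  | nil => simp [rowLengths] at hx
  | cons b l ih =>
    cases b with
    | false => exact (ih hx).trans (by simp)
    | true =>
      rcases List.mem_cons.1 hx with rfl | hx
      · simp
      · simpa using ih hx

theorem sortedGE_rowLengths (l : List Bool) : (rowLengths l).SortedGE := by
  rw [List.sortedGE_iff_pairwise]
  induction l with
  | nil => simp [rowLengths]
  | cons b l ih =>
    cases b with
    | false => exact ih
    | true => exact List.pairwise_cons.2 ⟨fun _ hx => le_of_mem_rowLengths hx, ih⟩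

/-- The Young diagram of a binary string with `n₀` digits `0` and `n₁` digits `1`: its boundary path
starts at the NE corner of an `n₁ × n₀` rectangle and steps left for each digit `0` and down for
each digit `1`. The row at the step down of some digit `1` has as many cells as there are steps left
still to come. -/
def stringDiagram (l : List Bool) : YoungDiagram :=
  YoungDiagram.ofRowLens (rowLengths l) (sortedGE_rowLengths l)

/-- The Littlewood-Richardson number `c_{κ,μ}^ν`, indexed by binary strings. -/
def lrNumber (κ μ ν : List Bool) : ℤ :=
  lrCoeff (stringDiagram κ) (stringDiagram μ) (stringDiagram ν)

end

/-!
Puzzles are matched with certain pairs of chains of Young diagrams, and these pairs are counted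
by sums of products of Littlewood-Richardson numbers.

*From puzzles to tableaux.* Cut the parallelogram into the strips between its columns of edges that
are parallel to the SW side, and think of the nonzero labels in the columns as `a₁` particles that
move through the strips from left to right. The digits between consecutive particles in all the
strips form a binary string of length `c₀ + c₁`. These strings lead from `γ` (above all particles)
to the reversal of `δ` (below all particles), and the puzzle conditions within a strip say that
consecutive strings interlace, i.e. that their diagrams differ by a horizontal strip
(`isStrip_iff_isMove`, `isHStrip_of_onesBefore`). So they encode a semistandard tableau of skew
shape `D / C`, where `C` and `D` are the diagrams of `γ` and the reversal of `δ`. The paths of the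
particles are determined by the tableau; that particles do not collide is the lattice word condition
relative to the diagram `A` of the reversal of `α` (`isLattice_iff_moves`), and the final positions
of the particles prescribe the weight of the tableau in terms of the diagram `B` of `β 0^c₀`. By
`card_parallelogramPuzzle`, the number of puzzles is `pairedCount a₁ c₁ A B C D`, the number of such
tableaux (the pictures between the skew shapes `B / A` and `D / C`).

*From tableaux to Littlewood-Richardson numbers.* By Stembridge's sign-reversing involution
(`sum_sign_stripVec`), `pairedCount` is an alternating sum of weight multiplicities. Together with
the Pieri rule (`completeSymm_mul_schurFunction`) this yields the linear independence of Schur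
functions, the Jacobi-Trudi formula, the Littlewood-Richardson rule (`lrCoeff_eq_pairedCount`), and
the identity `pairedCount n m A B C D = ∑ E, lrCoeff C E D * lrCoeff A E B` (`pairedCount_eq_sum`),
in which `E` may be restricted to the diagrams of strings `s` of the content of `γ`.

*Symmetries.* The first factor is the Littlewood-Richardson number of `γ`, `δ` and the reversal of
`s` by complementation in a rectangle (`lrCoeff_complement`). The second one is the coefficient of
`E` with `a₀ - c₀` added to each of its first `a₁` rows in the product for `α` and `β`, by duality
for the general linear group of rank `a₁` (`lrCoeff_dual`), both being visible from the alternating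
sums. The four cases of the theorem describe the strings `s` for which the second factor does not
vanish for trivial reasons: the diagram of `s` has at most `a₁` rows, and its first `a₁` rows have
length at least `c₀ - a₀`.
-/

noncomputable section

open Finset

/-! ### Young diagrams and horizontal strips -/

instance : DecidableEq YoungDiagram := Classical.decEq _

namespace YoungDiagram

/-- A Young diagram is determined by its row lengths. -/
theorem ext_rowLen {C D : YoungDiagram} (h : ∀ q, C.rowLen q = D.rowLen q) : C = D := by
  refine SetLike.ext fun x => ?_
  obtain ⟨i, j⟩ := x
  rw [mem_iff_lt_rowLen, mem_iff_lt_rowLen, h]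

theorem le_iff_rowLen {C D : YoungDiagram} : C ≤ D ↔ ∀ q, C.rowLen q ≤ D.rowLen q := by
  constructor
  · intro h q
    by_contra hq
    push Not at hq
    exact lt_irrefl _ (mem_iff_lt_rowLen.1 (h (mem_iff_lt_rowLen.2 hq)))
  · rintro h ⟨i, j⟩ hx
    exact mem_iff_lt_rowLen.2 ((mem_iff_lt_rowLen.1 hx).trans_le (h i))

@[simp]
theorem rowLen_bot (q : ℕ) : (⊥ : YoungDiagram).rowLen q = 0 := by
  by_contra h
  exact notMem_bot (q, 0) (mem_iff_lt_rowLen.2 (Nat.pos_of_ne_zero h))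

theorem rowLen_eq_zero_of_le {D : YoungDiagram} {m q : ℕ} (hm : D.rowLen m = 0) (h : m ≤ q) :
    D.rowLen q = 0 :=
  Nat.eq_zero_of_le_zero (hm ▸ D.rowLen_anti _ _ h)

theorem exists_rowLen_eq_zero (D : YoungDiagram) : ∃ m, D.rowLen m = 0 := by
  refine ⟨D.colLen 0, ?_⟩
  by_contra h
  exact lt_irrefl _ (mem_iff_lt_colLen.1 (mem_iff_lt_rowLen.2 (Nat.pos_of_ne_zero h)))

theorem card_eq_sum_rowLen {D : YoungDiagram} {m : ℕ} (hm : D.rowLen m = 0) :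
    D.card = ∑ q ∈ range m, D.rowLen q := by
  have : D.cells = (range m).biUnion D.row := by
    ext ⟨i, j⟩
    simp only [mem_biUnion, mem_range, mem_row_iff, mem_cells]
    constructor
    · intro h
      refine ⟨i, ?_, h, rfl⟩
      by_contra hi
      have := mem_iff_lt_rowLen.1 h
      rw [rowLen_eq_zero_of_le hm (not_lt.1 hi)] at this
      exact absurd this (Nat.not_lt_zero _)
    · rintro ⟨_, _, h, _⟩
      exact h
  change D.cells.card = _
  rw [this, card_biUnion]
  · simp [rowLen_eq_card]
  · intro i _ j _ hij
    refine disjoint_left.2 fun x hx hy => hij ?_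
    rw [← (mem_row_iff.1 hx).2, (mem_row_iff.1 hy).2]

open Classical in
/-- The Young diagram with given row lengths; it is `⊥` unless the row lengths are weakly decreasing
and eventually `0`. -/
def ofRows (f : ℕ → ℕ) : YoungDiagram :=
  if h : Antitone f ∧ ∃ m, f m = 0 then
    { cells := (range (Classical.choose h.2) ×ˢ range (f 0)).filter fun x => x.2 < f x.1
      isLowerSet := by
        rintro ⟨i, j⟩ ⟨i', j'⟩ ⟨hi, hj⟩ hx
        simp only [coe_filter, mem_product, mem_range, Set.mem_ofPred_eq] at hx ⊢
        have := h.1 hi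
        dsimp only at hi hj this
        omega }
  else ⊥

theorem rowLen_ofRows {f : ℕ → ℕ} (hf : Antitone f) (hm : ∃ m, f m = 0) (q : ℕ) :
    (ofRows f).rowLen q = f q := by
  have key : ∀ j, j < (ofRows f).rowLen q ↔ j < f q := by
    intro j
    rw [← mem_iff_lt_rowLen, ← mem_cells, ofRows, dif_pos ⟨hf, hm⟩]
    simp only [mem_filter, mem_product, mem_range]
    refine ⟨fun h => h.2, fun h => ⟨⟨?_, h.trans_le (hf (Nat.zero_le _))⟩, h⟩⟩
    by_contra hq
    have := hf (not_lt.1 hq)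
    rw [Classical.choose_spec hm] at this
    omega
  exact le_antisymm (not_lt.1 fun h => lt_irrefl _ ((key _).1 h))
    (not_lt.1 fun h => lt_irrefl _ ((key _).2 h))

theorem finite_Iic (D : YoungDiagram) : (Set.Iic D).Finite := by
  refine Set.Finite.of_finite_image (f := YoungDiagram.cells) ?_ ?_
  · refine (D.cells.powerset.finite_toSet).subset ?_
    rintro _ ⟨E, hE, rfl⟩
    simpa using hE
  · intro E _ F _ h
    exact YoungDiagram.ext h

theorem finite_card_le (k : ℕ) : {D : YoungDiagram | D.card ≤ k}.Finite := by
  refine Set.Finite.of_finite_image (f := YoungDiagram.cells) ?_ ?_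
  · refine ((range k ×ˢ range k).powerset.finite_toSet).subset ?_
    rintro _ ⟨E, hE, rfl⟩
    rw [mem_coe, mem_powerset]
    rintro ⟨i, j⟩ h
    rw [mem_cells] at h
    have h1 : (range (i + 1)) ×ˢ range (j + 1) ⊆ E.cells := by
      rintro ⟨i', j'⟩ h'
      simp only [mem_product, mem_range] at h'
      exact E.up_left_mem (by omega) (by omega) h
    have h2 := card_le_card h1
    rw [card_product, card_range, card_range] at h2
    have h3 : E.cells.card ≤ k := hE
    simp only [mem_product, mem_range]
    constructor <;> nlinarith
  · intro E _ F _ h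
    exact YoungDiagram.ext h

@[simp]
theorem card_bot : (⊥ : YoungDiagram).card = 0 := rfl

theorem card_mono {C D : YoungDiagram} (h : C ≤ D) : C.card ≤ D.card :=
  card_le_card (cells_subset_iff.2 h)

end YoungDiagram

/-- `D / C` is a horizontal strip: `C ⊆ D`, and no two cells of `D / C` are in one column. -/
def IsHStrip (C D : YoungDiagram) : Prop :=
  ∀ q, C.rowLen q ≤ D.rowLen q ∧ D.rowLen (q + 1) ≤ C.rowLen q

theorem IsHStrip.le {C D : YoungDiagram} (h : IsHStrip C D) : C ≤ D :=
  YoungDiagram.le_iff_rowLen.2 fun q => (h q).1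

theorem IsHStrip.card_le {C D : YoungDiagram} (h : IsHStrip C D) : C.card ≤ D.card :=
  YoungDiagram.card_mono h.le

theorem IsHStrip.refl (C : YoungDiagram) : IsHStrip C C :=
  fun q => ⟨le_rfl, C.rowLen_anti _ _ (Nat.le_succ q)⟩

theorem isHStrip_bot_right {C : YoungDiagram} : IsHStrip C ⊥ ↔ C = ⊥ := by
  refine ⟨fun h => le_bot_iff.1 h.le, ?_⟩
  rintro rfl
  exact IsHStrip.refl _

theorem finite_addStrips (C : YoungDiagram) (k : ℤ) :
    {D : YoungDiagram | IsHStrip C D ∧ (D.card : ℤ) = C.card + k}.Finite := by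
  refine (YoungDiagram.finite_card_le (C.card + k.toNat)).subset ?_
  rintro D ⟨h, h'⟩
  have := h.card_le
  change D.card ≤ _
  omega

theorem finite_removeStrips (D : YoungDiagram) : {C : YoungDiagram | IsHStrip C D}.Finite :=
  (YoungDiagram.finite_Iic D).subset fun _ h => IsHStrip.le h

/-- The diagrams `D` such that `D / C` is a horizontal strip with `k` cells. -/
def addStrips (C : YoungDiagram) (k : ℤ) : Finset YoungDiagram :=
  (finite_addStrips C k).toFinset

theorem mem_addStrips {C D : YoungDiagram} {k : ℤ} :
    D ∈ addStrips C k ↔ IsHStrip C D ∧ (D.card : ℤ) = C.card + k := by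
  simp [addStrips]

/-- The diagrams `C` such that `D / C` is a horizontal strip. -/
def removeStrips (D : YoungDiagram) : Finset YoungDiagram :=
  (finite_removeStrips D).toFinset

theorem mem_removeStrips {C D : YoungDiagram} : C ∈ removeStrips D ↔ IsHStrip C D := by
  simp [removeStrips]

/-! ### The Pieri rule in finitely many variables -/

/-- The Schur function of `D` in the first `n` variables, built up by adding one variable after the
other: the cells with entry `n` form a horizontal strip. -/
def schurTrunc : ℕ → YoungDiagram → MvPowerSeries ℕ ℤ
  | 0, D => if D = ⊥ then 1 else 0
  | n + 1, D => ∑ E ∈ removeStrips D, MvPowerSeries.X n ^ (D.card - E.card) * schurTrunc n E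

/-- The complete homogeneous symmetric polynomial of degree `k` in the first `n` variables. -/
def completeTrunc : ℕ → ℕ → MvPowerSeries ℕ ℤ
  | 0, k => if k = 0 then 1 else 0
  | n + 1, k => ∑ i ∈ range (k + 1), MvPowerSeries.X n ^ i * completeTrunc n (k - i)

/-- The relation between `D` and `(F, i)` in the local rule behind the Pieri rule: for fixed
`C` and `E`, it is a bijection between the `D` such that `D / C` and `D / E` are horizontal strips
and the pairs of a number `i` and an `F` such that `C / F` and `E / F` are horizontal strips. -/
def LocalRule (C E D F : YoungDiagram) (i : ℕ) : Prop :=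
  D.rowLen 0 = max (C.rowLen 0) (E.rowLen 0) + i ∧
  ∀ q, D.rowLen (q + 1) + F.rowLen q =
    max (C.rowLen (q + 1)) (E.rowLen (q + 1)) + min (C.rowLen q) (E.rowLen q)

theorem LocalRule.card_add_card {C E D F : YoungDiagram} {i : ℕ} (h : LocalRule C E D F i) :
    D.card + F.card = C.card + E.card + i := by
  obtain ⟨mC, hC⟩ := C.exists_rowLen_eq_zero
  obtain ⟨mD, hD⟩ := D.exists_rowLen_eq_zero
  obtain ⟨mE, hE⟩ := E.exists_rowLen_eq_zero
  obtain ⟨mF, hF⟩ := F.exists_rowLen_eq_zero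
  set m := mC + mD + mE + mF
  have hC' : C.rowLen m = 0 := YoungDiagram.rowLen_eq_zero_of_le hC (by omega)
  have hE' : E.rowLen m = 0 := YoungDiagram.rowLen_eq_zero_of_le hE (by omega)
  rw [YoungDiagram.card_eq_sum_rowLen (YoungDiagram.rowLen_eq_zero_of_le hC (by omega : mC ≤ m)),
    YoungDiagram.card_eq_sum_rowLen (YoungDiagram.rowLen_eq_zero_of_le hE (by omega : mE ≤ m)),
    YoungDiagram.card_eq_sum_rowLen (YoungDiagram.rowLen_eq_zero_of_le hF (by omega : mF ≤ m)),
    YoungDiagram.card_eq_sum_rowLen (YoungDiagram.rowLen_eq_zero_of_le hD (by omega : mD ≤ m + 1)),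
    sum_range_succ', h.1]
  have h1 : ∑ q ∈ range m, D.rowLen (q + 1) + ∑ q ∈ range m, F.rowLen q =
      ∑ q ∈ range m, max (C.rowLen (q + 1)) (E.rowLen (q + 1)) +
        ∑ q ∈ range m, min (C.rowLen q) (E.rowLen q) := by
    rw [← sum_add_distrib, ← sum_add_distrib]
    exact sum_congr rfl fun q _ => h.2 q
  have h2 : ∑ q ∈ range m, max (C.rowLen (q + 1)) (E.rowLen (q + 1)) +
      max (C.rowLen 0) (E.rowLen 0) = ∑ q ∈ range m, max (C.rowLen q) (E.rowLen q) := by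
    rw [← sum_range_succ' (fun q => max (C.rowLen q) (E.rowLen q)), sum_range_succ, hC', hE']
    simp
  have h3 : ∑ q ∈ range m, max (C.rowLen q) (E.rowLen q) +
      ∑ q ∈ range m, min (C.rowLen q) (E.rowLen q) =
      ∑ q ∈ range m, C.rowLen q + ∑ q ∈ range m, E.rowLen q := by
    rw [← sum_add_distrib, ← sum_add_distrib]
    exact sum_congr rfl fun q _ => by omega
  omega

/-- The row lengths of the diagram `D` in the local rule. -/
def localUpperRow (C E F : YoungDiagram) (i : ℕ) : ℕ → ℕ
  | 0 => max (C.rowLen 0) (E.rowLen 0) + i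
  | q + 1 => max (C.rowLen (q + 1)) (E.rowLen (q + 1)) + min (C.rowLen q) (E.rowLen q) - F.rowLen q

/-- The diagram `D` in the local rule. -/
def localUpper (C E F : YoungDiagram) (i : ℕ) : YoungDiagram :=
  YoungDiagram.ofRows (localUpperRow C E F i)

/-- The diagram `F` in the local rule. -/
def localLower (C E D : YoungDiagram) : YoungDiagram :=
  YoungDiagram.ofRows fun q => max (C.rowLen (q + 1)) (E.rowLen (q + 1)) +
    min (C.rowLen q) (E.rowLen q) - D.rowLen (q + 1)

theorem localRule_localUpper {C E F : YoungDiagram} (i : ℕ) (hC : IsHStrip F C)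
    (hE : IsHStrip F E) : LocalRule C E (localUpper C E F i) F i := by
  have hr := YoungDiagram.rowLen_ofRows (f := localUpperRow C E F i)
    (antitone_nat_of_succ_le fun q => by
      rcases q with _ | q
      · have := hC 0; have := hE 0
        simp only [localUpperRow]; omega
      · have := hC q; have := hE q; have := hC (q + 1); have := hE (q + 1)
        simp only [localUpperRow]; omega)
    (by
      obtain ⟨mC, hC0⟩ := C.exists_rowLen_eq_zero
      obtain ⟨mE, hE0⟩ := E.exists_rowLen_eq_zero
      refine ⟨mC + mE + 1, ?_⟩
      simp only [localUpperRow]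
      rw [YoungDiagram.rowLen_eq_zero_of_le hC0 (by omega : mC ≤ mC + mE + 1),
        YoungDiagram.rowLen_eq_zero_of_le hE0 (by omega : mE ≤ mC + mE + 1),
        YoungDiagram.rowLen_eq_zero_of_le hC0 (by omega : mC ≤ mC + mE)]
      simp)
  refine ⟨hr 0, fun q => ?_⟩
  rw [localUpper, hr (q + 1), localUpperRow]
  have := hC q; have := hE q
  omega

theorem localRule_localLower {C E D : YoungDiagram} (hC : IsHStrip C D) (hE : IsHStrip E D) :
    LocalRule C E D (localLower C E D) (D.rowLen 0 - max (C.rowLen 0) (E.rowLen 0)) := by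
  have hr := fun q => YoungDiagram.rowLen_ofRows
    (f := fun q => max (C.rowLen (q + 1)) (E.rowLen (q + 1)) +
    min (C.rowLen q) (E.rowLen q) - D.rowLen (q + 1))
    (antitone_nat_of_succ_le fun q => by
      have := hC (q + 1); have := hE (q + 1); have := hC q; have := hE q
      have := hC (q + 2); have := hE (q + 2)
      simp only [Nat.add_assoc, Nat.reduceAdd] at *
      omega)
    (by
      obtain ⟨mC, hC0⟩ := C.exists_rowLen_eq_zero
      obtain ⟨mE, hE0⟩ := E.exists_rowLen_eq_zero
      refine ⟨mC + mE, ?_⟩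
      rw [YoungDiagram.rowLen_eq_zero_of_le hC0 (by omega : mC ≤ mC + mE + 1),
        YoungDiagram.rowLen_eq_zero_of_le hE0 (by omega : mE ≤ mC + mE + 1),
        YoungDiagram.rowLen_eq_zero_of_le hC0 (by omega : mC ≤ mC + mE)]
      simp) q
  refine ⟨?_, fun q => ?_⟩
  · have := hC 0; have := hE 0
    omega
  · rw [localLower, hr q]
    have := hC q; have := hE q; have := hC (q + 1); have := hE (q + 1)
    omega

theorem LocalRule.upper_unique {C E D D' F : YoungDiagram} {i : ℕ} (h : LocalRule C E D F i)
    (h' : LocalRule C E D' F i) : D = D' := by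
  refine YoungDiagram.ext_rowLen fun q => ?_
  rcases q with _ | q
  · rw [h.1, h'.1]
  · have := h.2 q; have := h'.2 q
    omega

theorem LocalRule.lower_unique {C E D F F' : YoungDiagram} {i i' : ℕ} (h : LocalRule C E D F i)
    (h' : LocalRule C E D F' i') : F = F' :=
  YoungDiagram.ext_rowLen fun q => by
    have := h.2 q; have := h'.2 q
    omega

theorem LocalRule.isHStrip_lower {C E D F : YoungDiagram} {i : ℕ} (h : LocalRule C E D F i)
    (hC : IsHStrip C D) (hE : IsHStrip E D) : IsHStrip F C ∧ IsHStrip F E := by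
  refine ⟨fun q => ?_, fun q => ?_⟩ <;>
  · have := h.2 q; have := hC q; have := hE q; have := hC (q + 1); have := hE (q + 1)
    omega

theorem LocalRule.isHStrip_upper {C E D F : YoungDiagram} {i : ℕ} (h : LocalRule C E D F i)
    (hC : IsHStrip F C) (hE : IsHStrip F E) : IsHStrip C D ∧ IsHStrip E D := by
  refine ⟨fun q => ?_, fun q => ?_⟩ <;>
  · rcases q with _ | q
    · have := h.1; have := h.2 0; have := hC 0; have := hE 0
      omega
    · have := h.2 q; have := h.2 (q + 1); have := hC q; have := hE q
      have := hC (q + 1); have := hE (q + 1)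
      omega

/-- The Pieri rule in finitely many variables. -/
theorem sum_schurTrunc_addStrips (n k : ℕ) (C : YoungDiagram) :
    ∑ D ∈ addStrips C k, schurTrunc n D = completeTrunc n k * schurTrunc n C := by
  induction n generalizing k C with
  | zero =>
    simp only [schurTrunc, completeTrunc]
    by_cases hC : C = ⊥
    · subst hC
      by_cases hk : k = 0
      · subst hk
        rw [sum_eq_single ⊥]
        · simp
        · intro D _ hD
          simp [hD]
        · intro h
          exact absurd (mem_addStrips.2 ⟨IsHStrip.refl _, by simp⟩) h
      · rw [if_neg hk, zero_mul]
        refine sum_eq_zero fun D hD => if_neg ?_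
        rintro rfl
        have := (mem_addStrips.1 hD).2
        simp only [YoungDiagram.card_bot] at this
        omega
    · rw [if_neg hC, mul_zero]
      refine sum_eq_zero fun D hD => if_neg ?_
      rintro rfl
      exact hC (isHStrip_bot_right.1 (mem_addStrips.1 hD).1)
  | succ n ih =>
    have hR : completeTrunc (n + 1) k * schurTrunc (n + 1) C =
        ∑ i ∈ range (k + 1), ∑ F ∈ removeStrips C, ∑ E ∈ addStrips F ((k - i : ℕ) : ℤ),
          MvPowerSeries.X n ^ (i + (C.card - F.card)) * schurTrunc n E := by
      simp only [completeTrunc, schurTrunc, sum_mul_sum]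
      refine sum_congr rfl fun i _ => sum_congr rfl fun F _ => ?_
      rw [← mul_sum, ih]
      ring
    rw [hR]
    simp only [schurTrunc, sum_sigma']
    refine sum_bij' (fun x _ => ⟨x.1.rowLen 0 - max (C.rowLen 0) (x.2.rowLen 0),
      localLower C x.2 x.1, x.2⟩) (fun y _ => ⟨localUpper C y.2.2 y.2.1 y.1, y.2.2⟩) ?_ ?_ ?_ ?_ ?_
    · rintro ⟨D, E⟩ h
      simp only [mem_sigma, mem_addStrips, mem_removeStrips, mem_range] at h ⊢
      obtain ⟨⟨hC, hk⟩, hE⟩ := h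
      have hr := localRule_localLower hC hE
      have h1 := hr.card_add_card
      obtain ⟨h2, h3⟩ := hr.isHStrip_lower hC hE
      have := h3.card_le
      refine ⟨by omega, h2, h3, by omega⟩
    · rintro ⟨i, F, E⟩ h
      simp only [mem_sigma, mem_addStrips, mem_removeStrips, mem_range] at h ⊢
      obtain ⟨hi, hC, hE, hk⟩ := h
      have hr := localRule_localUpper i hC hE
      have h1 := hr.card_add_card
      obtain ⟨h2, h3⟩ := hr.isHStrip_upper hC hE
      refine ⟨⟨h2, by omega⟩, h3⟩
    · rintro ⟨D, E⟩ h
      simp only [mem_sigma, mem_addStrips, mem_removeStrips] at h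
      obtain ⟨⟨hC, hk⟩, hE⟩ := h
      have hr := localRule_localLower hC hE
      obtain ⟨h2, h3⟩ := hr.isHStrip_lower hC hE
      have := hr.upper_unique (localRule_localUpper _ h2 h3)
      dsimp only
      rw [← this]
    · rintro ⟨i, F, E⟩ h
      simp only [mem_sigma, mem_addStrips, mem_removeStrips, mem_range] at h
      obtain ⟨hi, hC, hE, hk⟩ := h
      have hr := localRule_localUpper i hC hE
      obtain ⟨h2, h3⟩ := hr.isHStrip_upper hC hE
      have h4 := hr.lower_unique (localRule_localLower h2 h3)
      have h5 := hr.1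
      dsimp only
      rw [← h4, h5, Nat.add_sub_cancel_left]
    · rintro ⟨D, E⟩ h
      simp only [mem_sigma, mem_addStrips, mem_removeStrips] at h
      obtain ⟨⟨hC, hk⟩, hE⟩ := h
      have hr := localRule_localLower hC hE
      have h1 := hr.card_add_card
      obtain ⟨h2, h3⟩ := hr.isHStrip_lower hC hE
      have := h2.card_le
      have := hE.card_le
      dsimp only
      congr 2
      omega

/-! ### Chains of horizontal strips, tableaux and the Pieri rule -/

/-- The operator on formal linear combinations of diagrams that sends `C` to the sum of all `D` such
that `D / C` is a horizontal strip with `k` cells. It is `0` for `k < 0`. -/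
def pieri (k : ℤ) : (YoungDiagram →₀ ℤ) →ₗ[ℤ] (YoungDiagram →₀ ℤ) :=
  Finsupp.linearCombination ℤ fun C => ∑ D ∈ addStrips C k, Finsupp.single D 1

theorem pieri_single (k : ℤ) (C : YoungDiagram) :
    pieri k (Finsupp.single C 1) = ∑ D ∈ addStrips C k, Finsupp.single D 1 := by
  simp [pieri]

theorem pieri_apply (k : ℤ) (v : YoungDiagram →₀ ℤ) (D : YoungDiagram) :
    pieri k v D = ∑ E ∈ removeStrips D with (D.card : ℤ) = E.card + k, v E := by
  induction v using Finsupp.induction_linear with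
  | zero => simp
  | add v w hv hw => simp [map_add, hv, hw, sum_add_distrib]
  | single C z =>
    rw [show Finsupp.single C z = z • Finsupp.single C (1 : ℤ) by simp, map_smul, pieri_single,
      Finsupp.smul_apply, Finsupp.finsetSum_apply]
    simp only [Finsupp.smul_apply, Finsupp.single_apply, smul_eq_mul, ← mul_sum]
    congr 1
    simp only [sum_ite_eq, sum_ite_eq', mem_filter, mem_addStrips, mem_removeStrips]
    congr 1
    simp only [mem_filter, mem_addStrips, mem_removeStrips]

/-- The coefficient of `D` in `stripVec n k C` counts the ways of going from `C` to `D` by adding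
horizontal strips with `k 0`, …, `k (n - 1)` cells; see `stripVec_eq_card`. -/
def stripVec : (n : ℕ) → (Fin n → ℤ) → YoungDiagram → YoungDiagram →₀ ℤ
  | 0, _, C => Finsupp.single C 1
  | n + 1, k, C => pieri (k (Fin.last n)) (stripVec n (fun r => k r.castSucc) C)

/-- The chains `C = L 0 ⊆ L 1 ⊆ … ⊆ L n = D` in which consecutive diagrams differ by horizontal
strips. They encode the semistandard tableaux of shape `D / C` with entries less than `n`: the
diagram `L r` consists of `C` and the cells with entries less than `r`. -/
def StripChain (n : ℕ) (C D : YoungDiagram) : Set (ℕ → YoungDiagram) :=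
  {L | L 0 = C ∧ (∀ r, n ≤ r → L r = D) ∧ ∀ r, IsHStrip (L r) (L (r + 1))}

/-- The number of entries `r` in the tableau encoded by the chain `L`. -/
def chainWeight (L : ℕ → YoungDiagram) (r : ℕ) : ℤ := (L (r + 1)).card - (L r).card

theorem StripChain.mono {n : ℕ} {C D : YoungDiagram} {L : ℕ → YoungDiagram}
    (hL : L ∈ StripChain n C D) : Monotone L :=
  monotone_nat_of_le_succ fun r => (hL.2.2 r).le

theorem StripChain.le {n : ℕ} {C D : YoungDiagram} {L : ℕ → YoungDiagram}
    (hL : L ∈ StripChain n C D) (r : ℕ) : L r ≤ D := by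
  rw [← hL.2.1 (max n r) (le_max_left _ _)]
  exact StripChain.mono hL (le_max_right _ _)

theorem StripChain.ge {n : ℕ} {C D : YoungDiagram} {L : ℕ → YoungDiagram}
    (hL : L ∈ StripChain n C D) (r : ℕ) : C ≤ L r := by
  rw [← hL.1]
  exact StripChain.mono hL (Nat.zero_le _)

theorem finite_stripChain (n : ℕ) (C D : YoungDiagram) : (StripChain n C D).Finite := by
  have : {f : Fin n → YoungDiagram | ∀ r, f r ∈ Set.Iic D}.Finite :=
    Set.Finite.pi' fun _ => YoungDiagram.finite_Iic D
  refine Set.Finite.of_finite_image (f := fun L (r : Fin n) => L r) (this.subset ?_) ?_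
  · rintro _ ⟨L, hL, rfl⟩ r
    exact StripChain.le hL r
  · intro L hL L' hL' h
    funext r
    by_cases hr : r < n
    · exact congrFun h ⟨r, hr⟩
    · rw [hL.2.1 r (by omega), hL'.2.1 r (by omega)]

theorem stripVec_eq_card (n : ℕ) (k : Fin n → ℤ) (C D : YoungDiagram) :
    stripVec n k C D =
      Nat.card {L // L ∈ StripChain n C D ∧ ∀ r : Fin n, chainWeight L r = k r} := by
  induction n generalizing D with
  | zero =>
    rw [stripVec, Finsupp.single_apply]
    by_cases h : C = D
    · subst h
      rw [if_pos rfl]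
      have : Nat.card {L // L ∈ StripChain 0 C C ∧ ∀ r : Fin 0, chainWeight L r = k r} = 1 := by
        rw [Nat.card_eq_one_iff_unique]
        refine ⟨⟨fun L L' => Subtype.ext (funext fun r => ?_)⟩,
          ⟨⟨fun _ => C, ⟨rfl, fun _ _ => rfl, fun _ => IsHStrip.refl C⟩, fun r => r.elim0⟩⟩⟩
        rw [L.2.1.2.1 r (Nat.zero_le _), L'.2.1.2.1 r (Nat.zero_le _)]
      rw [this, Nat.cast_one]
    · rw [if_neg h]
      have : IsEmpty {L // L ∈ StripChain 0 C D ∧ ∀ r : Fin 0, chainWeight L r = k r} :=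
        ⟨fun L => h (by rw [← L.2.1.1, L.2.1.2.1 0 le_rfl])⟩
      rw [Nat.card_of_isEmpty, Nat.cast_zero]
  | succ n ih =>
    rw [stripVec, pieri_apply]
    set s := (removeStrips D).filter fun E => (D.card : ℤ) = E.card + k (Fin.last n)
    have hs : ∀ E, E ∈ s ↔ IsHStrip E D ∧ (D.card : ℤ) = E.card + k (Fin.last n) := by
      intro E
      simp only [s, mem_filter, mem_removeStrips]
    have e : {L // L ∈ StripChain (n + 1) C D ∧ ∀ r : Fin (n + 1), chainWeight L r = k r} ≃
        Σ E : s, {L // L ∈ StripChain n C E ∧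
          ∀ r : Fin n, chainWeight L r = k r.castSucc} := by
      refine
        { toFun := fun L => ⟨⟨L.1 n, ?_⟩, fun r => L.1 (min r n), ⟨?_, ?_, ?_⟩, ?_⟩
          invFun := fun x => ⟨fun r => if r ≤ n then x.2.1 r else D, ⟨?_, ?_, ?_⟩, ?_⟩
          left_inv := ?_
          right_inv := ?_ }
      · obtain ⟨L, hL, hk⟩ := L
        rw [hs]
        have h1 := hL.2.2 n
        have h2 := hk (Fin.last n)
        rw [chainWeight, Fin.val_last, hL.2.1 (n + 1) le_rfl] at h2
        rw [hL.2.1 (n + 1) le_rfl] at h1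
        exact ⟨h1, by simp only; omega⟩
      · simpa using L.2.1.1
      · intro r hr
        simp only [min_eq_right hr]
      · intro r
        dsimp only
        rcases lt_or_ge r n with h | h
        · rw [min_eq_left h.le, min_eq_left h]
          exact L.2.1.2.2 r
        · rw [min_eq_right h, min_eq_right (h.trans (Nat.le_succ r))]
          exact IsHStrip.refl _
      · intro r
        rw [← L.2.2 r.castSucc, chainWeight, chainWeight]
        simp only [min_eq_left r.2.le, min_eq_left (Nat.succ_le_of_lt r.2), Fin.val_castSucc]
      · simpa using x.2.2.1.1
      · intro r hr
        dsimp only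
        rw [if_neg (by omega)]
      · intro r
        dsimp only
        rcases lt_trichotomy r n with h | h | h
        · rw [if_pos h.le, if_pos (Nat.succ_le_of_lt h)]
          exact x.2.2.1.2.2 r
        · subst h
          rw [if_pos le_rfl, if_neg (by omega), x.2.2.1.2.1 r le_rfl]
          exact ((hs _).1 x.1.2).1
        · rw [if_neg (by omega), if_neg (by omega)]
          exact IsHStrip.refl _
      · intro r
        induction r using Fin.lastCases with
        | last =>
          have := ((hs _).1 x.1.2).2
          rw [chainWeight, Fin.val_last, if_neg (by omega), if_pos le_rfl, x.2.2.1.2.1 n le_rfl]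
          omega
        | cast r =>
          have hr := r.2
          rw [← x.2.2.2 r, chainWeight, chainWeight, Fin.val_castSucc, if_pos (by omega),
            if_pos (by omega)]
      · rintro ⟨L, hL, hk⟩
        refine Subtype.ext (funext fun r => ?_)
        dsimp only
        split_ifs with h
        · rw [min_eq_left h]
        · rw [hL.2.1 r (by omega)]
      · rintro ⟨⟨E, hE⟩, L, hL, hk⟩
        have h1 : (if n ≤ n then L n else D) = E := by
          rw [if_pos le_rfl, hL.2.1 n le_rfl]
        have h2 : (fun r => if min r n ≤ n then L (min r n) else D) = L := by
          funext r
          rw [if_pos (min_le_right _ _)]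
          rcases le_total r n with h | h
          · rw [min_eq_left h]
          · rw [min_eq_right h, hL.2.1 n le_rfl, hL.2.1 r h]
        subst h1
        simp only [h2]
    have hfin : ∀ E : s, Finite {L // L ∈ StripChain n C E ∧
          ∀ r : Fin n, chainWeight L r = k r.castSucc} := fun E =>
      ((finite_stripChain n C E).subset fun L hL => hL.1).to_subtype
    rw [Nat.card_congr e, Nat.card_sigma, ← sum_coe_sort s]
    push_cast
    exact sum_congr rfl fun E _ => ih _ _

/-- The diagram of the cells of a semistandard tableau with entries less than `r`. -/
def tableauBelow {D : YoungDiagram} (T : SemistandardYoungTableau D) (r : ℕ) : YoungDiagram where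
  cells := D.cells.filter fun x => T x.1 x.2 < r
  isLowerSet := by
    rintro ⟨i, j⟩ ⟨i', j'⟩ ⟨hi, hj⟩ h
    simp only [coe_filter, YoungDiagram.mem_cells, Set.mem_ofPred_eq] at h ⊢
    dsimp only at hi hj
    refine ⟨D.up_left_mem hi hj h.1, ?_⟩
    have h1 := T.row_weak_of_le hj (D.up_left_mem hi le_rfl h.1)
    have h2 := T.col_weak hi h.1
    omega

theorem mem_tableauBelow {D : YoungDiagram} (T : SemistandardYoungTableau D) (r i j : ℕ) :
    (i, j) ∈ tableauBelow T r ↔ (i, j) ∈ D ∧ T i j < r := by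
  rw [← YoungDiagram.mem_cells, tableauBelow, mem_filter, YoungDiagram.mem_cells]

theorem card_tableauBelow_succ {D : YoungDiagram} (T : SemistandardYoungTableau D) (r : ℕ) :
    (tableauBelow T (r + 1)).card =
      (tableauBelow T r).card + (D.cells.filter fun x => T x.1 x.2 = r).card := by
  change (D.cells.filter fun x => T x.1 x.2 < r + 1).card =
    (D.cells.filter fun x => T x.1 x.2 < r).card + _
  rw [← card_union_of_disjoint]
  · congr 1
    ext x
    simp only [mem_filter, mem_union]
    have : T x.1 x.2 < r + 1 ↔ T x.1 x.2 < r ∨ T x.1 x.2 = r := by omega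
    tauto
  · refine disjoint_left.2 fun x hx hy => ?_
    have := (mem_filter.1 hx).2; have := (mem_filter.1 hy).2
    omega

theorem mem_chain_iff {n : ℕ} {D : YoungDiagram} {L : ℕ → YoungDiagram}
    (hL : L ∈ StripChain n ⊥ D) {x : ℕ × ℕ} (hx : x ∈ D) (r : ℕ) :
    x ∈ L r ↔ ((range n).filter fun r => x ∉ L (r + 1)).card < r := by
  have hmono : ∀ {r r'}, r ≤ r' → x ∈ L r → x ∈ L r' := fun h h' => StripChain.mono hL h h'
  constructor
  · intro h
    have h0 : r ≠ 0 := by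
      rintro rfl
      rw [hL.1] at h
      exact YoungDiagram.notMem_bot _ h
    have : (range n).filter (fun r => x ∉ L (r + 1)) ⊆ range (r - 1) := by
      intro r' hr'
      rw [mem_range]
      by_contra h'
      exact (mem_filter.1 hr').2 (hmono (by omega) h)
    have := card_le_card this
    rw [card_range] at this
    omega
  · intro h
    by_contra hr
    have hrn : r < n := by
      by_contra h'
      exact hr (by rw [hL.2.1 r (by omega)]; exact hx)
    have : range r ⊆ (range n).filter fun r => x ∉ L (r + 1) := by
      intro r' hr'
      rw [mem_range] at hr'
      exact mem_filter.2 ⟨mem_range.2 (by omega), fun h' => hr (hmono (by omega) h')⟩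
    have := card_le_card this
    rw [card_range] at this
    omega

/-- The semistandard tableau encoded by a chain of horizontal strips. -/
def chainTableau {n : ℕ} {D : YoungDiagram} {L : ℕ → YoungDiagram} (hL : L ∈ StripChain n ⊥ D) :
    SemistandardYoungTableau D where
  entry i j := if (i, j) ∈ D then ((range n).filter fun r => (i, j) ∉ L (r + 1)).card else 0
  row_weak' := by
    intro i j1 j2 hj h
    simp only [if_pos h, if_pos (D.up_left_mem le_rfl hj.le h)]
    refine card_le_card fun r hr => ?_
    rw [mem_filter] at hr ⊢
    exact ⟨hr.1, fun h' => hr.2 ((L (r + 1)).up_left_mem le_rfl hj.le h')⟩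
  col_strict' := by
    intro i1 i2 j hi h
    have h1 := D.up_left_mem hi.le le_rfl h
    simp only [if_pos h, if_pos h1]
    rw [← mem_chain_iff hL h1, YoungDiagram.mem_iff_lt_rowLen]
    have h2 := (mem_chain_iff hL h (_ + 1)).2 (Nat.lt_succ_self _)
    rw [YoungDiagram.mem_iff_lt_rowLen] at h2
    obtain ⟨i, rfl⟩ : ∃ i, i2 = i + 1 := ⟨i2 - 1, by omega⟩
    exact (h2.trans_le (hL.2.2 _ i).2).trans_le ((L _).rowLen_anti _ _ (by omega))
  zeros' := fun h => if_neg h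

theorem tableauBelow_chainTableau {n : ℕ} {D : YoungDiagram} {L : ℕ → YoungDiagram}
    (hL : L ∈ StripChain n ⊥ D) : tableauBelow (chainTableau hL) = L := by
  funext r
  refine SetLike.ext fun ⟨i, j⟩ => ?_
  rw [mem_tableauBelow]
  by_cases h : (i, j) ∈ D
  · rw [mem_chain_iff hL h]
    change _ ∧ (if (i, j) ∈ D then _ else 0) < r ↔ _
    rw [if_pos h]
    exact ⟨fun h => h.2, fun h' => ⟨h, h'⟩⟩
  · exact ⟨fun h' => absurd h'.1 h, fun h' => absurd (StripChain.le hL r h') h⟩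

theorem tableauBelow_injective {D : YoungDiagram} :
    Function.Injective (tableauBelow (D := D)) := by
  intro T T' h
  ext i j
  by_cases hD : (i, j) ∈ D
  · have key : ∀ r, T i j < r ↔ T' i j < r := by
      intro r
      have := mem_tableauBelow T r i j
      have := mem_tableauBelow T' r i j
      rw [h] at *
      tauto
    exact le_antisymm (Nat.lt_succ_iff.1 ((key _).2 (Nat.lt_succ_self _)))
      (Nat.lt_succ_iff.1 ((key _).1 (Nat.lt_succ_self _)))
  · rw [T.zeros hD, T'.zeros hD]

theorem tableauBelow_mem_stripChain {n : ℕ} {D : YoungDiagram} (T : SemistandardYoungTableau D)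
    (hT : ∀ i j, (i, j) ∈ D → T i j < n) : tableauBelow T ∈ StripChain n ⊥ D := by
  refine ⟨?_, ?_, ?_⟩
  · refine SetLike.ext fun ⟨i, j⟩ => ?_
    rw [mem_tableauBelow]
    simp
  · intro r hr
    refine SetLike.ext fun ⟨i, j⟩ => ?_
    rw [mem_tableauBelow]
    exact ⟨fun h => h.1, fun h => ⟨h, (hT i j h).trans_le hr⟩⟩
  · intro r q
    constructor <;> by_contra h <;> push Not at h
    · have h1 := (mem_tableauBelow _ _ _ _).1 (YoungDiagram.mem_iff_lt_rowLen.2 h)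
      exact lt_irrefl _ (YoungDiagram.mem_iff_lt_rowLen.1
        ((mem_tableauBelow T (r + 1) _ _).2 ⟨h1.1, by omega⟩))
    · have h1 := (mem_tableauBelow _ _ _ _).1 (YoungDiagram.mem_iff_lt_rowLen.2 h)
      have h2 := T.col_strict (Nat.lt_succ_self q) h1.1
      refine lt_irrefl _ (YoungDiagram.mem_iff_lt_rowLen.1
        ((mem_tableauBelow T r _ _).2 ⟨D.up_left_mem (Nat.le_succ q) le_rfl h1.1, ?_⟩))
      exact h2.trans_le (Nat.lt_succ_iff.1 h1.2)

/-- The coefficients of Schur functions count chains of horizontal strips. -/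
theorem coeff_schurFunction (n : ℕ) (D : YoungDiagram) (m : ℕ →₀ ℕ) (hm : ∀ i, n ≤ i → m i = 0) :
    MvPowerSeries.coeff m (schurFunction D) = stripVec n (fun r => (m r : ℤ)) ⊥ D := by
  rw [stripVec_eq_card]
  change ((Nat.card _ : ℕ) : ℤ) = _
  congr 1
  have hlt : ∀ T : SemistandardYoungTableau D,
      (∀ i, (D.cells.filter fun b => T b.1 b.2 = i).card = m i) →
        ∀ i j, (i, j) ∈ D → T i j < n := by
    intro T hT i j h
    by_contra hlt
    have h1 := hT (T i j)
    rw [hm _ (by omega), card_eq_zero] at h1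
    exact notMem_empty (i, j) (h1 ▸ mem_filter.2 ⟨h, rfl⟩)
  have hw : ∀ (T : SemistandardYoungTableau D) (r : ℕ), chainWeight (tableauBelow T) r =
      (D.cells.filter fun b => T b.1 b.2 = r).card := by
    intro T r
    rw [chainWeight, card_tableauBelow_succ]
    push_cast
    ring
  refine Nat.card_congr
    { toFun := fun T => ⟨tableauBelow T.1, tableauBelow_mem_stripChain _ (hlt _ T.2),
        fun r => by rw [hw, T.2]⟩
      invFun := fun L => ⟨chainTableau L.2.1, fun r => ?_⟩
      left_inv := fun T => Subtype.ext (tableauBelow_injective (tableauBelow_chainTableau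
        (tableauBelow_mem_stripChain _ (hlt _ T.2))))
      right_inv := fun L => Subtype.ext (tableauBelow_chainTableau L.2.1) }
  have h := hw (chainTableau L.2.1) r
  rw [tableauBelow_chainTableau] at h
  rcases lt_or_ge r n with hr | hr
  · have h' := L.2.2 ⟨r, hr⟩
    dsimp only at h'
    rw [h] at h'
    exact_mod_cast h'
  · rw [chainWeight, L.2.1.2.1 r hr, L.2.1.2.1 (r + 1) (by omega), sub_self] at h
    rw [hm r hr]
    exact_mod_cast h.symm

/-- The complete homogeneous symmetric function of degree `k`; it is `0` for `k < 0`. -/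
def completeSymm (k : ℤ) : MvPowerSeries ℕ ℤ := fun m => if (m.degree : ℤ) = k then 1 else 0

theorem coeff_X_pow_mul_of_eq {f : MvPowerSeries ℕ ℤ} {n i : ℕ} {m : ℕ →₀ ℕ}
    (hf : ∀ m : ℕ →₀ ℕ, m n ≠ 0 → MvPowerSeries.coeff m f = 0) :
    MvPowerSeries.coeff m (MvPowerSeries.X n ^ i * f) =
      if m n = i then MvPowerSeries.coeff (m.erase n) f else 0 := by
  rw [MvPowerSeries.X_pow_eq, MvPowerSeries.coeff_monomial_mul, one_mul]
  split_ifs with h1 h2 h2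
  · congr 2
    ext x
    by_cases hx : x = n
    · subst hx
      simp [h2]
    · simp [Finsupp.erase_ne hx, Finsupp.single_eq_of_ne hx]
  · refine hf _ ?_
    have := h1 n
    simp only [Finsupp.single_eq_same] at this
    simp only [Finsupp.coe_tsub, Pi.sub_apply, Finsupp.single_eq_same]
    omega
  · refine absurd (Finsupp.single_le_iff.2 h2.ge) h1
  · rfl

open Classical in
theorem coeff_completeTrunc (n k : ℕ) (m : ℕ →₀ ℕ) :
    MvPowerSeries.coeff m (completeTrunc n k) =
      if (∀ i, n ≤ i → m i = 0) ∧ m.degree = k then 1 else 0 := by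
  induction n generalizing k m with
  | zero =>
    have h0 : (∀ i, 0 ≤ i → m i = 0) ↔ m = 0 :=
      ⟨fun h => Finsupp.ext fun i => h i (Nat.zero_le i), fun h i _ => by simp [h]⟩
    rw [h0]
    by_cases hm : m = 0
    · subst hm
      by_cases hk : k = 0
      · simp [completeTrunc, hk]
      · simp [completeTrunc, hk, Ne.symm hk]
    · by_cases hk : k = 0
      · simp [completeTrunc, hk, hm, MvPowerSeries.coeff_one]
      · simp [completeTrunc, hk, hm]
  | succ n ih =>
    have hf : ∀ (k : ℕ) (m : ℕ →₀ ℕ), m n ≠ 0 →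
        MvPowerSeries.coeff m (completeTrunc n k) = 0 := by
      intro k m hm
      rw [ih, if_neg]
      exact fun h => hm (h.1 n le_rfl)
    have hdeg : m.degree = m n + (m.erase n).degree := by
      conv_lhs => rw [← Finsupp.single_add_erase n m]
      rw [map_add, Finsupp.degree_single]
    have hz : (∀ i, n ≤ i → m.erase n i = 0) ↔ ∀ i, n + 1 ≤ i → m i = 0 := by
      constructor
      · intro h i hi
        rw [← h i (by omega), Finsupp.erase_ne (by omega)]
      · intro h i hi
        by_cases hin : i = n
        · rw [hin, Finsupp.erase_same]
        · rw [Finsupp.erase_ne hin, h i (by omega)]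
    rw [completeTrunc, map_sum]
    simp only [coeff_X_pow_mul_of_eq (hf _)]
    rw [sum_ite_eq, ih, hz, hdeg]
    by_cases h1 : ∀ i, n + 1 ≤ i → m i = 0
    · by_cases h2 : m n ≤ k
      · rw [if_pos (mem_range.2 (by omega))]
        congr 1
        rw [eq_iff_iff]
        exact and_congr_right fun _ => by omega
      · rw [if_neg (by rw [mem_range]; omega), if_neg]
        rintro ⟨_, h⟩
        omega
    · simp only [h1, false_and, if_false, ite_self]

open Classical in
theorem coeff_schurTrunc (n : ℕ) (D : YoungDiagram) (m : ℕ →₀ ℕ) :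
    MvPowerSeries.coeff m (schurTrunc n D) =
      if (∀ i, n ≤ i → m i = 0) then stripVec n (fun r => (m r : ℤ)) ⊥ D else 0 := by
  induction n generalizing D m with
  | zero =>
    have h0 : (∀ i, 0 ≤ i → m i = 0) ↔ m = 0 :=
      ⟨fun h => Finsupp.ext fun i => h i (Nat.zero_le i), fun h i _ => by simp [h]⟩
    rw [schurTrunc, stripVec, Finsupp.single_apply]
    simp only [h0]
    by_cases hm : m = 0
    · subst hm
      by_cases hD : D = ⊥
      · simp [hD]
      · simp [hD, Ne.symm hD]
    · by_cases hD : D = ⊥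
      · simp [hD, hm, MvPowerSeries.coeff_one]
      · simp [hD, hm]
  | succ n ih =>
    have hf : ∀ (D : YoungDiagram) (m : ℕ →₀ ℕ), m n ≠ 0 →
        MvPowerSeries.coeff m (schurTrunc n D) = 0 := by
      intro D m hm
      rw [ih, if_neg]
      exact fun h => hm (h n le_rfl)
    have hz : (∀ i, n ≤ i → m.erase n i = 0) ↔ ∀ i, n + 1 ≤ i → m i = 0 := by
      constructor
      · intro h i hi
        rw [← h i (by omega), Finsupp.erase_ne (by omega)]
      · intro h i hi
        by_cases hin : i = n
        · rw [hin, Finsupp.erase_same]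
        · rw [Finsupp.erase_ne hin, h i (by omega)]
    have he : (fun r : Fin n => ((m.erase n) r : ℤ)) = fun r : Fin n => (m r : ℤ) := by
      funext r
      rw [Finsupp.erase_ne (by omega)]
    rw [schurTrunc, map_sum]
    simp only [coeff_X_pow_mul_of_eq (hf _), ih, hz]
    split_ifs with h
    · rw [stripVec, pieri_apply, sum_filter]
      refine sum_congr rfl fun E hE => ?_
      have := (mem_removeStrips.1 hE).card_le
      simp only [he, Fin.val_castSucc, Fin.val_last]
      congr 1
      rw [eq_iff_iff]
      omega
    · simp

/-- The linear map that sends a diagram to its Schur function. -/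
def schurMap : (YoungDiagram →₀ ℤ) →ₗ[ℤ] MvPowerSeries ℕ ℤ :=
  Finsupp.linearCombination ℤ schurFunction

theorem schurMap_single (C : YoungDiagram) : schurMap (Finsupp.single C 1) = schurFunction C := by
  simp [schurMap]

/-- The Pieri rule. -/
theorem completeSymm_mul_schurFunction (k : ℤ) (C : YoungDiagram) :
    completeSymm k * schurFunction C = ∑ D ∈ addStrips C k, schurFunction D := by
  rcases lt_or_ge k 0 with hk | hk
  · have h1 : completeSymm k = 0 := by
      funext m
      refine if_neg ?_
      omega
    have h2 : addStrips C k = ∅ := by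
      refine eq_empty_of_forall_notMem fun D hD => ?_
      have h := mem_addStrips.1 hD
      have := h.1.card_le
      omega
    rw [h1, h2, zero_mul, sum_empty]
  obtain ⟨k, rfl⟩ := Int.eq_ofNat_of_zero_le hk
  ext m
  obtain ⟨n, hn⟩ : ∃ n, ∀ i, n ≤ i → m i = 0 := by
    refine ⟨m.support.sup id + 1, fun i hi => ?_⟩
    by_contra h
    have : id i ≤ _ := le_sup (f := id) (Finsupp.mem_support_iff.2 h)
    dsimp only [id] at this
    omega
  have hS : ∀ (D : YoungDiagram) (m' : ℕ →₀ ℕ), m' ≤ m →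
      MvPowerSeries.coeff m' (schurFunction D) = MvPowerSeries.coeff m' (schurTrunc n D) := by
    intro D m' hm'
    have : ∀ i, n ≤ i → m' i = 0 := fun i hi => Nat.eq_zero_of_le_zero (hn i hi ▸ hm' i)
    rw [coeff_schurFunction n D m' this, coeff_schurTrunc, if_pos this]
  have hH : ∀ m' : ℕ →₀ ℕ, m' ≤ m →
      MvPowerSeries.coeff m' (completeSymm k) = MvPowerSeries.coeff m' (completeTrunc n k) := by
    intro m' hm'
    have : ∀ i, n ≤ i → m' i = 0 := fun i hi => Nat.eq_zero_of_le_zero (hn i hi ▸ hm' i)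
    rw [coeff_completeTrunc]
    change (if _ then _ else _) = _
    congr 1
    rw [eq_iff_iff]
    constructor
    · exact fun h => ⟨this, by exact_mod_cast h⟩
    · exact fun h => by exact_mod_cast h.2
  have h := congrArg (MvPowerSeries.coeff m) (sum_schurTrunc_addStrips n k C)
  rw [map_sum, MvPowerSeries.coeff_mul] at h
  rw [map_sum, MvPowerSeries.coeff_mul, sum_congr rfl fun D _ => hS D m le_rfl, h]
  refine sum_congr rfl fun x hx => ?_
  have hx := mem_antidiagonal.1 hx
  rw [hS C x.2 (hx ▸ le_add_self), hH x.1 (hx ▸ le_self_add)]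

theorem schurMap_pieri (k : ℤ) (v : YoungDiagram →₀ ℤ) :
    schurMap (pieri k v) = completeSymm k * schurMap v := by
  induction v using Finsupp.induction_linear with
  | zero => simp
  | add v w hv hw => simp [map_add, hv, hw, mul_add]
  | single C z =>
    rw [show Finsupp.single C z = z • Finsupp.single C (1 : ℤ) by simp, map_smul, map_smul,
      map_smul, pieri_single, map_sum, mul_smul_comm, schurMap_single,
      completeSymm_mul_schurFunction]
    simp only [schurMap_single]

theorem schurMap_stripVec (n : ℕ) (k : Fin n → ℤ) (C : YoungDiagram) :
    schurMap (stripVec n k C) = (∏ r, completeSymm (k r)) * schurFunction C := by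
  induction n with
  | zero => simp [stripVec, schurMap_single]
  | succ n ih =>
    rw [stripVec, schurMap_pieri, ih, Fin.prod_univ_castSucc]
    ring

/-! ### Pairs of chains and Stembridge's involution -/

/-- The pairs of a chain `L` from `C` to `D` and a chain `M` from `A` to `B` with
`L (r + 1) / L r` and `M (q + 1) / M q` having the same number of cells in row `q` and row `r`,
respectively. The chain `L` encodes a tableau of shape `D / C` with entries less than `n`, and the
diagram `M q` is obtained from `A` by adding a cell to row `r` for each entry `r` in the
first `q` rows of the tableau; so the existence of `M` is the lattice word condition relative
to `A`. Exchanging `L` and `M` exchanges the roles of `A, B` and `C, D`. -/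
def PairedChains (n m : ℕ) (A B C D : YoungDiagram) :
    Set ((ℕ → YoungDiagram) × (ℕ → YoungDiagram)) :=
  {p | p.1 ∈ StripChain n C D ∧ p.2 ∈ StripChain m A B ∧
    ∀ r q, (p.1 (r + 1)).rowLen q + (p.2 q).rowLen r = (p.1 r).rowLen q + (p.2 (q + 1)).rowLen r}

/-- The number of elements of `PairedChains n m A B C D`. -/
def pairedCount (n m : ℕ) (A B C D : YoungDiagram) : ℕ := Nat.card (PairedChains n m A B C D)

theorem pairedCount_symm (n m : ℕ) (A B C D : YoungDiagram) :
    pairedCount n m A B C D = pairedCount m n C D A B := by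
  refine Nat.card_congr ((Equiv.prodComm _ _).subtypeEquiv fun p => ?_)
  simp only [PairedChains, Set.mem_ofPred_eq, Equiv.prodComm_apply, Prod.fst_swap, Prod.snd_swap]
  constructor
  · rintro ⟨h1, h2, h3⟩
    exact ⟨h2, h1, fun r q => by have := h3 q r; omega⟩
  · rintro ⟨h1, h2, h3⟩
    exact ⟨h2, h1, fun r q => by have := h3 q r; omega⟩

/-- The length of row `r` of `A` plus the number of entries `r` in the first `q` rows of the tableau
encoded by `L`. -/
def prefixRow (A : YoungDiagram) (L : ℕ → YoungDiagram) (q r : ℕ) : ℕ :=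
  A.rowLen r + ∑ i ∈ range q, ((L (r + 1)).rowLen i - (L r).rowLen i)

section Toggle

variable {n m : ℕ} {A C D : YoungDiagram} {L : ℕ → YoungDiagram}

theorem prefixRow_zero (r : ℕ) : prefixRow A L 0 r = A.rowLen r := by
  simp [prefixRow]

theorem prefixRow_succ (hL : L ∈ StripChain n C D) (q r : ℕ) :
    prefixRow A L (q + 1) r + (L r).rowLen q = prefixRow A L q r + (L (r + 1)).rowLen q := by
  have := (hL.2.2 r q).1
  rw [prefixRow, prefixRow, sum_range_succ]
  omega

theorem prefixRow_mono (hL : L ∈ StripChain n C D) (q r : ℕ) :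
    prefixRow A L q r ≤ prefixRow A L (q + 1) r := by
  have := prefixRow_succ (A := A) hL q r
  have := (hL.2.2 r q).1
  omega

theorem rowLen_eq_zero_of_chain (hL : L ∈ StripChain n C D) (hm : D.rowLen m = 0) (r : ℕ) :
    (L r).rowLen m = 0 :=
  Nat.eq_zero_of_le_zero (hm ▸ YoungDiagram.le_iff_rowLen.1 (StripChain.le hL r) m)

theorem prefixRow_last (hL : L ∈ StripChain n C D) (hm : D.rowLen m = 0) (r : ℕ) :
    (prefixRow A L m r : ℤ) = A.rowLen r + chainWeight L r := by
  rw [chainWeight, YoungDiagram.card_eq_sum_rowLen (rowLen_eq_zero_of_chain hL hm _),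
    YoungDiagram.card_eq_sum_rowLen (rowLen_eq_zero_of_chain hL hm _), prefixRow]
  push_cast
  rw [← sum_sub_distrib]
  congr 1
  refine sum_congr rfl fun q _ => ?_
  have := (hL.2.2 r q).1
  omega

theorem prefixRow_congr {L' : ℕ → YoungDiagram} {q r : ℕ}
    (h : ∀ i < q, (L' r).rowLen i = (L r).rowLen i ∧ (L' (r + 1)).rowLen i = (L (r + 1)).rowLen i) :
    prefixRow A L' q r = prefixRow A L q r := by
  rw [prefixRow, prefixRow]
  congr 1
  refine sum_congr rfl fun i hi => ?_
  rw [(h i (mem_range.1 hi)).1, (h i (mem_range.1 hi)).2]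

/-- The lattice word condition for the tableau encoded by `L`, relative to `A`. -/
def IsLattice (n : ℕ) (A : YoungDiagram) (L : ℕ → YoungDiagram) : Prop :=
  ∀ q r, r + 1 < n → prefixRow A L (q + 1) (r + 1) ≤ prefixRow A L q r

/-- The first violation of the lattice word condition occurs when the entries `r + 1` in row `q` are
read. The rows are read from top to bottom, and each row from right to left. -/
structure FirstViolation (n : ℕ) (A : YoungDiagram) (L : ℕ → YoungDiagram) (q r : ℕ) : Prop where
  lt : r + 1 < n
  viol : prefixRow A L q r < prefixRow A L (q + 1) (r + 1)
  row_min : ∀ q' < q, ∀ r', r' + 1 < n → prefixRow A L (q' + 1) (r' + 1) ≤ prefixRow A L q' r'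
  entry_max : ∀ r', r < r' → r' + 1 < n → prefixRow A L (q + 1) (r' + 1) ≤ prefixRow A L q r'

theorem FirstViolation.unique {q r q' r' : ℕ} (h : FirstViolation n A L q r)
    (h' : FirstViolation n A L q' r') : q = q' ∧ r = r' := by
  have hq : q = q' := by
    rcases lt_trichotomy q q' with hq | hq | hq
    · exact absurd (h'.row_min q hq r h.lt) (not_le.2 h.viol)
    · exact hq
    · exact absurd (h.row_min q' hq r' h'.lt) (not_le.2 h'.viol)
  subst hq
  refine ⟨rfl, ?_⟩
  rcases lt_trichotomy r r' with hr | hr | hr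
  · exact absurd (h.entry_max r' hr h'.lt) (not_le.2 h'.viol)
  · exact hr
  · exact absurd (h'.entry_max r hr h.lt) (not_le.2 h.viol)

theorem exists_firstViolation (h : ¬ IsLattice n A L) : ∃ q r, FirstViolation n A L q r := by
  classical
  have h1 : ∃ q, ∃ r, r + 1 < n ∧ prefixRow A L q r < prefixRow A L (q + 1) (r + 1) := by
    by_contra h'
    push Not at h'
    exact h fun q r => h' q r
  set q := Nat.find h1
  set s := (range n).filter fun r =>
    r + 1 < n ∧ prefixRow A L q r < prefixRow A L (q + 1) (r + 1)
  have hs : s.Nonempty := by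
    obtain ⟨r, hr⟩ := Nat.find_spec h1
    exact ⟨r, mem_filter.2 ⟨mem_range.2 (by omega), hr⟩⟩
  have hr := (mem_filter.1 (s.max'_mem hs)).2
  refine ⟨q, s.max' hs, hr.1, hr.2, fun q' hq' r' hr' => ?_, fun r' hr' hn => ?_⟩
  · by_contra h'
    exact Nat.find_min h1 hq' ⟨r', hr', not_le.1 h'⟩
  · by_contra h'
    exact absurd (s.le_max' r' (mem_filter.2 ⟨mem_range.2 (by omega), hn, not_le.1 h'⟩))
      (not_le.2 hr')

/-- The row lengths of the new diagram `L (r + 1)` after a Bender-Knuth move that exchanges the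
numbers of entries `r` and `r + 1` among the entries that are read after the first violation. In
row `q`, the entries that remain to be read end in column `L (r + 2) q + M q (r + 1) - M q r - 1`,
where `M` stands for `prefixRow A L`. -/
def toggleRow (A : YoungDiagram) (L : ℕ → YoungDiagram) (q r i : ℕ) : ℕ :=
  if i < q then (L (r + 1)).rowLen i
  else if i = q then max ((L r).rowLen q) ((L (r + 2)).rowLen (q + 1)) +
    ((L (r + 2)).rowLen q + prefixRow A L q (r + 1) - prefixRow A L q r - 1) -
      (L (r + 1)).rowLen q
  else max ((L r).rowLen i) ((L (r + 2)).rowLen (i + 1)) +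
    min ((L (r + 2)).rowLen i) ((L r).rowLen (i - 1)) - (L (r + 1)).rowLen i

/-- The chain after the Bender-Knuth move. -/
def toggle (A : YoungDiagram) (L : ℕ → YoungDiagram) (q r : ℕ) : ℕ → YoungDiagram :=
  Function.update L (r + 1) (YoungDiagram.ofRows (toggleRow A L q r))

theorem FirstViolation.prefixRow_le {q r : ℕ} (h : FirstViolation n A L q r)
    (hL : L ∈ StripChain n C D) : prefixRow A L q (r + 1) ≤ prefixRow A L q r := by
  rcases q with _ | q
  · rw [prefixRow_zero, prefixRow_zero]
    exact A.rowLen_anti _ _ (Nat.le_succ r)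
  · exact (h.row_min q (Nat.lt_succ_self q) r h.lt).trans (prefixRow_mono hL q r)

theorem FirstViolation.le_top {q r : ℕ} (h : FirstViolation n A L q r)
    (hL : L ∈ StripChain n C D) : (L (r + 1)).rowLen q + prefixRow A L q r + 1 ≤
      (L (r + 2)).rowLen q + prefixRow A L q (r + 1) := by
  have h1 := prefixRow_succ (A := A) hL q (r + 1)
  have h2 := h.viol
  have := (hL.2.2 (r + 1) q).1
  simp only [Nat.add_assoc, Nat.reduceAdd] at *
  omega

theorem FirstViolation.top_le {q r : ℕ} (h : FirstViolation n A L (q + 1) r)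
    (hL : L ∈ StripChain n C D) :
    (L (r + 2)).rowLen (q + 1) + prefixRow A L (q + 1) (r + 1) ≤
      (L r).rowLen q + prefixRow A L (q + 1) r := by
  have h1 := h.row_min q (Nat.lt_succ_self q) r h.lt
  have h2 := prefixRow_succ (A := A) hL q r
  have := (hL.2.2 (r + 1) q).2
  simp only [Nat.add_assoc, Nat.reduceAdd] at *
  omega

/-- The bounds for the new rows that make them fit between the neighbouring diagrams. -/
theorem FirstViolation.toggleRow_mem {q r : ℕ} (h : FirstViolation n A L q r)
    (hL : L ∈ StripChain n C D) (i : ℕ) :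
    (L r).rowLen i ≤ toggleRow A L q r i ∧ (L (r + 2)).rowLen (i + 1) ≤ toggleRow A L q r i ∧
      toggleRow A L q r i ≤ (L (r + 2)).rowLen i ∧
      toggleRow A L q r (i + 1) ≤ (L r).rowLen i := by
  have aux : ∀ i, (L r).rowLen i ≤ toggleRow A L q r i ∧
      (L (r + 2)).rowLen (i + 1) ≤ toggleRow A L q r i ∧
      toggleRow A L q r i ≤ (L (r + 2)).rowLen i := by
    intro i
    have h1 := hL.2.2 r i
    have h2 := hL.2.2 (r + 1) i
    have h3 := h.le_top hL
    have h4 := h.prefixRow_le hL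
    have h5 := hL.2.2 r (i - 1)
    simp only [Nat.add_assoc, Nat.reduceAdd] at *
    rw [toggleRow]
    split_ifs with hi hi'
    · omega
    · subst hi'
      omega
    · rw [Nat.sub_add_cancel (by omega)] at h5
      omega
  refine ⟨(aux i).1, (aux i).2.1, (aux i).2.2, ?_⟩
  have h1 := hL.2.2 r i
  have h2 := hL.2.2 (r + 1) i
  have h3 := hL.2.2 r (i + 1)
  have h4 := hL.2.2 (r + 1) (i + 1)
  simp only [Nat.add_assoc, Nat.reduceAdd] at *
  rw [toggleRow]
  split_ifs with hi hi'
  · omega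
  · subst hi'
    have h5 := h.le_top hL
    have h6 := h.top_le hL
    have h7 := h.prefixRow_le hL
    simp only [Nat.add_assoc, Nat.reduceAdd] at *
    omega
  · rw [Nat.add_sub_cancel]
    simp only [Nat.add_assoc, Nat.reduceAdd] at *
    omega

theorem FirstViolation.rowLen_toggle {q r : ℕ} (h : FirstViolation n A L q r)
    (hL : L ∈ StripChain n C D) (i : ℕ) :
    (toggle A L q r (r + 1)).rowLen i = toggleRow A L q r i := by
  rw [toggle, Function.update_self, YoungDiagram.rowLen_ofRows]
  · refine antitone_nat_of_succ_le fun i => ?_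
    have := h.toggleRow_mem hL i
    omega
  · obtain ⟨m, hm⟩ := D.exists_rowLen_eq_zero
    refine ⟨m, Nat.eq_zero_of_le_zero ?_⟩
    rw [← rowLen_eq_zero_of_chain hL hm (r + 2)]
    exact (h.toggleRow_mem hL m).2.2.1

theorem toggle_of_ne {q r s : ℕ} (h : s ≠ r + 1) : toggle A L q r s = L s :=
  Function.update_of_ne h _ _

theorem FirstViolation.toggle_mem {q r : ℕ} (h : FirstViolation n A L q r)
    (hL : L ∈ StripChain n C D) : toggle A L q r ∈ StripChain n C D := by
  refine ⟨?_, fun s hs => ?_, fun s => ?_⟩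
  · rw [toggle_of_ne (by omega), hL.1]
  · have := h.lt
    rw [toggle_of_ne (by omega), hL.2.1 s hs]
  · by_cases h1 : s = r + 1
    · subst h1
      intro i
      rw [toggle_of_ne (s := r + 1 + 1) (by omega), h.rowLen_toggle hL]
      have := h.toggleRow_mem hL i
      exact ⟨this.2.2.1, this.2.1⟩
    · by_cases h2 : s = r
      · subst h2
        intro i
        rw [toggle_of_ne (s := s) (by omega), h.rowLen_toggle hL, h.rowLen_toggle hL]
        have := h.toggleRow_mem hL i
        exact ⟨this.1, this.2.2.2⟩
      · rw [toggle_of_ne h1, toggle_of_ne (by omega)]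
        exact hL.2.2 s

theorem FirstViolation.prefixRow_toggle {q r : ℕ} (h : FirstViolation n A L q r)
    (hL : L ∈ StripChain n C D) {q' : ℕ} (hq : q' ≤ q) (s : ℕ) :
    prefixRow A (toggle A L q r) q' s = prefixRow A L q' s := by
  have key : ∀ s, ∀ i < q', (toggle A L q r s).rowLen i = (L s).rowLen i := by
    intro s i hi
    by_cases hs : s = r + 1
    · subst hs
      rw [h.rowLen_toggle hL, toggleRow, if_pos (by omega)]
    · rw [toggle_of_ne hs]
  exact prefixRow_congr fun i hi => ⟨key _ i hi, key _ i hi⟩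

theorem prefixRow_toggle_of_ne {q r : ℕ} (t : ℕ) {s : ℕ} (h : s ≠ r) (h' : s ≠ r + 1) :
    prefixRow A (toggle A L q r) t s = prefixRow A L t s :=
  prefixRow_congr fun i _ => by
    rw [toggle_of_ne h', toggle_of_ne (by omega)]
    exact ⟨rfl, rfl⟩

theorem FirstViolation.toggle {q r : ℕ} (h : FirstViolation n A L q r)
    (hL : L ∈ StripChain n C D) : FirstViolation n A (toggle A L q r) q r := by
  refine ⟨h.lt, ?_, fun q' hq' r' hr' => ?_, fun r' hr' hn => ?_⟩
  · have h1 := prefixRow_succ (A := A) (h.toggle_mem hL) q (r + 1)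
    have h2 := hL.2.2 r q
    have h3 := hL.2.2 (r + 1) q
    have h4 := h.le_top hL
    rw [h.prefixRow_toggle hL le_rfl, h.rowLen_toggle hL, toggleRow, if_neg (lt_irrefl _),
      if_pos rfl, toggle_of_ne (by omega)] at h1
    rw [h.prefixRow_toggle hL le_rfl]
    simp only [Nat.add_assoc, Nat.reduceAdd] at *
    omega
  · rw [h.prefixRow_toggle hL (by omega), h.prefixRow_toggle hL (by omega)]
    exact h.row_min q' hq' r' hr'
  · rw [h.prefixRow_toggle hL le_rfl, prefixRow_toggle_of_ne _ (by omega) (by omega)]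
    exact h.entry_max r' hr' hn

theorem FirstViolation.toggle_toggle {q r : ℕ} (h : FirstViolation n A L q r)
    (hL : L ∈ StripChain n C D) : _root_.toggle A (_root_.toggle A L q r) q r = L := by
  funext s
  by_cases hs : s = r + 1
  · subst hs
    refine YoungDiagram.ext_rowLen fun i => ?_
    have h0 := (h.toggle hL).rowLen_toggle (h.toggle_mem hL) i
    have h1 := hL.2.2 r i
    have h2 := hL.2.2 (r + 1) i
    have h3 := h.le_top hL
    have h4 := h.prefixRow_le hL
    have h5 := hL.2.2 r (i - 1)
    have h6 := h.toggleRow_mem hL i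
    rw [h0, toggleRow]
    rw [h.prefixRow_toggle hL le_rfl, h.prefixRow_toggle hL le_rfl,
      toggle_of_ne (s := r) (by omega), toggle_of_ne (s := r + 2) (by omega), h.rowLen_toggle hL,
      h.rowLen_toggle hL]
    simp only [Nat.add_assoc, Nat.reduceAdd] at *
    rw [toggleRow] at *
    split_ifs at * with hi hi'
    · rfl
    · subst hi'
      rw [toggleRow, if_neg (lt_irrefl _), if_pos rfl]
      omega
    · rw [Nat.sub_add_cancel (by omega)] at h5
      omega
  · rw [toggle_of_ne hs, toggle_of_ne hs]

theorem FirstViolation.prefixRow_toggle_aux {q r : ℕ} (h : FirstViolation n A L q r)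
    (hL : L ∈ StripChain n C D) (t : ℕ) (ht : q ≤ t) :
    prefixRow A (_root_.toggle A L q r) (t + 1) r + 1 + (L r).rowLen t =
      prefixRow A L (t + 1) (r + 1) + max ((L r).rowLen t) ((L (r + 2)).rowLen (t + 1)) := by
  induction t, ht using Nat.le_induction with
  | base =>
    have h0 := prefixRow_succ (A := A) (h.toggle_mem hL) q r
    have h1 := prefixRow_succ (A := A) hL q (r + 1)
    have h2 := hL.2.2 r q
    have h3 := hL.2.2 (r + 1) q
    have h4 := h.le_top hL
    rw [h.prefixRow_toggle hL le_rfl, h.rowLen_toggle hL, toggleRow, if_neg (lt_irrefl _),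
      if_pos rfl, toggle_of_ne (by omega)] at h0
    simp only [Nat.add_assoc, Nat.reduceAdd] at *
    omega
  | succ t ht ih =>
    have h0 := prefixRow_succ (A := A) (h.toggle_mem hL) (t + 1) r
    have h1 := prefixRow_succ (A := A) hL (t + 1) (r + 1)
    have h2 := hL.2.2 r (t + 1)
    have h3 := hL.2.2 (r + 1) (t + 1)
    have h5 := hL.2.2 r t
    have h6 := hL.2.2 (r + 1) t
    rw [h.rowLen_toggle hL, toggleRow, if_neg (by omega), if_neg (by omega),
      toggle_of_ne (by omega), Nat.add_sub_cancel] at h0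
    simp only [Nat.add_assoc, Nat.reduceAdd] at *
    omega

/-- The Bender-Knuth move exchanges the weights of `r` and `r + 1`, up to the shift by `ρ`. -/
theorem FirstViolation.prefixRow_toggle_last {q r : ℕ} (h : FirstViolation n A L q r)
    (hL : L ∈ StripChain n C D) (hm : D.rowLen m = 0) :
    prefixRow A (_root_.toggle A L q r) m r + 1 = prefixRow A L m (r + 1) := by
  have hq : q < m := by
    by_contra hq
    have h1 := h.le_top hL
    have h2 := h.prefixRow_le hL
    have := rowLen_eq_zero_of_chain hL (YoungDiagram.rowLen_eq_zero_of_le hm (not_lt.1 hq)) (r + 2)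
    omega
  obtain ⟨t, rfl⟩ : ∃ t, m = t + 1 := ⟨m - 1, by omega⟩
  have h1 := h.prefixRow_toggle_aux hL t (by omega)
  have h2 := rowLen_eq_zero_of_chain hL hm (r + 2)
  omega

end Toggle

/-- The signed number of permutations `w` such that `v` is the vector `B - ρ` permuted by `w`, where
`ρ = (0, 1, 2, …)`. -/
def signedMatch (n : ℕ) (B : YoungDiagram) (v : Fin n → ℤ) : ℤ :=
  ∑ w : Equiv.Perm (Fin n), Equiv.Perm.sign w *
    if ∀ r, v r = (B.rowLen (w r) : ℤ) - (w r : ℕ) then 1 else 0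

theorem signedMatch_swap {n : ℕ} (B : YoungDiagram) (v : Fin n → ℤ) {i j : Fin n} (h : i ≠ j) :
    signedMatch n B (v ∘ Equiv.swap i j) = -signedMatch n B v := by
  rw [signedMatch, signedMatch, ← sum_neg_distrib]
  refine Fintype.sum_equiv (Equiv.mulRight (Equiv.swap i j)) _ _ fun w => ?_
  rw [Equiv.coe_mulRight, Equiv.Perm.sign_mul, Equiv.Perm.sign_swap h]
  have : (∀ r, (v ∘ Equiv.swap i j) r = (B.rowLen (w r) : ℤ) - (w r : ℕ)) ↔
      ∀ r, v r = (B.rowLen ((w * Equiv.swap i j) r) : ℤ) - ((w * Equiv.swap i j) r : ℕ) := by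
    rw [← (Equiv.swap i j).forall_congr_right]
    simp
  simp only [this]
  simp

theorem signedMatch_of_strictAnti {n : ℕ} (B : YoungDiagram) (v : Fin n → ℤ) (hv : StrictAnti v) :
    signedMatch n B v = if ∀ r : Fin n, v r = (B.rowLen r : ℤ) - (r : ℕ) then 1 else 0 := by
  rw [signedMatch, sum_eq_single 1]
  · simp
    congr
  · intro w _ hw
    rw [if_neg, mul_zero]
    intro h
    refine hw ?_
    have hu : StrictAnti fun r : Fin n => (B.rowLen r : ℤ) - (r : ℕ) := by
      intro r s hrs
      have := B.rowLen_anti r s hrs.le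
      have : (r : ℕ) < s := hrs
      change (B.rowLen s : ℤ) - (s : ℕ) < (B.rowLen r : ℤ) - (r : ℕ)
      omega
    have h1 : StrictMono w := by
      intro r s hrs
      by_contra h'
      have h2 : (B.rowLen (w r) : ℤ) - (w r : ℕ) ≤ (B.rowLen (w s) : ℤ) - (w s : ℕ) :=
        hu.antitone (not_lt.1 h')
      rw [← h, ← h] at h2
      exact absurd (hv hrs) (not_lt.2 h2)
    have h2 : StrictMono w.symm := by
      intro r s hrs
      by_contra h'
      have h3 := h1.monotone (not_lt.1 h')
      rw [Equiv.apply_symm_apply, Equiv.apply_symm_apply] at h3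
      exact absurd hrs (not_lt.2 h3)
    refine Equiv.ext fun r => le_antisymm ?_ (h1.le_apply)
    have := h1.monotone (h2.le_apply (x := r))
    rwa [Equiv.apply_symm_apply] at this
  · intro h
    exact absurd (mem_univ _) h

section Stembridge

variable {n m : ℕ} {A B C D : YoungDiagram}

/-- Tableaux that violate the lattice word condition cancel in pairs. -/
theorem sum_signedMatch_eq (hm : D.rowLen m = 0) [DecidablePred (IsLattice n A)] :
    ∑ L ∈ (finite_stripChain n C D).toFinset,
        signedMatch n B (fun r : Fin n => (prefixRow A L m r : ℤ) - (r : ℕ)) =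
      ∑ L ∈ (finite_stripChain n C D).toFinset with IsLattice n A L,
        signedMatch n B (fun r : Fin n => (prefixRow A L m r : ℤ) - (r : ℕ)) := by
  rw [← sum_filter_add_sum_filter_not _ (IsLattice n A), add_eq_left]
  have hex : ∀ L : ℕ → YoungDiagram, ∃ x : ℕ × ℕ, ¬ IsLattice n A L →
      FirstViolation n A L x.1 x.2 := by
    intro L
    by_cases hL : IsLattice n A L
    · exact ⟨0, fun h => absurd hL h⟩
    · obtain ⟨q, r, h⟩ := exists_firstViolation hL
      exact ⟨(q, r), fun _ => h⟩
  choose pos hpos using hex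
  have hbad : ∀ L ∈ ((finite_stripChain n C D).toFinset.filter fun L => ¬ IsLattice n A L),
      L ∈ StripChain n C D ∧ FirstViolation n A L (pos L).1 (pos L).2 := by
    intro L hL
    rw [mem_filter, Set.Finite.mem_toFinset] at hL
    exact ⟨hL.1, hpos L hL.2⟩
  have hneg : ∀ L ∈ ((finite_stripChain n C D).toFinset.filter fun L => ¬ IsLattice n A L),
      signedMatch n B (fun r : Fin n =>
        (prefixRow A (toggle A L (pos L).1 (pos L).2) m r : ℤ) - (r : ℕ)) =
      -signedMatch n B (fun r : Fin n => (prefixRow A L m r : ℤ) - (r : ℕ)) := by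
    intro L hL
    obtain ⟨hL', h⟩ := hbad L hL
    set q := (pos L).1
    set r := (pos L).2
    have h1 := h.prefixRow_toggle_last hL' hm
    have h2 := (h.toggle hL').prefixRow_toggle_last (h.toggle_mem hL') hm
    rw [h.toggle_toggle hL'] at h2
    have hr := h.lt
    have h3 : (fun s : Fin n => (prefixRow A (toggle A L q r) m s : ℤ) - (s : ℕ)) =
        (fun s : Fin n => (prefixRow A L m s : ℤ) - (s : ℕ)) ∘
          Equiv.swap (⟨r, by omega⟩ : Fin n) ⟨r + 1, hr⟩ := by
      funext s
      rw [Function.comp_apply]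
      by_cases hs : s = ⟨r, by omega⟩
      · rw [hs, Equiv.swap_apply_left]
        dsimp only
        omega
      · by_cases hs' : s = ⟨r + 1, hr⟩
        · rw [hs', Equiv.swap_apply_right]
          dsimp only
          omega
        · rw [Equiv.swap_apply_of_ne_of_ne hs hs', prefixRow_toggle_of_ne]
          · exact fun h => hs (Fin.ext h)
          · exact fun h => hs' (Fin.ext h)
    rw [h3, signedMatch_swap _ _ (by simp [Fin.ext_iff])]
  refine sum_involution (fun L _ => toggle A L (pos L).1 (pos L).2) ?_ ?_ ?_ ?_
  · intro L hL
    rw [hneg L hL, add_neg_cancel]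
  · intro L hL h0 heq
    have h := hneg L hL
    rw [heq] at h
    omega
  · intro L hL
    obtain ⟨hL', h⟩ := hbad L hL
    rw [mem_filter, Set.Finite.mem_toFinset]
    refine ⟨h.toggle_mem hL', fun hgood => ?_⟩
    have h' := h.toggle hL'
    exact absurd (hgood _ _ h'.lt) (not_le.2 h'.viol)
  · intro L hL
    obtain ⟨hL', h⟩ := hbad L hL
    have h' := h.toggle hL'
    obtain ⟨h1, h2⟩ := h'.unique (hpos _ fun hgood =>
      absurd (hgood _ _ h'.lt) (not_le.2 h'.viol))
    rw [← h1, ← h2]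
    exact h.toggle_toggle hL'

/-- The exponents in the Jacobi-Trudi formula for the skew shape `B / A`. -/
def jacobiTrudiExponent (A B : YoungDiagram) {n : ℕ} (w : Equiv.Perm (Fin n)) (r : Fin n) : ℤ :=
  ((B.rowLen (w r) : ℤ) - (w r : ℕ)) - ((A.rowLen r : ℤ) - (r : ℕ))

theorem prefixRow_le_of_isLattice {L : ℕ → YoungDiagram} (hL : L ∈ StripChain n C D)
    (h : IsLattice n A L) {q r : ℕ} (hr : r + 1 < n) :
    prefixRow A L q (r + 1) ≤ prefixRow A L q r :=
  (prefixRow_mono hL q (r + 1)).trans (h q r hr)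

/-- The second chain of a pair whose first chain is `L`. -/
def latticeChain (n : ℕ) (A : YoungDiagram) (L : ℕ → YoungDiagram) (q : ℕ) : YoungDiagram :=
  YoungDiagram.ofRows fun r => if r < n then prefixRow A L q r else 0

theorem rowLen_latticeChain {L : ℕ → YoungDiagram} (hL : L ∈ StripChain n C D)
    (h : IsLattice n A L) (q r : ℕ) :
    (latticeChain n A L q).rowLen r = if r < n then prefixRow A L q r else 0 := by
  rw [latticeChain, YoungDiagram.rowLen_ofRows]
  · refine antitone_nat_of_succ_le fun r => ?_
    by_cases hr : r + 1 < n
    · rw [if_pos hr, if_pos (by omega)]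
      exact prefixRow_le_of_isLattice hL h hr
    · rw [if_neg hr]
      exact Nat.zero_le _
  · exact ⟨n, if_neg (lt_irrefl _)⟩

theorem pairedChains_rowLen {p : (ℕ → YoungDiagram) × (ℕ → YoungDiagram)}
    (hp : p ∈ PairedChains n m A B C D) (q r : ℕ) : (p.2 q).rowLen r = prefixRow A p.1 q r := by
  induction q with
  | zero => rw [prefixRow_zero, hp.2.1.1]
  | succ q ih =>
    have h1 := prefixRow_succ (A := A) hp.1 q r
    have h2 := hp.2.2 r q
    omega

/-- The second chain of a pair is determined by the first one, and it exists if and only if the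
lattice word condition holds. -/
theorem pairedCount_eq (hA : A.rowLen n = 0) (hB : B.rowLen n = 0) (hm : D.rowLen m = 0) :
    pairedCount n m A B C D = Nat.card {L // L ∈ StripChain n C D ∧ IsLattice n A L ∧
      ∀ r : Fin n, prefixRow A L m r = B.rowLen r} := by
  refine Nat.card_congr
    { toFun := fun p => ⟨p.1.1, p.2.1, ?_, ?_⟩
      invFun := fun L => ⟨(L.1, latticeChain n A L.1), L.2.1, ⟨?_, ?_, ?_⟩, ?_⟩
      left_inv := ?_
      right_inv := fun L => rfl }
  · intro q r _
    rw [← pairedChains_rowLen p.2, ← pairedChains_rowLen p.2]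
    exact (p.2.2.1.2.2 q r).2
  · intro r
    rw [← pairedChains_rowLen p.2, p.2.2.1.2.1 m le_rfl]
  · obtain ⟨L, hL, h1, h2⟩ := L
    refine YoungDiagram.ext_rowLen fun r => ?_
    rw [rowLen_latticeChain hL h1, prefixRow_zero]
    split_ifs with h
    · rfl
    · rw [YoungDiagram.rowLen_eq_zero_of_le hA (not_lt.1 h)]
  · obtain ⟨L, hL, h1, h2⟩ := L
    intro q hq
    refine YoungDiagram.ext_rowLen fun r => ?_
    rw [rowLen_latticeChain hL h1]
    split_ifs with h
    · rw [← h2 ⟨r, h⟩]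
      induction q, hq using Nat.le_induction with
      | base => rfl
      | succ q hq ih =>
        rw [← ih]
        have h3 := prefixRow_succ (A := A) hL q r
        have h4 := YoungDiagram.rowLen_eq_zero_of_le hm hq
        have h5 := rowLen_eq_zero_of_chain hL h4 r
        have h6 := rowLen_eq_zero_of_chain hL h4 (r + 1)
        dsimp only at ih ⊢
        omega
    · rw [YoungDiagram.rowLen_eq_zero_of_le hB (not_lt.1 h)]
  · obtain ⟨L, hL, h1, h2⟩ := L
    intro q r
    dsimp only
    rw [rowLen_latticeChain hL h1, rowLen_latticeChain hL h1, rowLen_latticeChain hL h1]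
    refine ⟨?_, ?_⟩
    · split_ifs
      · exact prefixRow_mono hL q r
      · exact le_rfl
    · by_cases hr : r + 1 < n
      · rw [if_pos hr, if_pos (by omega)]
        exact h1 q r hr
      · rw [if_neg hr]
        exact Nat.zero_le _
  · obtain ⟨L, hL, h1, h2⟩ := L
    intro r q
    dsimp only
    rw [rowLen_latticeChain hL h1, rowLen_latticeChain hL h1]
    split_ifs with hr
    · have := prefixRow_succ (A := A) hL q r
      omega
    · rw [hL.2.1 r (by omega), hL.2.1 (r + 1) (by omega)]
  · rintro ⟨⟨L, M⟩, hp⟩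
    have h1 : IsLattice n A L := by
      intro q r _
      rw [← pairedChains_rowLen hp, ← pairedChains_rowLen hp]
      exact (hp.2.1.2.2 q r).2
    refine Subtype.ext (Prod.ext rfl (funext fun q => YoungDiagram.ext_rowLen fun r => ?_))
    dsimp only
    rw [rowLen_latticeChain hp.1 h1, pairedChains_rowLen hp]
    split_ifs with h
    · rfl
    · rw [← pairedChains_rowLen hp]
      have h2 := YoungDiagram.le_iff_rowLen.1 (StripChain.le hp.2.1 q) r
      rw [YoungDiagram.rowLen_eq_zero_of_le hB (not_lt.1 h)] at h2
      exact (Nat.eq_zero_of_le_zero h2).symm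

/-- The Littlewood-Richardson rule in Stembridge's form: the alternating sum of weight
multiplicities that extracts a coefficient of a product of Schur functions counts the tableaux that
satisfy the lattice word condition. -/
theorem sum_sign_stripVec (hA : A.rowLen n = 0) (hB : B.rowLen n = 0) (hm : D.rowLen m = 0) :
    ∑ w : Equiv.Perm (Fin n), (Equiv.Perm.sign w : ℤ) *
      stripVec n (jacobiTrudiExponent A B w) C D = pairedCount n m A B C D := by
  classical
  set s := (finite_stripChain n C D).toFinset
  have hmem : ∀ L, L ∈ s ↔ L ∈ StripChain n C D := fun L => Set.Finite.mem_toFinset _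
  have hcard : ∀ P : (ℕ → YoungDiagram) → Prop,
      (Nat.card {L // L ∈ StripChain n C D ∧ P L} : ℤ) = ∑ L ∈ s, if P L then 1 else 0 := by
    intro P
    rw [sum_boole]
    congr 1
    exact Nat.subtype_card _ fun L => by rw [mem_filter, hmem]
  have h1 : ∀ w : Equiv.Perm (Fin n), stripVec n (jacobiTrudiExponent A B w) C D =
      ∑ L ∈ s, if ∀ r : Fin n, (prefixRow A L m r : ℤ) - (r : ℕ) =
        (B.rowLen (w r) : ℤ) - (w r : ℕ) then 1 else 0 := by
    intro w
    rw [stripVec_eq_card, hcard]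
    refine sum_congr rfl fun L hL => ?_
    congr 1
    rw [eq_iff_iff]
    refine forall_congr' fun r => ?_
    rw [prefixRow_last ((hmem L).1 hL) hm, jacobiTrudiExponent]
    constructor <;> intro h <;> linarith
  have h2 : ∑ w : Equiv.Perm (Fin n), (Equiv.Perm.sign w : ℤ) *
      stripVec n (jacobiTrudiExponent A B w) C D =
      ∑ L ∈ s, signedMatch n B (fun r : Fin n => (prefixRow A L m r : ℤ) - (r : ℕ)) := by
    simp only [h1, mul_sum, signedMatch]
    exact sum_comm
  rw [h2, sum_signedMatch_eq hm, pairedCount_eq hA hB hm, hcard, sum_filter]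
  refine sum_congr rfl fun L hL => ?_
  have hL := (hmem L).1 hL
  by_cases hgood : IsLattice n A L
  · rw [if_pos hgood, signedMatch_of_strictAnti]
    · congr 1
      rw [eq_iff_iff]
      constructor
      · exact fun h => ⟨hgood, fun r => by have := h r; omega⟩
      · exact fun h r => by have := h.2 r; omega
    · intro r s hrs
      have h3 : ∀ k r, r + k < n → prefixRow A L m (r + k) ≤ prefixRow A L m r := by
        intro k
        induction k with
        | zero => exact fun r _ => le_rfl
        | succ k ih =>
          exact fun r hr => (prefixRow_le_of_isLattice hL hgood hr).trans (ih r (by omega))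
      have h4 : (r : ℕ) < s := hrs
      have h5 := h3 (s - r) r (by omega)
      rw [Nat.add_sub_cancel' h4.le] at h5
      dsimp only
      omega
  · rw [if_neg hgood, if_neg fun h => hgood h.1]

end Stembridge

/-! ### Littlewood-Richardson numbers and their symmetries -/

theorem rowLen_chain_of_le {n : ℕ} {D : YoungDiagram} {L : ℕ → YoungDiagram}
    (hL : L ∈ StripChain n ⊥ D) {r q : ℕ} (h : r ≤ q) : (L r).rowLen q = 0 := by
  induction r generalizing q with
  | zero => rw [hL.1, YoungDiagram.rowLen_bot]
  | succ r ih =>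
    obtain ⟨q, rfl⟩ : ∃ q', q = q' + 1 := ⟨q - 1, by omega⟩
    have := (hL.2.2 r q).2
    rw [ih (q := q) (by omega)] at this
    omega

/-- In a pair of chains starting from the empty diagram, all entries in row `q` of the tableau
are equal to `q`. -/
theorem rowLen_pairedChains_bot {n m : ℕ} {B D : YoungDiagram}
    {p : (ℕ → YoungDiagram) × (ℕ → YoungDiagram)} (hp : p ∈ PairedChains n m ⊥ B ⊥ D) (r q : ℕ) :
    (p.1 r).rowLen q = if q < r then D.rowLen q else 0 := by
  split_ifs with h
  · have key : ∀ k r, q < r → (p.1 (r + k)).rowLen q = (p.1 r).rowLen q := by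
      intro k
      induction k with
      | zero => exact fun r _ => rfl
      | succ k ih =>
        intro r hr
        rw [← ih r hr]
        have h1 := hp.2.2 (r + k) q
        rw [rowLen_chain_of_le hp.2.1 (by omega : q ≤ r + k),
          rowLen_chain_of_le hp.2.1 (by omega : q + 1 ≤ r + k)] at h1
        rw [← Nat.add_assoc]
        omega
    rw [← key n r h, hp.1.2.1 _ (by omega)]
  · exact rowLen_chain_of_le hp.1 (not_lt.1 h)

/-- The chain that encodes the tableau of shape `D` all of whose entries in row `q` are `q`. -/
def highestChain (D : YoungDiagram) (r : ℕ) : YoungDiagram :=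
  YoungDiagram.ofRows fun q => if q < r then D.rowLen q else 0

theorem rowLen_highestChain (D : YoungDiagram) (r q : ℕ) :
    (highestChain D r).rowLen q = if q < r then D.rowLen q else 0 := by
  rw [highestChain, YoungDiagram.rowLen_ofRows]
  · refine antitone_nat_of_succ_le fun q => ?_
    have := D.rowLen_anti q (q + 1) (Nat.le_succ q)
    split_ifs <;> omega
  · exact ⟨r, if_neg (lt_irrefl _)⟩

theorem highestChain_mem {n : ℕ} {D : YoungDiagram} (h : D.rowLen n = 0) :
    highestChain D ∈ StripChain n ⊥ D := by
  refine ⟨YoungDiagram.ext_rowLen fun q => ?_, fun r hr => YoungDiagram.ext_rowLen fun q => ?_,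
    fun r q => ?_⟩
  · rw [rowLen_highestChain, if_neg (Nat.not_lt_zero _), YoungDiagram.rowLen_bot]
  · rw [rowLen_highestChain]
    split_ifs with h'
    · rfl
    · rw [YoungDiagram.rowLen_eq_zero_of_le h (by omega)]
  · rw [rowLen_highestChain, rowLen_highestChain, rowLen_highestChain]
    have := D.rowLen_anti q (q + 1) (Nat.le_succ q)
    split_ifs <;> omega

theorem swap_mem_pairedChains {n m : ℕ} {A B C D : YoungDiagram}
    {p : (ℕ → YoungDiagram) × (ℕ → YoungDiagram)} (hp : p ∈ PairedChains n m A B C D) :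
    p.swap ∈ PairedChains m n C D A B := by
  refine ⟨hp.2.1, hp.1, fun r q => ?_⟩
  have := hp.2.2 q r
  rw [Prod.fst_swap, Prod.snd_swap]
  omega

/-- The only tableau of straight shape `D` whose reading word is a lattice word has weight `D`. -/
theorem pairedCount_bot {n m : ℕ} {B D : YoungDiagram} (hB : B.rowLen n = 0) (hD : D.rowLen m = 0) :
    pairedCount n m ⊥ B ⊥ D = if B = D then 1 else 0 := by
  split_ifs with h
  · subst h
    rw [pairedCount, Nat.card_eq_one_iff_unique]
    refine ⟨⟨?_⟩, ⟨⟨(highestChain B, highestChain B), highestChain_mem hB, highestChain_mem hD,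
      fun r q => ?_⟩⟩⟩
    · rintro ⟨p, hp⟩ ⟨p', hp'⟩
      refine Subtype.ext (Prod.ext (funext fun r => YoungDiagram.ext_rowLen fun q => ?_)
        (funext fun q => YoungDiagram.ext_rowLen fun r => ?_))
      · rw [rowLen_pairedChains_bot hp, rowLen_pairedChains_bot hp']
      · have h1 := rowLen_pairedChains_bot (swap_mem_pairedChains hp) q r
        have h2 := rowLen_pairedChains_bot (swap_mem_pairedChains hp') q r
        rw [Prod.fst_swap] at h1 h2
        dsimp only
        rw [h1, h2]
    · simp only [rowLen_highestChain]
      split_ifs with h1 h2 h3 h3 h3 h3 <;> first | omega | skip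
      all_goals
        have : q = r := by omega
        rw [this]
        omega
  · rw [pairedCount, Nat.card_eq_zero]
    refine Or.inl ⟨fun ⟨p, hp⟩ => h (YoungDiagram.ext_rowLen fun q => ?_)⟩
    have h1 := rowLen_pairedChains_bot hp (q + 1) q
    have h2 := rowLen_pairedChains_bot hp q q
    have hs := swap_mem_pairedChains hp
    have h3 := rowLen_pairedChains_bot hs (q + 1) q
    have h4 := rowLen_pairedChains_bot hs q q
    have h5 := hp.2.2 q q
    rw [if_pos (Nat.lt_succ_self q)] at h1 h3
    rw [if_neg (lt_irrefl q)] at h2 h4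
    rw [Prod.fst_swap] at h3 h4
    omega

theorem stripVec_eq_zero {n : ℕ} {k : Fin n → ℤ} {r : Fin n} (h : k r < 0) (C D : YoungDiagram) :
    stripVec n k C D = 0 := by
  rw [stripVec_eq_card]
  have : IsEmpty {L // L ∈ StripChain n C D ∧ ∀ r : Fin n, chainWeight L r = k r} := by
    refine ⟨fun L => ?_⟩
    have h1 := L.2.2 r
    have h2 := (L.2.1.2.2 r).card_le
    rw [chainWeight] at h1
    omega
  rw [Nat.card_of_isEmpty, Nat.cast_zero]

open Classical in
/-- The coefficient of the monomial with exponents `k 0`, …, `k (n - 1)`, which is `0` if an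
exponent is negative. -/
def coeffInt {n : ℕ} (k : Fin n → ℤ) : MvPowerSeries ℕ ℤ →+ ℤ :=
  if ∀ r, 0 ≤ k r then
    (MvPowerSeries.coeff (∑ r : Fin n, Finsupp.single (r : ℕ) (k r).toNat)).toAddMonoidHom
  else 0

theorem coeffInt_schurFunction {n : ℕ} (k : Fin n → ℤ) (D : YoungDiagram) :
    coeffInt k (schurFunction D) = stripVec n k ⊥ D := by
  rw [coeffInt]
  split_ifs with h
  · have h1 : ∀ i, (∑ r : Fin n, Finsupp.single (r : ℕ) (k r).toNat) i =
        if hi : i < n then (k ⟨i, hi⟩).toNat else 0 := by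
      intro i
      rw [Finsupp.finsetSum_apply]
      split_ifs with hi
      · rw [sum_eq_single ⟨i, hi⟩]
        · rw [Finsupp.single_eq_same]
        · intro r _ hr
          exact Finsupp.single_eq_of_ne fun h => hr (Fin.ext h.symm)
        · exact fun h => absurd (mem_univ _) h
      · refine sum_eq_zero fun r _ => Finsupp.single_eq_of_ne ?_
        omega
    rw [LinearMap.toAddMonoidHom_coe, coeff_schurFunction n]
    · congr 2
      funext r
      rw [h1, dif_pos r.2]
      exact Int.toNat_of_nonneg (h r)
    · intro i hi
      rw [h1, dif_neg (by omega)]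
  · push Not at h
    obtain ⟨r, hr⟩ := h
    rw [AddMonoidHom.zero_apply, stripVec_eq_zero hr]

/-- Schur functions are linearly independent: an alternating sum of coefficients extracts the
multiplicity of `schurFunction E`. -/
theorem schurMap_injective : Function.Injective schurMap := by
  rw [← LinearMap.ker_eq_bot, LinearMap.ker_eq_bot']
  intro v hv
  ext E
  obtain ⟨n, hn⟩ := E.exists_rowLen_eq_zero
  have key : ∀ v : YoungDiagram →₀ ℤ, (∑ w : Equiv.Perm (Fin n), (Equiv.Perm.sign w : ℤ) *
      coeffInt (jacobiTrudiExponent ⊥ E w) (schurMap v)) = v E := by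
    intro v
    induction v using Finsupp.induction_linear with
    | zero => simp
    | add v w hv hw => simp only [map_add, mul_add, sum_add_distrib, hv, hw, Finsupp.add_apply]
    | single D z =>
      obtain ⟨m, hm⟩ := D.exists_rowLen_eq_zero
      rw [show Finsupp.single D z = z • Finsupp.single D (1 : ℤ) by simp]
      simp only [map_smul, map_zsmul, schurMap_single, coeffInt_schurFunction,
        Finsupp.smul_apply, smul_eq_mul]
      have := sum_sign_stripVec (A := ⊥) (C := ⊥) (YoungDiagram.rowLen_bot n) hn hm
      rw [pairedCount_bot hn hm] at this
      simp only [mul_left_comm _ z, ← mul_sum, this, Finsupp.single_apply, eq_comm (a := D)]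
      split_ifs <;> simp
  rw [← key v, hv]
  simp

/-- The alternating sum over permutations in the Jacobi-Trudi formula for `B / A`, applied
to `C`. -/
def altVec (n : ℕ) (A B C : YoungDiagram) : YoungDiagram →₀ ℤ :=
  ∑ w : Equiv.Perm (Fin n), (Equiv.Perm.sign w : ℤ) • stripVec n (jacobiTrudiExponent A B w) C

theorem altVec_apply {n m : ℕ} {A B C D : YoungDiagram} (hA : A.rowLen n = 0) (hB : B.rowLen n = 0)
    (hm : D.rowLen m = 0) : altVec n A B C D = pairedCount n m A B C D := by
  rw [← sum_sign_stripVec hA hB hm, altVec, Finsupp.finsetSum_apply]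
  simp only [Finsupp.smul_apply, smul_eq_mul]

theorem schurFunction_bot : schurFunction ⊥ = 1 := by
  ext m
  change ((Nat.card _ : ℕ) : ℤ) = _
  rw [MvPowerSeries.coeff_one]
  have hsub : Subsingleton (SemistandardYoungTableau ⊥) :=
    ⟨fun T T' => SemistandardYoungTableau.ext fun i j => by
      rw [T.zeros (YoungDiagram.notMem_bot _), T'.zeros (YoungDiagram.notMem_bot _)]⟩
  split_ifs with h
  · subst h
    rw [Nat.cast_eq_one, Nat.card_eq_one_iff_unique]
    exact ⟨inferInstance, ⟨default, fun i => by simp⟩⟩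
  · rw [Nat.cast_eq_zero, Nat.card_eq_zero]
    refine Or.inl ⟨fun T => h (Finsupp.ext fun i => ?_)⟩
    rw [← T.2 i]
    simp

/-- The Jacobi-Trudi formula: the operator `altVec n ⊥ E` is multiplication by the Schur function
of `E`. -/
theorem schurMap_altVec_bot {n : ℕ} {E : YoungDiagram} (hE : E.rowLen n = 0) (C : YoungDiagram) :
    schurMap (altVec n ⊥ E C) = schurFunction C * schurFunction E := by
  have h1 : ∀ C, schurMap (altVec n ⊥ E C) = (∑ w : Equiv.Perm (Fin n), (Equiv.Perm.sign w : ℤ) •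
      ∏ r, completeSymm (jacobiTrudiExponent ⊥ E w r)) * schurFunction C := by
    intro C
    simp only [altVec, map_sum, map_smul, schurMap_stripVec, sum_mul, smul_mul_assoc]
  have h2 : altVec n ⊥ E ⊥ = Finsupp.single E 1 := by
    ext D
    obtain ⟨m, hm⟩ := D.exists_rowLen_eq_zero
    rw [altVec_apply (YoungDiagram.rowLen_bot n) hE hm, pairedCount_bot hE hm,
      Finsupp.single_apply]
    split_ifs <;> rfl
  have h3 := h1 ⊥
  rw [h2, schurMap_single, schurFunction_bot, mul_one] at h3
  rw [h1 C, ← h3, mul_comm]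

theorem schurMap_lrCoeff (C E : YoungDiagram) :
    schurMap (lrCoeff C E) = schurFunction C * schurFunction E := by
  obtain ⟨n, hn⟩ := E.exists_rowLen_eq_zero
  exact (Classical.epsilon_spec (p := IsSchurExpansion (schurFunction C * schurFunction E))
    ⟨altVec n ⊥ E C, (schurMap_altVec_bot hn C).symm⟩).symm

theorem lrCoeff_comm (C E : YoungDiagram) : lrCoeff C E = lrCoeff E C := by
  rw [lrCoeff, lrCoeff, mul_comm]

/-- Littlewood-Richardson numbers count the tableaux of shape `E` whose reading words lead from `C`
to `D`. -/
theorem lrCoeff_eq_pairedCount {n m : ℕ} {C D E : YoungDiagram} (hE : E.rowLen n = 0)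
    (hD : D.rowLen m = 0) : lrCoeff C E D = pairedCount m n C D ⊥ E := by
  have h : lrCoeff C E = altVec n ⊥ E C :=
    schurMap_injective (by rw [schurMap_lrCoeff, schurMap_altVec_bot hE])
  rw [h, altVec_apply (YoungDiagram.rowLen_bot n) hE hD, pairedCount_symm]

/-- The same number, with the roles of the two chains exchanged, as an alternating sum of weight
multiplicities. -/
theorem lrCoeff_eq_sum {n : ℕ} {C D : YoungDiagram} (hC : C.rowLen n = 0) (hD : D.rowLen n = 0)
    (E : YoungDiagram) : lrCoeff C E D = ∑ w : Equiv.Perm (Fin n), (Equiv.Perm.sign w : ℤ) *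
      stripVec n (jacobiTrudiExponent C D w) ⊥ E := by
  obtain ⟨m, hm⟩ := E.exists_rowLen_eq_zero
  rw [lrCoeff_eq_pairedCount hm hD, sum_sign_stripVec hC hD hm]

theorem exists_pairedChains_of_lrCoeff_ne_zero {C D E : YoungDiagram} (h : lrCoeff C E D ≠ 0) :
    ∃ n m p, p ∈ PairedChains n m C D ⊥ E := by
  obtain ⟨n, hn⟩ := E.exists_rowLen_eq_zero
  obtain ⟨m, hm⟩ := D.exists_rowLen_eq_zero
  rw [lrCoeff_eq_pairedCount hn hm] at h
  by_contra h'
  push Not at h'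
  refine h ?_
  rw [Nat.cast_eq_zero, pairedCount, Nat.card_eq_zero]
  exact Or.inl ⟨fun p => h' m n p.1 p.2⟩

theorem le_of_lrCoeff_ne_zero {C D E : YoungDiagram} (h : lrCoeff C E D ≠ 0) : C ≤ D := by
  obtain ⟨n, m, p, hp⟩ := exists_pairedChains_of_lrCoeff_ne_zero h
  have := StripChain.ge hp.2.1 m
  rwa [hp.2.1.2.1 m le_rfl] at this

theorem rowLen_le_of_lrCoeff_ne_zero {C D E : YoungDiagram} (h : lrCoeff C E D ≠ 0) (r : ℕ) :
    D.rowLen r ≤ C.rowLen r + E.rowLen 0 := by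
  obtain ⟨n, m, p, hp⟩ := exists_pairedChains_of_lrCoeff_ne_zero h
  have key : ∀ q, (p.2 (q + 1)).rowLen r + (p.1 r).rowLen q ≤
      C.rowLen r + (p.1 (r + 1)).rowLen 0 := by
    intro q
    induction q with
    | zero =>
      have h1 := hp.2.2 r 0
      rw [hp.2.1.1] at h1
      omega
    | succ q ih =>
      have h1 := hp.2.2 r (q + 1)
      have h2 := (hp.1.2.2 r q).2
      omega
  have h1 := key m
  rw [hp.2.1.2.1 (m + 1) (Nat.le_succ m)] at h1
  have h2 := YoungDiagram.le_iff_rowLen.1 (StripChain.le hp.1 (r + 1)) 0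
  omega

/-- Weight multiplicities are symmetric. -/
theorem stripVec_comp_perm {n : ℕ} (k : Fin n → ℤ) (w : Equiv.Perm (Fin n)) (C : YoungDiagram) :
    stripVec n (k ∘ w) C = stripVec n k C := by
  refine schurMap_injective ?_
  rw [schurMap_stripVec, schurMap_stripVec]
  congr 1
  exact Equiv.prod_comp w fun r => completeSymm (k r)

/-- The expansion of skew Schur functions into Schur functions, on the level of weight
multiplicities. -/
theorem stripVec_eq_sum {n : ℕ} (k : Fin n → ℤ) (C D : YoungDiagram) (s : Finset YoungDiagram)
    (hs : ∀ E ∉ s, lrCoeff C E D = 0) :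
    stripVec n k C D = ∑ E ∈ s, lrCoeff C E D * stripVec n k ⊥ E := by
  have h : stripVec n k C = (stripVec n k ⊥).sum fun E z => z • lrCoeff C E := by
    refine schurMap_injective ?_
    have h1 : (∏ r, completeSymm (k r)) = schurMap (stripVec n k ⊥) := by
      rw [schurMap_stripVec, schurFunction_bot, mul_one]
    rw [schurMap_stripVec, h1, Finsupp.sum, map_sum]
    simp only [map_smul, schurMap_lrCoeff]
    conv_lhs => rw [schurMap, Finsupp.linearCombination_apply, Finsupp.sum, sum_mul]
    refine sum_congr rfl fun E _ => ?_
    rw [smul_mul_assoc, mul_comm]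
  rw [h, Finsupp.sum, Finsupp.finsetSum_apply]
  simp only [Finsupp.smul_apply, smul_eq_mul]
  calc ∑ E ∈ (stripVec n k ⊥).support, stripVec n k ⊥ E * lrCoeff C E D
      = ∑ E ∈ (stripVec n k ⊥).support ∪ s, stripVec n k ⊥ E * lrCoeff C E D :=
        sum_subset subset_union_left fun E _ hE => by
          rw [Finsupp.notMem_support_iff.1 hE, zero_mul]
    _ = ∑ E ∈ s, stripVec n k ⊥ E * lrCoeff C E D :=
        (sum_subset subset_union_right fun E _ hE => by rw [hs E hE, mul_zero]).symm
    _ = _ := sum_congr rfl fun E _ => mul_comm _ _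

/-- The pairing of the skew Schur functions of `B / A` and `D / C`. -/
theorem pairedCount_eq_sum {n m : ℕ} {A B C D : YoungDiagram} (hA : A.rowLen n = 0)
    (hB : B.rowLen n = 0) (hD : D.rowLen m = 0) (s : Finset YoungDiagram)
    (hs : ∀ E ∉ s, lrCoeff C E D = 0) :
    (pairedCount n m A B C D : ℤ) = ∑ E ∈ s, lrCoeff C E D * lrCoeff A E B := by
  rw [← sum_sign_stripVec hA hB hD]
  simp only [stripVec_eq_sum _ C D s hs, lrCoeff_eq_sum hA hB, mul_sum]
  rw [sum_comm]
  exact sum_congr rfl fun E _ => sum_congr rfl fun w _ => by ring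

/-- The complement of a diagram in the rectangle with `n` rows and `p` columns, rotated by
180 degrees. -/
def complement (n p : ℕ) (D : YoungDiagram) : YoungDiagram :=
  YoungDiagram.ofRows fun i => if i < n then p - D.rowLen (n - 1 - i) else 0

theorem rowLen_complement (n p : ℕ) (D : YoungDiagram) (i : ℕ) :
    (complement n p D).rowLen i = if i < n then p - D.rowLen (n - 1 - i) else 0 := by
  rw [complement, YoungDiagram.rowLen_ofRows]
  · refine antitone_nat_of_succ_le fun i => ?_
    have := D.rowLen_anti (n - 1 - (i + 1)) (n - 1 - i) (by omega)
    split_ifs <;> omega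
  · exact ⟨n, if_neg (lt_irrefl _)⟩

theorem complement_complement {n p : ℕ} {D : YoungDiagram} (hn : D.rowLen n = 0)
    (hp : D.rowLen 0 ≤ p) : complement n p (complement n p D) = D := by
  refine YoungDiagram.ext_rowLen fun i => ?_
  rw [rowLen_complement]
  split_ifs with h
  · rw [rowLen_complement, if_pos (by omega), show n - 1 - (n - 1 - i) = i by omega]
    have := D.rowLen_anti 0 i (Nat.zero_le i)
    omega
  · rw [YoungDiagram.rowLen_eq_zero_of_le hn (by omega)]

theorem card_complement {n p : ℕ} {D : YoungDiagram} (hn : D.rowLen n = 0) (hp : D.rowLen 0 ≤ p) :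
    (complement n p D).card + D.card = n * p := by
  rw [YoungDiagram.card_eq_sum_rowLen hn, YoungDiagram.card_eq_sum_rowLen (m := n)
    (by rw [rowLen_complement, if_neg (lt_irrefl _)]), ← sum_range_reflect D.rowLen,
    ← sum_add_distrib, ← smul_eq_mul, ← card_range n, ← sum_const, card_range]
  refine sum_congr rfl fun i hi => ?_
  rw [rowLen_complement, if_pos (mem_range.1 hi)]
  have := D.rowLen_anti 0 (n - 1 - i) (Nat.zero_le _)
  omega

theorem isHStrip_complement {n p : ℕ} {C D : YoungDiagram} (h : IsHStrip C D) :
    IsHStrip (complement n p C) (complement (n + 1) p D) := by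
  intro i
  rw [rowLen_complement, rowLen_complement, rowLen_complement]
  by_cases hi : i < n
  · have h1 := (h (n - 1 - i)).1
    have h2 := (h (n - 1 - i)).2
    rw [if_pos hi, if_pos (by omega), if_pos (by omega),
      show n + 1 - 1 - i = n - 1 - i + 1 by omega, show n + 1 - 1 - (i + 1) = n - 1 - i by omega]
    omega
  · rw [if_neg hi, if_neg (by omega : ¬ i + 1 < n + 1)]
    exact ⟨Nat.zero_le _, le_rfl⟩

/-- Taking complements of all diagrams in a chain replaces the weight `k` by `p - k`. -/
theorem complement_chain_mem {n p : ℕ} {D : YoungDiagram} (hp : D.rowLen 0 ≤ p)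
    {k : Fin n → ℤ} {L : ℕ → YoungDiagram}
    (hL : L ∈ StripChain n ⊥ D ∧ ∀ r : Fin n, chainWeight L r = k r) :
    (fun r => complement (min r n) p (L r)) ∈ StripChain n ⊥ (complement n p D) ∧
      ∀ r : Fin n, chainWeight (fun r => complement (min r n) p (L r)) r = p - k r := by
  obtain ⟨hL, hw⟩ := hL
  refine ⟨⟨?_, fun r hr => ?_, fun r => ?_⟩, fun r => ?_⟩
  · refine YoungDiagram.ext_rowLen fun i => ?_
    rw [rowLen_complement, Nat.zero_min, if_neg (Nat.not_lt_zero _), YoungDiagram.rowLen_bot]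
  · dsimp only
    rw [min_eq_right hr, hL.2.1 r hr]
  · dsimp only
    by_cases hr : r < n
    · rw [min_eq_left hr.le, min_eq_left hr]
      exact isHStrip_complement (hL.2.2 r)
    · rw [min_eq_right (by omega), min_eq_right (by omega), hL.2.1 r (by omega),
        hL.2.1 (r + 1) (by omega)]
      exact IsHStrip.refl _
  · have hr := r.2
    have h0 : ∀ s, (L s).rowLen 0 ≤ p := fun s =>
      (YoungDiagram.le_iff_rowLen.1 (StripChain.le hL s) 0).trans hp
    have h1 := card_complement (rowLen_chain_of_le hL le_rfl) (h0 r)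
    have h2 := card_complement (rowLen_chain_of_le hL le_rfl) (h0 (r + 1))
    have h3 := hw r
    rw [chainWeight] at h3 ⊢
    rw [min_eq_left hr.le, min_eq_left (show (r : ℕ) + 1 ≤ n from hr)]
    rw [Nat.succ_mul] at h2
    omega

/-- Duality of weight multiplicities: passing to the complement in a rectangle with `p` columns
replaces the weight `k` by `p - k`. -/
theorem stripVec_complement {n p : ℕ} {D : YoungDiagram} (hn : D.rowLen n = 0)
    (hp : D.rowLen 0 ≤ p) (k : Fin n → ℤ) :
    stripVec n k ⊥ D = stripVec n (fun r => p - k r) ⊥ (complement n p D) := by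
  rw [stripVec_eq_card, stripVec_eq_card]
  congr 1
  have h0 : (complement n p D).rowLen 0 ≤ p := by
    rw [rowLen_complement]
    split_ifs <;> omega
  have hinv : ∀ {D : YoungDiagram} {L : ℕ → YoungDiagram}, D.rowLen 0 ≤ p → D.rowLen n = 0 →
      L ∈ StripChain n ⊥ D →
      (fun r => complement (min r n) p (complement (min r n) p (L r))) = L := by
    intro D L hp hn hL
    funext r
    refine complement_complement ?_ ((YoungDiagram.le_iff_rowLen.1 (StripChain.le hL r) 0).trans hp)
    rcases le_total r n with h | h
    · rw [min_eq_left h, rowLen_chain_of_le hL le_rfl]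
    · rw [min_eq_right h, hL.2.1 r h, hn]
  refine Nat.card_congr
    { toFun := fun L => ⟨_, complement_chain_mem hp L.2⟩
      invFun := fun L => ⟨fun r => complement (min r n) p (L.1 r), ?_⟩
      left_inv := fun L => Subtype.ext (hinv hp hn L.2.1)
      right_inv := fun L => Subtype.ext (hinv h0 (by rw [rowLen_complement, if_neg (lt_irrefl _)])
        L.2.1) }
  have h := complement_chain_mem h0 L.2
  rw [complement_complement hn hp] at h
  refine ⟨h.1, fun r => ?_⟩
  rw [h.2]
  ring

theorem coe_rowLen_complement_rev {n p : ℕ} {D : YoungDiagram} (hp : D.rowLen 0 ≤ p) (r : Fin n) :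
    ((complement n p D).rowLen r : ℤ) = p - D.rowLen (Fin.rev r) := by
  have := D.rowLen_anti 0 (n - 1 - r) (Nat.zero_le _)
  rw [rowLen_complement, if_pos r.2, Fin.val_rev, show n - (r + 1) = n - 1 - r by omega]
  omega

/-- The symmetry of Littlewood-Richardson numbers that comes from the intersection form of a
Grassmannian. -/
theorem lrCoeff_complement {n p : ℕ} {C D E : YoungDiagram} (hD : D.rowLen n = 0)
    (hD' : D.rowLen 0 ≤ p) (hE : E.rowLen n = 0) (hE' : E.rowLen 0 ≤ p) :
    lrCoeff C E (complement n p D) = lrCoeff C D (complement n p E) := by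
  have hn : ∀ D, (complement n p D).rowLen n = 0 := fun D => by
    rw [rowLen_complement, if_neg (lt_irrefl _)]
  rw [lrCoeff_comm C E, lrCoeff_comm C D, lrCoeff_eq_sum hE (hn D), lrCoeff_eq_sum hD (hn E)]
  refine sum_nbij' (fun w => Fin.revPerm * w⁻¹ * Fin.revPerm)
    (fun w => Fin.revPerm * w⁻¹ * Fin.revPerm) (fun _ _ => mem_univ _) (fun _ _ => mem_univ _)
    ?_ ?_ ?_
  · intro w _
    ext r
    simp
  · intro w _
    ext r
    simp
  · intro w _
    congr 1
    · simp only [Equiv.Perm.sign_mul, Equiv.Perm.sign_inv]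
      rw [mul_comm (Equiv.Perm.sign Fin.revPerm), mul_assoc, Int.units_mul_self, mul_one]
    · rw [← stripVec_comp_perm (jacobiTrudiExponent E (complement n p D) w)
        (w⁻¹ * Fin.revPerm)]
      congr 2
      funext r
      have h1 : w (w⁻¹ (Fin.rev r)) = Fin.rev r := w.apply_symm_apply _
      simp only [Function.comp_apply, jacobiTrudiExponent, Equiv.Perm.mul_apply,
        Fin.revPerm_apply, h1]
      rw [coe_rowLen_complement_rev hD', coe_rowLen_complement_rev hE', Fin.rev_rev, Fin.rev_rev]
      have h2 := Fin.val_rev r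
      have h3 := Fin.val_rev (w⁻¹ (Fin.rev r))
      have h4 := (w⁻¹ (Fin.rev r)).2
      have h5 := r.2
      omega

/-- The symmetry of Littlewood-Richardson numbers that comes from duality of representations of
the general linear group of rank `n`. -/
theorem lrCoeff_dual {n p : ℕ} {t : ℤ} {A B D E F : YoungDiagram} (hA : A.rowLen n = 0)
    (hA' : A.rowLen 0 ≤ p) (hB : B.rowLen n = 0) (hD : D.rowLen n = 0) (hE : E.rowLen n = 0)
    (hF : F.rowLen n = 0) (hFE : ∀ r < n, (F.rowLen r : ℤ) = E.rowLen r + t)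
    (hDB : ∀ r < n, (D.rowLen r : ℤ) = B.rowLen r + p - t) :
    lrCoeff A B F = lrCoeff (complement n p A) E D := by
  rw [lrCoeff_comm A B, lrCoeff_comm _ E, lrCoeff_eq_sum hB hF, lrCoeff_eq_sum hE hD]
  refine sum_nbij' (fun w => w⁻¹) (fun w => w⁻¹) (fun _ _ => mem_univ _) (fun _ _ => mem_univ _)
    (fun w _ => inv_inv w) (fun w _ => inv_inv w) ?_
  intro w _
  rw [Equiv.Perm.sign_inv, stripVec_complement hA hA',
    ← stripVec_comp_perm (jacobiTrudiExponent E D w⁻¹) w]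
  congr 3
  funext r
  have h1 : w⁻¹ (w r) = r := w.symm_apply_apply r
  simp only [Function.comp_apply, jacobiTrudiExponent, h1]
  rw [hFE _ (w r).2, hDB _ r.2]
  ring

/-! ### Diagrams of binary strings -/

theorem rowLen_stringDiagram (l : List Bool) (r : ℕ) :
    (stringDiagram l).rowLen r = (rowLengths l).getD r 0 := by
  by_cases h : r < (rowLengths l).length
  · rw [stringDiagram, List.getD_eq_getElem _ _ h]
    exact YoungDiagram.rowLen_ofRowLens (hw := sortedGE_rowLengths l) ⟨r, h⟩
  · rw [List.getD_eq_default _ _ (not_lt.1 h)]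
    by_contra h0
    have : (r, 0) ∈ stringDiagram l := YoungDiagram.mem_iff_lt_rowLen.2 (Nat.pos_of_ne_zero h0)
    obtain ⟨h1, -⟩ := YoungDiagram.mem_ofRowLens.1 this
    exact h h1

@[simp]
theorem rowLen_stringDiagram_nil (r : ℕ) : (stringDiagram []).rowLen r = 0 := by
  simp [rowLen_stringDiagram, rowLengths]

@[simp]
theorem rowLen_stringDiagram_false_cons (l : List Bool) (r : ℕ) :
    (stringDiagram (false :: l)).rowLen r = (stringDiagram l).rowLen r := by
  simp [rowLen_stringDiagram, rowLengths]

@[simp]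
theorem rowLen_stringDiagram_true_cons_zero (l : List Bool) :
    (stringDiagram (true :: l)).rowLen 0 = l.count false := by
  simp [rowLen_stringDiagram, rowLengths]

@[simp]
theorem rowLen_stringDiagram_true_cons_succ (l : List Bool) (r : ℕ) :
    (stringDiagram (true :: l)).rowLen (r + 1) = (stringDiagram l).rowLen r := by
  simp [rowLen_stringDiagram, rowLengths]

theorem rowLen_stringDiagram_append (l l' : List Bool) (r : ℕ) :
    (stringDiagram (l ++ l')).rowLen r = if r < l.count true then
      (stringDiagram l).rowLen r + l'.count false
    else (stringDiagram l').rowLen (r - l.count true) := by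
  induction l generalizing r with
  | nil => simp
  | cons b l ih =>
    cases b with
    | false => simp [ih]
    | true =>
      cases r with
      | zero => simp
      | succ r => simp [ih]

theorem rowLen_stringDiagram_count (l : List Bool) :
    (stringDiagram l).rowLen (l.count true) = 0 := by
  induction l with
  | nil => simp
  | cons b l ih => cases b <;> simpa using ih

theorem rowLen_stringDiagram_le (l : List Bool) (r : ℕ) :
    (stringDiagram l).rowLen r ≤ l.count false := by
  induction l generalizing r with
  | nil => simp
  | cons b l ih =>
    cases b with
    | false => simpa using (ih r).trans (Nat.le_succ _)
    | true =>
      cases r with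
      | zero => simp
      | succ r => simpa using ih r

/-- Reversing a string replaces its diagram by the complement in a rectangle. -/
theorem stringDiagram_reverse (l : List Bool) :
    stringDiagram l.reverse = complement (l.count true) (l.count false) (stringDiagram l) := by
  refine YoungDiagram.ext_rowLen fun r => ?_
  rw [rowLen_complement]
  induction l with
  | nil => simp
  | cons b l ih =>
    rw [List.reverse_cons, rowLen_stringDiagram_append, ih, List.count_reverse]
    cases b with
    | false =>
      have := rowLen_stringDiagram_le l (l.count true - 1 - r)
      by_cases h : r < l.count true
      · simp [h]
        omega
      · simp [h]
    | true =>
      by_cases h : r < l.count true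
      · have h1 : List.count true l - r = List.count true l - 1 - r + 1 := by omega
        simp [h, h1, Nat.lt_succ_of_lt h]
      · rcases Nat.eq_or_lt_of_le (not_lt.1 h) with h2 | h2
        · subst h2
          simp
        · obtain ⟨i, rfl⟩ := Nat.exists_eq_add_of_lt h2
          have h3 : l.count true + i + 1 - l.count true = i + 1 := by omega
          simp [h3, not_le.2 h2, h]

/-- The diagram of a string, and the content of the string, determine the string. -/
theorem stringDiagram_injOn (n₀ n₁ : ℕ) :
    Set.InjOn stringDiagram (binaryStrings n₀ n₁ : Set (List Bool)) := by
  intro l hl l' hl' h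
  rw [mem_coe, mem_binaryStrings] at hl hl'
  have h0 : ∀ r, (stringDiagram l).rowLen r = (stringDiagram l').rowLen r := fun r => by rw [h]
  clear h
  induction l generalizing l' n₀ n₁ with
  | nil =>
    cases l' with
    | nil => rfl
    | cons b l' => cases b <;> simp at hl hl' <;> omega
  | cons b l ih =>
    cases l' with
    | nil => cases b <;> simp at hl hl' <;> omega
    | cons b' l' =>
      have h1 := h0 0
      have h2 := rowLen_stringDiagram_le l 0
      have h3 := rowLen_stringDiagram_le l' 0
      cases b <;> cases b' <;> simp at hl hl' h1 h0
      · rw [ih (n₀ - 1) n₁ (l' := l') (by omega) (by omega) h0]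
      · omega
      · omega
      · rw [ih n₀ (n₁ - 1) (l' := l') (by omega) (by omega) fun r => by simpa using h0 (r + 1)]

theorem exists_stringDiagram_eq {n₀ n₁ : ℕ} {D : YoungDiagram} (hn : D.rowLen n₁ = 0)
    (h0 : D.rowLen 0 ≤ n₀) : ∃ l ∈ binaryStrings n₀ n₁, stringDiagram l = D := by
  simp only [mem_binaryStrings]
  induction n₁ generalizing n₀ D with
  | zero =>
    refine ⟨zeros n₀, by simp [List.count_replicate], YoungDiagram.ext_rowLen fun r => ?_⟩
    rw [YoungDiagram.rowLen_eq_zero_of_le hn (Nat.zero_le r)]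
    have := rowLen_stringDiagram_count (zeros n₀)
    simp only [List.count_replicate] at this
    exact YoungDiagram.rowLen_eq_zero_of_le this (by simp)
  | succ n₁ ih =>
    have ha : Antitone fun q => D.rowLen (q + 1) := fun q q' h => D.rowLen_anti _ _ (by omega)
    have hf : ∃ m, D.rowLen (m + 1) = 0 := ⟨n₁, hn⟩
    obtain ⟨l, hl, hD⟩ := ih (n₀ := D.rowLen 0)
      (D := YoungDiagram.ofRows fun q => D.rowLen (q + 1))
      (by rw [YoungDiagram.rowLen_ofRows ha hf, hn])
      (by rw [YoungDiagram.rowLen_ofRows ha hf]; exact D.rowLen_anti 0 1 (Nat.zero_le 1))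
    refine ⟨zeros (n₀ - D.rowLen 0) ++ true :: l, ?_, YoungDiagram.ext_rowLen fun r => ?_⟩
    · simp [List.count_replicate, hl]
      omega
    · rw [rowLen_stringDiagram_append]
      cases r with
      | zero => simp [List.count_replicate, hl]
      | succ r => simp [List.count_replicate, hD, YoungDiagram.rowLen_ofRows ha hf]

/-! ### Interlacing positions of digits -/

/-- If `D` is the diagram of a string with `c₀` digits `0` and `m` digits `1`, then
`onesBefore c₀ m D j` is the number of digits `1` among the first `j` digits, the digit `1`
that corresponds to row `k` being at position `k + c₀ - D.rowLen k`. -/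
def onesBefore (c₀ m : ℕ) (D : YoungDiagram) (j : ℕ) : ℕ :=
  ((range m).filter fun k => k + c₀ < j + D.rowLen k).card

theorem lt_onesBefore_iff {c₀ m : ℕ} {D : YoungDiagram} {j k : ℕ} (hk : k < m) :
    k < onesBefore c₀ m D j ↔ k + c₀ < j + D.rowLen k := by
  constructor
  · contrapose!
    intro h
    have : (range m).filter (fun k => k + c₀ < j + D.rowLen k) ⊆ range k := by
      intro i hi
      rw [mem_filter] at hi
      rw [mem_range]
      by_contra hik
      have := D.rowLen_anti k i (by omega)
      omega
    exact (card_le_card this).trans_eq (card_range k)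
  · intro h
    have : range (k + 1) ⊆ (range m).filter fun k => k + c₀ < j + D.rowLen k := by
      intro i hi
      rw [mem_range] at hi
      rw [mem_filter, mem_range]
      have := D.rowLen_anti i k (by omega)
      omega
    exact Nat.lt_of_succ_le ((card_range (k + 1)).symm.trans_le (card_le_card this))

theorem onesBefore_le (c₀ m : ℕ) (D : YoungDiagram) (j : ℕ) : onesBefore c₀ m D j ≤ m :=
  (card_filter_le _ _).trans_eq (card_range m)

theorem onesBefore_mono (c₀ m : ℕ) (D : YoungDiagram) : Monotone (onesBefore c₀ m D) := by
  intro j j' h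
  refine card_le_card fun i hi => ?_
  rw [mem_filter] at hi ⊢
  exact ⟨hi.1, by omega⟩

theorem onesBefore_eq {c₀ m j : ℕ} (D : YoungDiagram) (hj : c₀ + m ≤ j) :
    onesBefore c₀ m D j = m := by
  rw [onesBefore, filter_true_of_mem, card_range]
  intro k hk
  rw [mem_range] at hk
  omega

theorem onesBefore_zero {c₀ m : ℕ} {D : YoungDiagram} (h0 : D.rowLen 0 ≤ c₀) :
    onesBefore c₀ m D 0 = 0 := by
  rw [onesBefore, card_eq_zero, filter_eq_empty_iff]
  intro k _
  have := D.rowLen_anti 0 k (Nat.zero_le k)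
  omega

theorem onesBefore_stringDiagram {c₀ m : ℕ} {l : List Bool} (hl : l ∈ binaryStrings c₀ m) (j : ℕ) :
    onesBefore c₀ m (stringDiagram l) j = (l.take j).count true := by
  rw [mem_binaryStrings] at hl
  obtain ⟨rfl, rfl⟩ := hl
  induction l generalizing j with
  | nil => simp [onesBefore]
  | cons b l ih =>
    cases j with
    | zero => rw [onesBefore_zero (rowLen_stringDiagram_le _ _)]; simp
    | succ j =>
      have ih := ih j
      simp only [onesBefore, card_filter] at ih ⊢
      cases b with
      | false =>
        simp only [List.take_succ_cons, rowLen_stringDiagram_false_cons, ← Nat.add_assoc,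
          List.count_cons_self, List.count_cons_of_ne (by decide : false ≠ true), ← ih]
        refine sum_congr rfl fun k _ => if_congr ?_ rfl rfl
        omega
      | true =>
        simp only [List.take_succ_cons, List.count_cons_self,
          List.count_cons_of_ne (by decide : true ≠ false), ← ih]
        rw [sum_range_succ', rowLen_stringDiagram_true_cons_zero, if_pos (by omega)]
        simp only [rowLen_stringDiagram_true_cons_succ]
        congr 1
        refine sum_congr rfl fun k _ => if_congr ?_ rfl rfl
        omega

theorem rowLen_le_of_onesBefore_le {c₀ m : ℕ} {C D : YoungDiagram} (hC : C.rowLen m = 0)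
    (hC' : C.rowLen 0 ≤ c₀)
    (h : ∀ j ≤ c₀ + m, onesBefore c₀ m C j ≤ onesBefore c₀ m D j) (k : ℕ) :
    C.rowLen k ≤ D.rowLen k := by
  rcases lt_or_ge k m with hk | hk
  · have h0 := C.rowLen_anti 0 k (Nat.zero_le k)
    have h1 := (lt_onesBefore_iff (c₀ := c₀) (D := C) (j := k + c₀ - C.rowLen k + 1) hk).2
      (by omega)
    have h2 := (lt_onesBefore_iff hk).1 (h1.trans_le (h _ (by omega)))
    omega
  · rw [YoungDiagram.rowLen_eq_zero_of_le hC hk]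
    exact Nat.zero_le _

theorem eq_of_onesBefore_eq {c₀ m : ℕ} {C D : YoungDiagram} (hC : C.rowLen m = 0)
    (hC' : C.rowLen 0 ≤ c₀) (hD : D.rowLen m = 0) (hD' : D.rowLen 0 ≤ c₀)
    (h : ∀ j ≤ c₀ + m, onesBefore c₀ m C j = onesBefore c₀ m D j) : C = D :=
  YoungDiagram.ext_rowLen fun k => le_antisymm
    (rowLen_le_of_onesBefore_le hC hC' (fun j hj => (h j hj).le) k)
    (rowLen_le_of_onesBefore_le hD hD' (fun j hj => (h j hj).ge) k)

/-- Horizontal strips correspond to interlacing sets of positions. -/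
theorem isHStrip_of_onesBefore {c₀ m : ℕ} {C D : YoungDiagram} (hC : C.rowLen m = 0)
    (hC' : C.rowLen 0 ≤ c₀) (hD : D.rowLen m = 0) (hD' : D.rowLen 0 ≤ c₀)
    (h : ∀ j ≤ c₀ + m, onesBefore c₀ m C j ≤ onesBefore c₀ m D j)
    (h' : ∀ j < c₀ + m, onesBefore c₀ m D (j + 1) ≤ onesBefore c₀ m C j + 1) : IsHStrip C D := by
  refine fun k => ⟨rowLen_le_of_onesBefore_le hC hC' h k, ?_⟩
  rcases lt_or_ge (k + 1) m with hk | hk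
  · have h0 := D.rowLen_anti 0 (k + 1) (Nat.zero_le _)
    have h1 := (lt_onesBefore_iff (c₀ := c₀) (D := D) (j := k + 1 + c₀ - D.rowLen (k + 1) + 1) hk).2
      (by omega)
    have h2 := h' (k + 1 + c₀ - D.rowLen (k + 1)) (by omega)
    have h3 := (lt_onesBefore_iff (c₀ := c₀) (D := C) (j := k + 1 + c₀ - D.rowLen (k + 1))
      (by omega : k < m)).1 (by omega)
    omega
  · rw [YoungDiagram.rowLen_eq_zero_of_le hD hk]
    exact Nat.zero_le _

theorem onesBefore_le_of_isHStrip {C D : YoungDiagram} (h : IsHStrip C D) (c₀ m j : ℕ) :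
    onesBefore c₀ m C j ≤ onesBefore c₀ m D j := by
  refine card_le_card fun k hk => ?_
  rw [mem_filter] at hk ⊢
  have := (h k).1
  exact ⟨hk.1, by omega⟩

theorem onesBefore_succ_le_of_isHStrip {C D : YoungDiagram} (h : IsHStrip C D) (c₀ m j : ℕ) :
    onesBefore c₀ m D (j + 1) ≤ onesBefore c₀ m C j + 1 := by
  by_contra! hlt
  have hm := onesBefore_le c₀ m D (j + 1)
  have h1 := (lt_onesBefore_iff (by omega)).1 (by omega :
    onesBefore c₀ m C j + 1 < onesBefore c₀ m D (j + 1))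
  have h2 := mt (lt_onesBefore_iff (c₀ := c₀) (D := C) (j := j)
    (by omega : onesBefore c₀ m C j < m)).2 (lt_irrefl _)
  have h3 := (h (onesBefore c₀ m C j)).2
  omega

/-- The sum counts, for each digit `1`, the numbers `i < j` greater than its position. -/
theorem sum_onesBefore {c₀ m : ℕ} {D : YoungDiagram} (h0 : D.rowLen 0 ≤ c₀) (j : ℕ) :
    ∑ i ∈ range j, onesBefore c₀ m D i = ∑ k ∈ range m, (j + D.rowLen k - (k + c₀ + 1)) := by
  simp only [onesBefore, card_filter]
  rw [sum_comm]
  refine sum_congr rfl fun k _ => ?_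
  have := D.rowLen_anti 0 k (Nat.zero_le k)
  induction j with
  | zero => rw [range_zero, sum_empty]; omega
  | succ j ih =>
    rw [sum_range_succ, ih]
    split_ifs <;> omega

/-! ### Particle paths and the lattice word condition -/

theorem sum_range_add_self (f : ℕ → ℕ) (q : ℕ) :
    ∑ k ∈ range q, f k + q = ∑ k ∈ range q, (f k + 1) := by
  simp [sum_add_distrib]

section Moves

variable {n m c₀ : ℕ} {A C D : YoungDiagram} {L : ℕ → YoungDiagram}

/-- In the puzzle that corresponds to the chain `L`, the number of the first `j` strips in which
the `r`-th particle keeps its distance from the upper boundary, instead of moving horizontally. The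
summands are `0` or `1` if consecutive diagrams differ by horizontal strips. -/
def moves (c₀ m : ℕ) (L : ℕ → YoungDiagram) (r j : ℕ) : ℕ :=
  ∑ i ∈ range j, (onesBefore c₀ m (L (r + 1)) (i + 1) - onesBefore c₀ m (L r) i)

theorem moves_succ (r j : ℕ) : moves c₀ m L r (j + 1) =
    moves c₀ m L r j + (onesBefore c₀ m (L (r + 1)) (j + 1) - onesBefore c₀ m (L r) j) :=
  sum_range_succ _ _

theorem rowLen_zero_le_of_mem (hL : L ∈ StripChain n C D) (h0 : D.rowLen 0 ≤ c₀) (r : ℕ) :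
    (L r).rowLen 0 ≤ c₀ :=
  (YoungDiagram.le_iff_rowLen.1 (StripChain.le hL r) 0).trans h0

theorem moves_le (hL : L ∈ StripChain n C D) (r j : ℕ) : moves c₀ m L r j ≤ j := by
  refine (sum_le_card_nsmul _ _ 1 fun i _ => ?_).trans_eq (by simp)
  have := onesBefore_succ_le_of_isHStrip (hL.2.2 r) c₀ m i
  omega

theorem moves_eq (hL : L ∈ StripChain n C D) (h0 : D.rowLen 0 ≤ c₀) (r j : ℕ) :
    moves c₀ m L r j = ∑ k ∈ range m,
      (j + (L (r + 1)).rowLen k - (k + c₀) - (j + (L r).rowLen k - (k + c₀ + 1))) := by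
  have h1 : moves c₀ m L r j + ∑ i ∈ range j, onesBefore c₀ m (L r) i =
      ∑ i ∈ range (j + 1), onesBefore c₀ m (L (r + 1)) i := by
    rw [moves, ← sum_add_distrib, sum_range_succ', onesBefore_zero (rowLen_zero_le_of_mem hL h0 _)]
    refine sum_congr rfl fun i _ => Nat.sub_add_cancel ?_
    exact (onesBefore_le_of_isHStrip (hL.2.2 r) c₀ m i).trans
      (onesBefore_mono _ _ _ (Nat.le_succ i))
  rw [sum_onesBefore (rowLen_zero_le_of_mem hL h0 _),
    sum_onesBefore (rowLen_zero_le_of_mem hL h0 _)] at h1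
  refine Nat.add_right_cancel (h1.trans ?_)
  rw [← sum_add_distrib]
  refine sum_congr rfl fun k _ => ?_
  have := (hL.2.2 r k).1
  omega

/-- At the position of the digit `1` that belongs to row `q` of `L (r + 1)`, the sum defining
`moves` involves the first `q` rows only, and is the number of entries `r` in them, up to a
constant. -/
theorem moves_position (hL : L ∈ StripChain n C D) (h0 : D.rowLen 0 ≤ c₀) (r : ℕ) {q : ℕ}
    (hq : q < m) : prefixRow A L q r + q =
      A.rowLen r + moves c₀ m L r (q + c₀ - (L (r + 1)).rowLen q) := by
  have hb := rowLen_zero_le_of_mem hL h0 (r + 1)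
  have hq0 := (L (r + 1)).rowLen_anti 0 q (Nat.zero_le q)
  rw [moves_eq hL h0, prefixRow, Nat.add_assoc]
  congr 1
  rw [← sum_subset (range_mono hq.le)]
  · rw [sum_range_add_self]
    refine sum_congr rfl fun k hk => ?_
    rw [mem_range] at hk
    have h1 := hL.2.2 r k
    have h2 := (L (r + 1)).rowLen_anti (k + 1) q hk
    omega
  · intro k _ hk
    rw [mem_range, not_lt] at hk
    have h1 := hL.2.2 r k
    have h2 := (L (r + 1)).rowLen_anti q k hk
    omega

/-- At the same position as in `moves_position`, the number of moves of the next particle counts the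
entries `r + 1` in the first `q + 1` rows. -/
theorem moves_succ_position (hL : L ∈ StripChain n C D) (h0 : D.rowLen 0 ≤ c₀) (r : ℕ) {q : ℕ}
    (hq : q < m) : prefixRow A L (q + 1) (r + 1) + q =
      A.rowLen (r + 1) + moves c₀ m L (r + 1) (q + c₀ - (L (r + 1)).rowLen q) := by
  have hb := rowLen_zero_le_of_mem hL h0 (r + 1)
  have hq0 := (L (r + 1)).rowLen_anti 0 q (Nat.zero_le q)
  rw [moves_eq hL h0, prefixRow, Nat.add_assoc]
  congr 1
  rw [← sum_subset (range_mono (Nat.succ_le_of_lt hq)), sum_range_succ, sum_range_succ]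
  · have h : ∑ k ∈ range q, ((L (r + 1 + 1)).rowLen k - (L (r + 1)).rowLen k) + q =
        ∑ k ∈ range q, (q + c₀ - (L (r + 1)).rowLen q + (L (r + 1 + 1)).rowLen k - (k + c₀) -
          (q + c₀ - (L (r + 1)).rowLen q + (L (r + 1)).rowLen k - (k + c₀ + 1))) := by
      rw [sum_range_add_self]
      refine sum_congr rfl fun k hk => ?_
      rw [mem_range] at hk
      have h1 := hL.2.2 (r + 1) k
      have h2 := (L (r + 1)).rowLen_anti k q hk.le
      omega
    have h1 := (hL.2.2 (r + 1) q).1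
    omega
  · intro k _ hk
    rw [mem_range, not_lt] at hk
    obtain ⟨k, rfl⟩ : ∃ k', k = k' + 1 := ⟨k - 1, by omega⟩
    have h1 := hL.2.2 (r + 1) k
    have h2 := (L (r + 1)).rowLen_anti q k (by omega)
    omega

theorem moves_last (hL : L ∈ StripChain n C D) (h0 : D.rowLen 0 ≤ c₀) (r : ℕ) :
    prefixRow A L m r + m = A.rowLen r + moves c₀ m L r (c₀ + m) := by
  rw [moves_eq hL h0, prefixRow, Nat.add_assoc]
  congr 1
  rw [sum_range_add_self]
  refine sum_congr rfl fun k hk => ?_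
  rw [mem_range] at hk
  have h1 := hL.2.2 r k
  omega

theorem prefixRow_eq_of_le (hL : L ∈ StripChain n C D) (hm : D.rowLen m = 0) (r : ℕ) {q : ℕ}
    (hq : m ≤ q) : prefixRow A L q r = prefixRow A L m r := by
  rw [prefixRow, prefixRow]
  congr 1
  refine (sum_subset (range_mono hq) fun k _ hk => ?_).symm
  rw [mem_range, not_lt] at hk
  rw [YoungDiagram.rowLen_eq_zero_of_le (rowLen_eq_zero_of_chain hL hm (r + 1)) hk, Nat.zero_sub]

/-- The lattice word condition says that the particles `r` and `r + 1` never collide. The difference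
of their positions is, as a function of the column `j`, concave between the positions of two
consecutive digits `1` of the string of `L (r + 1)`; so it has to be examined at these positions and
at both ends only. There it agrees with the difference in the lattice word condition. -/
theorem isLattice_iff_moves (hL : L ∈ StripChain n C D) (hm : D.rowLen m = 0)
    (h0 : D.rowLen 0 ≤ c₀) : IsLattice n A L ↔ ∀ j ≤ c₀ + m, ∀ r, r + 1 < n →
      A.rowLen (r + 1) + moves c₀ m L (r + 1) j ≤ A.rowLen r + moves c₀ m L r j := by
  constructor
  · intro h j hj r hr
    by_contra! hlt
    -- The first column in which the two particles are in the wrong order.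
    have hex : ∃ j, A.rowLen r + moves c₀ m L r j < A.rowLen (r + 1) + moves c₀ m L (r + 1) j :=
      ⟨j, hlt⟩
    classical
    have hspec := Nat.find_spec hex
    have hmin := fun i => Nat.find_min hex (m := i)
    rcases hj0 : Nat.find hex with _ | i
    · rw [hj0] at hspec
      have := A.rowLen_anti r (r + 1) (Nat.le_succ r)
      simp only [moves, range_zero, sum_empty] at hspec
      omega
    · rw [hj0] at hspec hmin
      have h1 := hmin i (Nat.lt_succ_self i)
      rw [moves_succ, moves_succ] at hspec
      have h2 := onesBefore_le_of_isHStrip (hL.2.2 r) c₀ m i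
      have h3 := onesBefore_mono c₀ m (L (r + 1)) (Nat.le_succ i)
      have h4 := onesBefore_succ_le_of_isHStrip (hL.2.2 (r + 1)) c₀ m i
      have h5 := onesBefore_le c₀ m (L (r + 1 + 1)) (i + 1)
      rw [Nat.succ_eq_add_one] at h3
      set k := onesBefore c₀ m (L r) i with hk
      have hkm : k < m := by omega
      -- The order remains wrong up to the position of the digit `1` in row `k`.
      have key : ∀ j, i + 1 ≤ j → j ≤ k + c₀ - (L (r + 1)).rowLen k →
          A.rowLen r + moves c₀ m L r j < A.rowLen (r + 1) + moves c₀ m L (r + 1) j := by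
        intro j hj
        induction j, hj using Nat.le_induction with
        | base =>
          intro _
          rw [moves_succ, moves_succ]
          exact hspec
        | succ j hj ih =>
          intro hj'
          have h6 := ih (by omega)
          have h7 := mt (lt_onesBefore_iff (c₀ := c₀) (D := L (r + 1)) (j := j + 1) hkm).1
            (by omega)
          have h8 := onesBefore_mono c₀ m (L r) (show i ≤ j by omega)
          rw [← hk] at h8
          rw [moves_succ, moves_succ]
          omega
      have h6 := mt (lt_onesBefore_iff (c₀ := c₀) (D := L (r + 1)) (j := i + 1) hkm).2 (by omega)
      have h7 := key _ (by omega) le_rfl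
      have h8 := moves_position (A := A) hL h0 r hkm
      have h9 := moves_succ_position (A := A) hL h0 r hkm
      have := h k r hr
      omega
  · intro h q r hr
    rcases lt_or_ge q m with hq | hq
    · have h1 := moves_position (A := A) hL h0 r hq
      have h2 := moves_succ_position (A := A) hL h0 r hq
      have h3 := h (q + c₀ - (L (r + 1)).rowLen q) (by omega) r hr
      omega
    · rw [prefixRow_eq_of_le hL hm _ hq, prefixRow_eq_of_le hL hm _ (hq.trans (Nat.le_succ q))]
      have h1 := moves_last (A := A) (m := m) hL h0 r
      have h2 := moves_last (A := A) (m := m) hL h0 (r + 1)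
      have h3 := h (c₀ + m) le_rfl r hr
      omega

end Moves

/-! ### Strips of puzzle pieces as moves of particles -/

/-- `IsRhombus z y z' x` says that two puzzle pieces, glued along a horizontal edge, form a rhombus
with NW, NE, SE and SW edges labeled `z`, `y`, `z'` and `x`. -/
def IsRhombus (z y z' x : EdgeLabel) : Prop := ∃ h, IsPiece z' x h ∧ IsPiece z y h

/-- `IsStrip z xs ys z'` says that the labels `z` (NW edge), `ys` (NE side), `z'` (SE edge) and `xs`
(SW side) are those of a puzzle in the shape of a strip that is one unit wide. The two long sides
are read from top to bottom. -/
def IsStrip : EdgeLabel → List EdgeLabel → List EdgeLabel → EdgeLabel → Prop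
  | z, [], [], z' => z = z'
  | z, x :: xs, y :: ys, z' => ∃ w, IsRhombus z y w x ∧ IsStrip w xs ys z'
  | _, _, _, _ => False

/-- The positions of the labels that are not `0`, the first label of the list being at position `k`.
These labels are thought of as particles; each position comes with the number `0` for a label `1`,
and the number `1` for a label `10`. -/
def particles : ℕ → List EdgeLabel → List (ℕ × ℕ)
  | _, [] => []
  | k, .zero :: l => particles (k + 1) l
  | k, .one :: l => (k, 0) :: particles (k + 1) l
  | k, .ten :: l => (k, 1) :: particles (k + 1) l

/-- The condition on the particles `P` and `P'` on the two long sides of a strip that makes the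
strip a puzzle whose short edges have the digits `d` (at the top) and `d'` (at the bottom); see
`isStrip_digitLabel_iff`. The strip is swept from top to bottom, `d` being the current digit. A
particle of type `s` at position `p` becomes one of type `s'` at position `p'`; it keeps its
position if `d + s' = 1`, moves horizontally to position `p + 1` if `d + s' = 0`, and leaves the
digit `d + s' - s`. -/
def IsMove : ℕ → List (ℕ × ℕ) → List (ℕ × ℕ) → ℕ → Prop
  | d, [], [], d' => d = d'
  | d, (p, s) :: P, (p', s') :: P', d' =>
      d + s' ≤ 1 ∧ p' + (d + s') = p + 1 ∧ s ≤ d + s' ∧ IsMove (d + s' - s) P P' d'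
  | _, _, _, _ => False

theorem isStrip_zero_zero {xs ys : List EdgeLabel} {x z' : EdgeLabel} :
    IsStrip .zero (x :: xs) (.zero :: ys) z' ↔
      x = .zero ∧ IsStrip .zero xs ys z' ∨ x = .one ∧ IsStrip .ten xs ys z' := by
  cases x <;> simp [IsStrip, IsRhombus, IsPiece]

theorem isStrip_zero_one {xs ys : List EdgeLabel} {x z' : EdgeLabel} :
    ¬ IsStrip .zero (x :: xs) (.one :: ys) z' := by
  cases x <;> simp [IsStrip, IsRhombus, IsPiece]

theorem isStrip_zero_ten {xs ys : List EdgeLabel} {x z' : EdgeLabel} :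
    IsStrip .zero (x :: xs) (.ten :: ys) z' ↔
      x = .ten ∧ IsStrip .zero xs ys z' ∨ x = .one ∧ IsStrip .one xs ys z' := by
  cases x <;> simp [IsStrip, IsRhombus, IsPiece]

theorem isStrip_one_zero {xs ys : List EdgeLabel} {x z' : EdgeLabel} :
    IsStrip .one (x :: xs) (.zero :: ys) z' ↔ x = .zero ∧ IsStrip .one xs ys z' := by
  cases x <;> simp [IsStrip, IsRhombus, IsPiece]

theorem isStrip_one_one {xs ys : List EdgeLabel} {x z' : EdgeLabel} :
    IsStrip .one (x :: xs) (.one :: ys) z' ↔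
      x = .one ∧ IsStrip .one xs ys z' ∨ x = .ten ∧ IsStrip .zero xs ys z' := by
  cases x <;> simp [IsStrip, IsRhombus, IsPiece]

theorem isStrip_one_ten {xs ys : List EdgeLabel} {x z' : EdgeLabel} :
    ¬ IsStrip .one (x :: xs) (.ten :: ys) z' := by
  cases x <;> simp [IsStrip, IsRhombus, IsPiece]

theorem isStrip_ten_one {xs ys : List EdgeLabel} {x z' : EdgeLabel} :
    IsStrip .ten (x :: xs) (.one :: ys) z' ↔
      x = .zero ∧ IsStrip .zero xs ys z' ∨ x = .one ∧ IsStrip .ten xs ys z' := by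
  cases x <;> simp [IsStrip, IsRhombus, IsPiece]

theorem isStrip_ten_of_ne {xs ys : List EdgeLabel} {x y z' : EdgeLabel} (hy : y ≠ .one) :
    ¬ IsStrip .ten (x :: xs) (y :: ys) z' := by
  cases x <;> cases y <;> first | exact absurd rfl hy |
    simp [IsStrip, IsRhombus, IsPiece]

theorem le_of_mem_particles {k : ℕ} {l : List EdgeLabel} {b : ℕ × ℕ} (hb : b ∈ particles k l) :
    k ≤ b.1 ∧ b.1 < k + l.length ∧ b.2 ≤ 1 := by
  induction l generalizing k with
  | nil => simp [particles] at hb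
  | cons x l ih =>
    rw [List.length_cons]
    cases x <;> simp only [particles, List.mem_cons] at hb
    · have := ih hb
      omega
    all_goals
      rcases hb with rfl | hb
      · simp
      · have := ih hb
        omega

/-- A particle cannot move to a smaller position. -/
theorem not_isMove_particles_left {d k s : ℕ} {xs : List EdgeLabel} {P : List (ℕ × ℕ)} {d' : ℕ} :
    ¬ IsMove d (particles (k + 1) xs) ((k, s) :: P) d' := by
  rcases h : particles (k + 1) xs with _ | ⟨⟨p, t⟩, Q⟩
  · simp [IsMove]
  · have := (le_of_mem_particles (h ▸ List.mem_cons_self : (p, t) ∈ particles (k + 1) xs)).1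
    dsimp only at this
    rw [IsMove]
    omega

/-- A particle moves by at most one position, and only if it is a label `1` and the digit is `0`. -/
theorem not_isMove_particles_right {d k j s : ℕ} {ys : List EdgeLabel} {P : List (ℕ × ℕ)} {d' : ℕ}
    (h : k + 1 < j + d + s) (hj : k < j) : ¬ IsMove d ((k, s) :: P) (particles j ys) d' := by
  rcases h' : particles j ys with _ | ⟨⟨p, t⟩, Q⟩
  · simp [IsMove]
  · have := (le_of_mem_particles (h' ▸ List.mem_cons_self : (p, t) ∈ particles j ys)).1
    dsimp only at this
    rw [IsMove]
    omega

/-- Strips of rhombi are moves of particles. While a strip is swept, the label `10` on a short edge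
stands for a particle that has just left the long side on the left, one position above, and
has not yet arrived on the right. -/
theorem isStrip_iff_isMove {xs ys : List EdgeLabel} (hl : xs.length = ys.length) (k : ℕ)
    (b' : Bool) :
    (IsStrip .zero xs ys (digitLabel b') ↔
      IsMove 0 (particles k xs) (particles k ys) b'.toNat) ∧
    (IsStrip .one xs ys (digitLabel b') ↔
      IsMove 1 (particles k xs) (particles k ys) b'.toNat) ∧
    (IsStrip .ten xs ys (digitLabel b') ↔
      IsMove 0 ((k, 0) :: particles (k + 1) xs) (particles (k + 1) ys) b'.toNat) := by
  induction xs generalizing ys k with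
  | nil =>
    rw [List.length_nil, eq_comm, List.length_eq_zero_iff] at hl
    subst hl
    cases b' <;> simp [IsStrip, IsMove, particles, digitLabel]
  | cons x xs ih =>
    rcases ys with _ | ⟨y, ys⟩
    · simp at hl
    · rw [List.length_cons, List.length_cons, Nat.add_right_cancel_iff] at hl
      obtain ⟨h1, h2, -⟩ := ih hl (k + 1)
      have h3 := fun k => (ih hl k).2.2
      obtain ⟨h1', h2', -⟩ := ih hl (k + 2)
      refine ⟨?_, ?_, ?_⟩
      · cases y
        · rw [isStrip_zero_zero]
          cases x
          · simp [particles, h1]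
          · simpa [particles] using h3 k
          · simp [particles, not_isMove_particles_right]
        · rw [iff_false_left isStrip_zero_one]
          cases x
          · exact not_isMove_particles_left
          all_goals simp [particles, IsMove]
        · rw [isStrip_zero_ten]
          cases x
          · simp [particles, not_isMove_particles_left]
          · simp [particles, IsMove, h2]
          · simp [particles, IsMove, h1]
      · cases y
        · rw [isStrip_one_zero]
          cases x
          · simp [particles, h2]
          · simp [particles, not_isMove_particles_right]
          · simp [particles, not_isMove_particles_right]
        · rw [isStrip_one_one]
          cases x
          · simp [particles, not_isMove_particles_left]
          · simp [particles, IsMove, h2]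
          · simp [particles, IsMove, h1]
        · rw [iff_false_left isStrip_one_ten]
          cases x
          · exact not_isMove_particles_left
          all_goals simp [particles, IsMove]
      · cases y
        · rw [iff_false_left (isStrip_ten_of_ne (by decide))]
          exact not_isMove_particles_right (j := k + 2) (by omega) (by omega)
        · rw [isStrip_ten_one]
          cases x
          · simp [particles, IsMove, h1']
          · simpa [particles, IsMove] using h3 (k + 1)
          · simp [particles, IsMove, not_isMove_particles_right]
        · rw [iff_false_left (isStrip_ten_of_ne (by decide))]
          simp [particles, IsMove]

theorem isStrip_length {z z' : EdgeLabel} {xs ys : List EdgeLabel} (h : IsStrip z xs ys z') :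
    xs.length = ys.length := by
  induction xs generalizing ys z with
  | nil => cases ys <;> simp [IsStrip] at h ⊢
  | cons x xs ih =>
    cases ys with
    | nil => simp [IsStrip] at h
    | cons y ys =>
      obtain ⟨w, -, hw⟩ := h
      simp [ih hw]

theorem isStrip_digitLabel_iff {xs ys : List EdgeLabel} (hl : xs.length = ys.length) (b b' : Bool) :
    IsStrip (digitLabel b) xs ys (digitLabel b') ↔
      IsMove b.toNat (particles 0 xs) (particles 0 ys) b'.toNat := by
  cases b
  · exact (isStrip_iff_isMove hl 0 b').1
  · exact (isStrip_iff_isMove hl 0 b').2.1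

theorem isMove_length {d d' : ℕ} {P P' : List (ℕ × ℕ)} (h : IsMove d P P' d') :
    P.length = P'.length := by
  induction P generalizing P' d with
  | nil => cases P' <;> simp [IsMove] at h ⊢
  | cons x xs ih =>
    cases P' with
    | nil => simp [IsMove] at h
    | cons y ys => simp [ih h.2.2.2]

/-- The numbers `e r` are the digits between the particles. -/
theorem isMove_map_range {n d d' : ℕ} {f g : ℕ → ℕ × ℕ} :
    IsMove d ((List.range n).map f) ((List.range n).map g) d' ↔
      ∃ e : ℕ → ℕ, e 0 = d ∧ e n = d' ∧ ∀ r < n, e r + (g r).2 ≤ 1 ∧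
        (g r).1 + (e r + (g r).2) = (f r).1 + 1 ∧ e (r + 1) + (f r).2 = e r + (g r).2 := by
  induction n generalizing d f g with
  | zero =>
    simp only [List.range_zero, List.map_nil, IsMove]
    exact ⟨fun h => ⟨fun _ => d, rfl, h, fun r hr => absurd hr (Nat.not_lt_zero r)⟩,
      fun ⟨e, h1, h2, _⟩ => h1.symm.trans h2⟩
  | succ n ih =>
    simp only [List.range_succ_eq_map, List.map_cons, List.map_map]
    have : IsMove d (f 0 :: (List.range n).map (f ∘ Nat.succ))
        (g 0 :: (List.range n).map (g ∘ Nat.succ)) d' ↔ d + (g 0).2 ≤ 1 ∧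
        (g 0).1 + (d + (g 0).2) = (f 0).1 + 1 ∧ (f 0).2 ≤ d + (g 0).2 ∧
        IsMove (d + (g 0).2 - (f 0).2) ((List.range n).map (f ∘ Nat.succ))
          ((List.range n).map (g ∘ Nat.succ)) d' := Iff.rfl
    rw [this, ih]
    constructor
    · rintro ⟨h1, h2, h3, e, he, he', h4⟩
      refine ⟨fun r => Nat.casesOn r d e, rfl, he', fun r hr => ?_⟩
      cases r with
      | zero => exact ⟨h1, h2, show e 0 + (f 0).2 = d + (g 0).2 by omega⟩
      | succ r => exact h4 r (by omega)
    · rintro ⟨e, rfl, he', h⟩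
      obtain ⟨h1, h2, h3⟩ := h 0 (Nat.succ_pos n)
      exact ⟨h1, h2, by omega, fun r => e (r + 1), by rw [← h3]; simp, he',
        fun r hr => h (r + 1) (by omega)⟩

theorem map_getD_range {β : Type*} (l : List β) (b : β) :
    (List.range l.length).map (fun r => l.getD r b) = l := by
  refine List.ext_getElem (by simp) fun r h1 h2 => ?_
  simp [h2]

theorem particles_injective {k : ℕ} {l l' : List EdgeLabel} (hl : l.length = l'.length)
    (h : particles k l = particles k l') : l = l' := by
  induction l generalizing k l' with
  | nil => exact (List.length_eq_zero_iff.1 hl.symm).symm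
  | cons x l ih =>
    rcases l' with _ | ⟨x', l'⟩
    · simp at hl
    · rw [List.length_cons, List.length_cons, Nat.add_right_cancel_iff] at hl
      have hne : ∀ (s : ℕ) (P : List (ℕ × ℕ)) (l : List EdgeLabel),
          particles (k + 1) l ≠ (k, s) :: P := by
        intro s P l h
        have := (le_of_mem_particles (h ▸ List.mem_cons_self : (k, s) ∈ particles (k + 1) l)).1
        dsimp only at this
        omega
      cases x <;> cases x' <;> simp [particles, hne, (hne _ _ _).symm] at h <;> rw [ih hl h]

theorem pairwise_particles (k : ℕ) (l : List EdgeLabel) :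
    (particles k l).Pairwise fun b b' => b.1 < b'.1 := by
  induction l generalizing k with
  | nil => exact List.Pairwise.nil
  | cons x l ih =>
    cases x <;> simp only [particles, List.pairwise_cons, ih, and_true]
    all_goals exact fun b hb => (le_of_mem_particles hb).1

theorem exists_particles_eq {a k : ℕ} {P : List (ℕ × ℕ)} (hP : P.Pairwise fun b b' => b.1 < b'.1)
    (hk : ∀ b ∈ P, k ≤ b.1 ∧ b.1 < k + a ∧ b.2 ≤ 1) :
    ∃ l : List EdgeLabel, l.length = a ∧ particles k l = P := by
  induction a generalizing k P with
  | zero =>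
    rcases P with _ | ⟨b, P⟩
    · exact ⟨[], rfl, rfl⟩
    · have := hk b List.mem_cons_self
      omega
  | succ a ih =>
    by_cases h : ∃ s Q, P = (k, s) :: Q
    · obtain ⟨s, Q, rfl⟩ := h
      rw [List.pairwise_cons] at hP
      obtain ⟨l, hl, hQ⟩ := ih (k := k + 1) hP.2 fun b hb => by
        have h1 := hP.1 b hb
        have h2 := hk b (List.mem_cons_of_mem _ hb)
        dsimp only at h1
        omega
      have h2 := (hk _ List.mem_cons_self).2.2
      dsimp only at h2
      interval_cases s
      · exact ⟨.one :: l, by simp [hl], by simp [particles, hQ]⟩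
      · exact ⟨.ten :: l, by simp [hl], by simp [particles, hQ]⟩
    · obtain ⟨l, hl, hQ⟩ := ih (k := k + 1) hP fun b hb => by
        have h2 := hk b hb
        have h3 : b.1 ≠ k := by
          rintro rfl
          rcases P with _ | ⟨b', P⟩
          · simp at hb
          · rcases List.mem_cons.1 hb with rfl | hb'
            · exact h ⟨b.2, P, rfl⟩
            · have := (List.pairwise_cons.1 hP).1 b hb'
              have := hk b' List.mem_cons_self
              omega
        omega
      exact ⟨.zero :: l, by simp [hl], by simp [particles, hQ]⟩

/-- The particles on a side that is labeled by a binary string are its digits `1`. -/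
theorem particles_map_digitLabel (k : ℕ) (l : List Bool) :
    particles k (l.map digitLabel) = (List.range (l.count true)).map fun r =>
      (k + r + l.count false - (stringDiagram l).rowLen r, 0) := by
  induction l generalizing k with
  | nil => simp [particles]
  | cons b l ih =>
    cases b with
    | false =>
      simp only [List.map_cons, digitLabel, particles, ih, List.count_cons_self, ne_eq,
        reduceCtorEq, not_false_eq_true, List.count_cons_of_ne, rowLen_stringDiagram_false_cons]
      refine List.map_congr_left fun r _ => ?_
      rw [Prod.mk.injEq]
      exact ⟨by omega, rfl⟩
    | true =>
      simp only [List.map_cons, digitLabel, particles, ih, List.count_cons_self, ne_eq,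
        reduceCtorEq, not_false_eq_true, List.count_cons_of_ne, List.range_succ_eq_map,
        List.map_map, rowLen_stringDiagram_true_cons_zero, Nat.add_zero, Nat.add_sub_cancel]
      congr 1
      refine List.map_congr_left fun r _ => ?_
      rw [Function.comp_apply, Prod.mk.injEq, Nat.succ_eq_add_one,
        rowLen_stringDiagram_true_cons_succ]
      exact ⟨by omega, rfl⟩

theorem count_take_succ (l : List Bool) (j : ℕ) :
    (l.take (j + 1)).count true = (l.take j).count true + (l.getD j false).toNat := by
  induction l generalizing j with
  | nil => simp
  | cons b l ih =>
    cases j with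
    | zero => cases b <;> simp
    | succ j =>
      have := ih j
      cases b <;> simp at this ⊢ <;> omega

/-! ### Columns of puzzles and chains of diagrams -/

/-- The particles in column `j` of the puzzle that corresponds to the chain `L`: the `r`-th particle
starts at the position of the `r`-th digit `1` of a string with diagram `A`, and it is a label `10`
if the `r`-th and `(r + 1)`-st strings of the chain have different numbers of digits `1` among their
first `j` digits. -/
def chainParticles (a₀ c₀ n m : ℕ) (A : YoungDiagram) (L : ℕ → YoungDiagram) (j : ℕ) :
    List (ℕ × ℕ) :=
  (List.range n).map fun r => (r + a₀ + j - A.rowLen r - moves c₀ m L r j,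
    onesBefore c₀ m (L (r + 1)) j - onesBefore c₀ m (L r) j)

section Columns

variable {a₀ a₁ c₀ c₁ : ℕ} {α β γ δ : List Bool}

theorem length_eq_of_mem (hα : α ∈ binaryStrings a₀ a₁) : α.length = a₀ + a₁ := by
  rw [mem_binaryStrings] at hα
  rw [← hα.1, ← hα.2, List.count_false_add_count_true]

theorem rowLen_eq_zero_of_mem_binaryStrings (hα : α ∈ binaryStrings a₀ a₁) :
    (stringDiagram α).rowLen a₁ = 0 := by
  rw [← (mem_binaryStrings.1 hα).2, rowLen_stringDiagram_count]

theorem rowLen_le_of_mem_binaryStrings (hα : α ∈ binaryStrings a₀ a₁) (r : ℕ) :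
    (stringDiagram α).rowLen r ≤ a₀ := by
  rw [← (mem_binaryStrings.1 hα).1]
  exact rowLen_stringDiagram_le α r

variable {L : ℕ → YoungDiagram}

/-- A chain that satisfies the lattice word condition gives the columns of a puzzle. All strings are
read from top to bottom or from left to right. -/
theorem exists_columns (hα : α ∈ binaryStrings a₀ a₁) (hβ : β ∈ binaryStrings a₀ a₁)
    (hγ : γ ∈ binaryStrings c₀ c₁) (hδ : δ ∈ binaryStrings c₀ c₁)
    (hL : L ∈ StripChain a₁ (stringDiagram γ) (stringDiagram δ))
    (hlat : IsLattice a₁ (stringDiagram α) L)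
    (hpre : ∀ r < a₁, prefixRow (stringDiagram α) L c₁ r = (stringDiagram β).rowLen r + c₀) :
    ∃ σ : ℕ → List EdgeLabel,
      (∀ j ≤ c₀ + c₁, (σ j).length = a₀ + a₁ ∧
        particles 0 (σ j) = chainParticles a₀ c₀ a₁ c₁ (stringDiagram α) L j) ∧
      σ 0 = α.map digitLabel ∧ σ (c₀ + c₁) = β.map digitLabel ∧
      ∀ j < c₀ + c₁, IsStrip (digitLabel (γ.getD j false)) (σ j) (σ (j + 1))
        (digitLabel (δ.getD j false)) := by
  have hm := rowLen_eq_zero_of_mem_binaryStrings hδ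
  have h0 := rowLen_le_of_mem_binaryStrings hδ 0
  have hA := rowLen_le_of_mem_binaryStrings hα
  have hlat := (isLattice_iff_moves hL hm h0).1 hlat
  have hmv := fun r j => moves_le (c₀ := c₀) (m := c₁) hL r j
  have hlast : ∀ r < a₁, (stringDiagram β).rowLen r + c₀ + c₁ =
      (stringDiagram α).rowLen r + moves c₀ c₁ L r (c₀ + c₁) := fun r hr => by
    rw [← moves_last hL h0, hpre r hr]
  have hs : ∀ r j, onesBefore c₀ c₁ (L (r + 1)) (j + 1) ≤ onesBefore c₀ c₁ (L r) j + 1 :=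
    fun r j => onesBefore_succ_le_of_isHStrip (hL.2.2 r) c₀ c₁ j
  have hmono := fun r j => onesBefore_mono c₀ c₁ (L r) (Nat.le_succ j)
  have hle : ∀ r j, onesBefore c₀ c₁ (L r) j ≤ onesBefore c₀ c₁ (L (r + 1)) j :=
    fun r j => onesBefore_le_of_isHStrip (hL.2.2 r) c₀ c₁ j
  simp only [Nat.succ_eq_add_one] at hmono
  have hex : ∀ j, ∃ l : List EdgeLabel, j ≤ c₀ + c₁ → l.length = a₀ + a₁ ∧
      particles 0 l = chainParticles a₀ c₀ a₁ c₁ (stringDiagram α) L j := by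
    intro j
    by_cases hj : j ≤ c₀ + c₁
    · obtain ⟨l, hl⟩ := exists_particles_eq (a := a₀ + a₁) (k := 0)
        (P := chainParticles a₀ c₀ a₁ c₁ (stringDiagram α) L j) (by
          rw [chainParticles, List.pairwise_map]
          have key : ∀ i r, r < i → i < a₁ →
              r + a₀ + j - (stringDiagram α).rowLen r - moves c₀ c₁ L r j <
              i + a₀ + j - (stringDiagram α).rowLen i - moves c₀ c₁ L i j := by
            intro i r hri
            induction i, hri using Nat.le_induction with
            | base =>
              intro hr
              have h1 := hlat j hj r hr
              have h2 := hA r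
              have h3 := hA (r + 1)
              have h4 := hmv r j
              have h5 := hmv (r + 1) j
              simp only [Nat.succ_eq_add_one]
              omega
            | succ i hi ih =>
              intro hi'
              have h1 := hlat j hj i hi'
              have h2 := hA i
              have h3 := hA (i + 1)
              have h4 := hmv i j
              have h5 := hmv (i + 1) j
              have := ih (by omega)
              omega
          refine List.Pairwise.imp_of_mem (fun {r i} _ hi hri => ?_) (List.pairwise_lt_range)
          exact key i r hri (List.mem_range.1 hi)) (by
          intro b hb
          obtain ⟨r, hr, rfl⟩ := List.mem_map.1 hb
          rw [List.mem_range] at hr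
          refine ⟨Nat.zero_le _, ?_, ?_⟩
          -- The position does not exceed the position in the last column.
          · have h1 : ∀ i, j + i ≤ c₀ + c₁ → moves c₀ c₁ L r (j + i) ≤ moves c₀ c₁ L r j + i := by
              intro i
              induction i with
              | zero => exact fun _ => le_rfl
              | succ i ih =>
                intro hi
                have h2 := ih (by omega)
                have h3 := hs r (j + i)
                rw [← Nat.add_assoc, moves_succ]
                omega
            have h2 := h1 (c₀ + c₁ - j) (by omega)
            rw [show j + (c₀ + c₁ - j) = c₀ + c₁ by omega] at h2
            have h3 := hlast r hr
            have h4 := hA r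
            have h5 := hmv r j
            dsimp only
            omega
          -- The type of the particle is at most `1`.
          · rcases Nat.eq_zero_or_pos j with rfl | hj0
            · dsimp only
              rw [onesBefore_zero (rowLen_zero_le_of_mem hL h0 _)]
              omega
            · obtain ⟨j, rfl⟩ : ∃ i, j = i + 1 := ⟨j - 1, by omega⟩
              have h1 := hs r j
              have h2 := hmono r j
              dsimp only
              omega)
      exact ⟨l, fun _ => hl⟩
    · exact ⟨[], fun h => absurd h hj⟩
  choose σ hσ using hex
  refine ⟨σ, hσ, ?_, ?_, fun j hj => ?_⟩
  · refine particles_injective (k := 0) ?_ ?_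
    · rw [(hσ 0 (Nat.zero_le _)).1, List.length_map, length_eq_of_mem hα]
    · rw [(hσ 0 (Nat.zero_le _)).2, particles_map_digitLabel, (mem_binaryStrings.1 hα).1,
        (mem_binaryStrings.1 hα).2, chainParticles]
      refine List.map_congr_left fun r _ => ?_
      rw [onesBefore_zero (rowLen_zero_le_of_mem hL h0 _), moves, range_zero, sum_empty,
        Prod.mk.injEq]
      exact ⟨by omega, by omega⟩
  · refine particles_injective (k := 0) ?_ ?_
    · rw [(hσ _ le_rfl).1, List.length_map, length_eq_of_mem hβ]
    · rw [(hσ _ le_rfl).2, particles_map_digitLabel, (mem_binaryStrings.1 hβ).1,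
        (mem_binaryStrings.1 hβ).2, chainParticles]
      refine List.map_congr_left fun r hr => ?_
      rw [onesBefore_eq _ le_rfl, onesBefore_eq _ le_rfl, Prod.mk.injEq]
      have h1 := hlast r (List.mem_range.1 hr)
      have h2 := hA r
      exact ⟨by omega, by omega⟩
  · obtain ⟨h1, h2⟩ := hσ j hj.le
    obtain ⟨h3, h4⟩ := hσ (j + 1) hj
    rw [isStrip_digitLabel_iff (h1.trans h3.symm), h2, h4, chainParticles, chainParticles,
      isMove_map_range]
    refine ⟨fun r => onesBefore c₀ c₁ (L r) (j + 1) - onesBefore c₀ c₁ (L r) j, ?_, ?_,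
      fun r hr => ?_⟩
    · dsimp only
      rw [hL.1, onesBefore_stringDiagram hγ, onesBefore_stringDiagram hγ, count_take_succ,
        Nat.add_sub_cancel_left]
    · dsimp only
      rw [hL.2.1 _ le_rfl, onesBefore_stringDiagram hδ, onesBefore_stringDiagram hδ,
        count_take_succ, Nat.add_sub_cancel_left]
    · dsimp only
      rw [moves_succ]
      have h5 := hs r j
      have h6 := hmono r j
      have h7 := hmono (r + 1) j
      have h8 := hle r j
      have h9 := hle r (j + 1)
      have h10 := hmv r (j + 1)
      rw [moves_succ] at h10
      have h11 := hA r
      have h12 := hmv r j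
      omega

/-- The columns of a puzzle give a chain: the digits between the particles `r - 1` and `r` in all
the strips form the `r`-th string of the chain. -/
theorem exists_chain (hα : α ∈ binaryStrings a₀ a₁) (hβ : β ∈ binaryStrings a₀ a₁)
    (hγ : γ ∈ binaryStrings c₀ c₁) (hδ : δ ∈ binaryStrings c₀ c₁) {σ : ℕ → List EdgeLabel}
    (hσ0 : σ 0 = α.map digitLabel) (hσ1 : σ (c₀ + c₁) = β.map digitLabel)
    (hσ : ∀ j < c₀ + c₁, IsStrip (digitLabel (γ.getD j false)) (σ j) (σ (j + 1))
      (digitLabel (δ.getD j false))) :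
    ∃ L ∈ StripChain a₁ (stringDiagram γ) (stringDiagram δ),
      IsLattice a₁ (stringDiagram α) L ∧
      (∀ r < a₁, prefixRow (stringDiagram α) L c₁ r = (stringDiagram β).rowLen r + c₀) ∧
      ∀ j ≤ c₀ + c₁,
        particles 0 (σ j) = chainParticles a₀ c₀ a₁ c₁ (stringDiagram α) L j := by
  have hA := rowLen_le_of_mem_binaryStrings hα
  have hB := rowLen_le_of_mem_binaryStrings hβ
  have hmove : ∀ j < c₀ + c₁, IsMove (γ.getD j false).toNat (particles 0 (σ j))
      (particles 0 (σ (j + 1))) (δ.getD j false).toNat := fun j hj =>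
    (isStrip_digitLabel_iff (isStrip_length (hσ j hj)) _ _).1 (hσ j hj)
  have hlen : ∀ j ≤ c₀ + c₁, (particles 0 (σ j)).length = a₁ := by
    intro j
    induction j with
    | zero =>
      intro _
      rw [hσ0, particles_map_digitLabel, List.length_map, List.length_range,
        (mem_binaryStrings.1 hα).2]
    | succ j ih => exact fun hj => (isMove_length (hmove j hj)).symm.trans (ih (by omega))
  set f : ℕ → ℕ → ℕ × ℕ := fun j r => (particles 0 (σ j)).getD r (0, 0) with hf
  have hpart : ∀ j ≤ c₀ + c₁, particles 0 (σ j) = (List.range a₁).map (f j) := fun j hj => by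
    rw [← hlen j hj, hf, map_getD_range]
  have hf0 : ∀ r < a₁, f 0 r = (r + a₀ - (stringDiagram α).rowLen r, 0) := by
    intro r hr
    have h1 := hpart 0 (Nat.zero_le _)
    rw [hσ0, particles_map_digitLabel, (mem_binaryStrings.1 hα).1, (mem_binaryStrings.1 hα).2,
      List.map_inj_left] at h1
    exact ((h1 r (List.mem_range.2 hr)).symm).trans (by simp)
  have hf1 : ∀ r < a₁, f (c₀ + c₁) r = (r + a₀ - (stringDiagram β).rowLen r, 0) := by
    intro r hr
    have h1 := hpart _ le_rfl
    rw [hσ1, particles_map_digitLabel, (mem_binaryStrings.1 hβ).1, (mem_binaryStrings.1 hβ).2,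
      List.map_inj_left] at h1
    exact ((h1 r (List.mem_range.2 hr)).symm).trans (by simp)
  have hex : ∀ j, ∃ e : ℕ → ℕ, j < c₀ + c₁ → e 0 = (γ.getD j false).toNat ∧
      e a₁ = (δ.getD j false).toNat ∧ ∀ r < a₁, e r + (f (j + 1) r).2 ≤ 1 ∧
        (f (j + 1) r).1 + (e r + (f (j + 1) r).2) = (f j r).1 + 1 ∧
        e (r + 1) + (f j r).2 = e r + (f (j + 1) r).2 := by
    intro j
    by_cases hj : j < c₀ + c₁
    · have h1 := hmove j hj
      rw [hpart j hj.le, hpart (j + 1) hj, isMove_map_range] at h1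
      obtain ⟨e, he⟩ := h1
      exact ⟨e, fun _ => he⟩
    · exact ⟨fun _ => 0, fun h => absurd h hj⟩
  choose e he using hex
  -- `e j r` is the `j`-th digit of the `r`-th string.
  have hsum : ∀ r < a₁, ∀ j ≤ c₀ + c₁,
      ∑ i ∈ range j, e i (r + 1) = ∑ i ∈ range j, e i r + (f j r).2 := by
    intro r hr j
    induction j with
    | zero => simp [hf0 r hr]
    | succ j ih =>
      intro hj
      have h1 := ih (by omega)
      have h2 := ((he j hj).2.2 r hr).2.2
      rw [sum_range_succ, sum_range_succ]
      omega
  have hE0 : ∀ j ≤ c₀ + c₁, ∑ i ∈ range j, e i 0 = onesBefore c₀ c₁ (stringDiagram γ) j := by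
    intro j
    rw [onesBefore_stringDiagram hγ]
    induction j with
    | zero => simp
    | succ j ih =>
      intro hj
      rw [sum_range_succ, ih (by omega), (he j hj).1, count_take_succ]
  have hE1 : ∀ j ≤ c₀ + c₁, ∑ i ∈ range j, e i a₁ = onesBefore c₀ c₁ (stringDiagram δ) j := by
    intro j
    rw [onesBefore_stringDiagram hδ]
    induction j with
    | zero => simp
    | succ j ih =>
      intro hj
      rw [sum_range_succ, ih (by omega), (he j hj).2.1, count_take_succ]
  have htot : ∀ r ≤ a₁, ∑ i ∈ range (c₀ + c₁), e i r = c₁ := by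
    intro r
    induction r with
    | zero => rw [hE0 _ le_rfl, onesBefore_eq _ le_rfl]; exact fun _ => rfl
    | succ r ih =>
      intro hr
      rw [hsum r hr _ le_rfl, ih (by omega), hf1 r hr, Nat.add_zero]
  have he1 : ∀ j < c₀ + c₁, ∀ r ≤ a₁, e j r ≤ 1 := by
    intro j hj r hr
    rcases Nat.lt_or_eq_of_le hr with hr | rfl
    · exact (Nat.le_add_right _ _).trans ((he j hj).2.2 r hr).1
    · rw [(he j hj).2.1]
      exact Bool.toNat_le _
  have hw : ∀ r, ∃ w ∈ binaryStrings c₀ c₁, r ≤ a₁ → ∀ j ≤ c₀ + c₁,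
      onesBefore c₀ c₁ (stringDiagram w) j = ∑ i ∈ range j, e i r := by
    intro r
    by_cases hr : r ≤ a₁
    · have h1 : ∀ j ≤ c₀ + c₁, (((List.range (c₀ + c₁)).map fun i => decide (e i r = 1)).take
          j).count true = ∑ i ∈ range j, e i r := by
        intro j
        induction j with
        | zero => simp
        | succ j ih =>
          intro hj
          rw [count_take_succ, ih (by omega), sum_range_succ]
          have h2 := he1 j hj r hr
          congr 1
          have h3 : ((List.range (c₀ + c₁)).map fun i => decide (e i r = 1)).getD j false =
              decide (e j r = 1) := by
            rw [List.getD_eq_getElem _ _ (by simpa using hj)]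
            simp
          rw [h3]
          interval_cases e j r <;> rfl
      have h2 := h1 _ le_rfl
      rw [List.take_of_length_le (by simp), htot r hr] at h2
      have h3 : ((List.range (c₀ + c₁)).map fun i => decide (e i r = 1)) ∈ binaryStrings c₀ c₁ := by
        rw [mem_binaryStrings]
        refine ⟨?_, h2⟩
        have h4 := List.count_false_add_count_true
          ((List.range (c₀ + c₁)).map fun i => decide (e i r = 1))
        rw [h2, List.length_map, List.length_range] at h4
        omega
      exact ⟨_, h3, fun _ j hj => (onesBefore_stringDiagram h3 j).trans (h1 j hj)⟩
    · exact ⟨γ, hγ, fun h => absurd h hr⟩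
  choose w hw hwE using hw
  have hmin : ∀ r, ∀ j ≤ c₀ + c₁, onesBefore c₀ c₁ (stringDiagram (w (min r a₁))) j =
      ∑ i ∈ range j, e i (min r a₁) := fun r j hj => hwE _ (min_le_right _ _) j hj
  have hz := fun r => rowLen_eq_zero_of_mem_binaryStrings (hw r)
  have hz' := fun r => rowLen_le_of_mem_binaryStrings (hw r) 0
  have hL : (fun r => stringDiagram (w (min r a₁))) ∈
      StripChain a₁ (stringDiagram γ) (stringDiagram δ) := by
    refine ⟨?_, fun r hr => ?_, fun r => ?_⟩
    · refine eq_of_onesBefore_eq (hz _) (hz' _) (rowLen_eq_zero_of_mem_binaryStrings hγ)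
        (rowLen_le_of_mem_binaryStrings hγ 0) fun j hj => ?_
      rw [hmin 0 j hj, Nat.zero_min, hE0 j hj]
    · refine eq_of_onesBefore_eq (hz _) (hz' _) (rowLen_eq_zero_of_mem_binaryStrings hδ)
        (rowLen_le_of_mem_binaryStrings hδ 0) fun j hj => ?_
      rw [hmin r j hj, min_eq_right hr, hE1 j hj]
    · dsimp only
      rcases lt_or_ge r a₁ with hr | hr
      · refine isHStrip_of_onesBefore (hz _) (hz' _) (hz _) (hz' _) (fun j hj => ?_)
          fun j hj => ?_
        · rw [hmin r j hj, hmin (r + 1) j hj, min_eq_left hr.le,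
            min_eq_left (show r + 1 ≤ a₁ from hr), hsum r hr j hj]
          exact Nat.le_add_right _ _
        · rw [hmin r j hj.le, hmin (r + 1) (j + 1) hj, min_eq_left hr.le,
            min_eq_left (show r + 1 ≤ a₁ from hr), hsum r hr (j + 1) hj, sum_range_succ]
          have := ((he j hj).2.2 r hr).1
          omega
      · rw [min_eq_right hr, min_eq_right (by omega)]
        exact IsHStrip.refl _
  have hm := rowLen_eq_zero_of_mem_binaryStrings hδ
  have h0 := rowLen_le_of_mem_binaryStrings hδ 0
  set L : ℕ → YoungDiagram := fun r => stringDiagram (w (min r a₁)) with hLdef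
  have hLE : ∀ r ≤ a₁, ∀ j ≤ c₀ + c₁, onesBefore c₀ c₁ (L r) j = ∑ i ∈ range j, e i r := by
    intro r hr j hj
    rw [hLdef]
    dsimp only
    rw [hmin r j hj, min_eq_left hr]
  have hpos : ∀ r < a₁, ∀ j ≤ c₀ + c₁,
      (f j r).1 + (stringDiagram α).rowLen r + moves c₀ c₁ L r j = r + a₀ + j := by
    intro r hr j
    induction j with
    | zero =>
      have := hA r
      simp only [hf0 r hr, moves, range_zero, sum_empty]
      omega
    | succ j ih =>
      intro hj
      have h1 := ih (by omega)
      have h2 := ((he j hj).2.2 r hr).2.1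
      rw [moves_succ, hLE r hr.le j (by omega), hLE (r + 1) hr (j + 1) hj, hsum r hr (j + 1) hj,
        sum_range_succ]
      omega
  refine ⟨L, hL, ?_, fun r hr => ?_, fun j hj => ?_⟩
  · rw [isLattice_iff_moves hL hm h0]
    intro j hj r hr
    have h1 := pairwise_particles 0 (σ j)
    rw [hpart j hj, List.pairwise_map, List.pairwise_iff_getElem] at h1
    have h2 := h1 r (r + 1) (by simp; omega) (by simpa using hr) (Nat.lt_succ_self r)
    rw [List.getElem_range, List.getElem_range] at h2
    have h3 := hpos r (by omega) j hj
    have h4 := hpos (r + 1) hr j hj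
    omega
  · have h1 := moves_last (A := stringDiagram α) (m := c₁) hL h0 r
    have h2 := hpos r hr _ le_rfl
    have h3 := hB r
    rw [hf1 r hr] at h2
    dsimp only at h2
    omega
  · rw [hpart j hj, chainParticles]
    refine List.map_congr_left fun r hr => Prod.ext ?_ ?_
    · have := hpos r (List.mem_range.1 hr) j hj
      dsimp only
      omega
    · have hr := List.mem_range.1 hr
      dsimp only
      rw [hLE r hr.le j hj, hLE (r + 1) hr j hj, hsum r hr j hj]
      omega

/-- A chain is determined by the particles in the columns. -/
theorem chain_eq_of_chainParticles_eq {n m : ℕ} {A C D : YoungDiagram} {L L' : ℕ → YoungDiagram}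
    (hL : L ∈ StripChain n C D) (hL' : L' ∈ StripChain n C D) (hm : D.rowLen m = 0)
    (h0 : D.rowLen 0 ≤ c₀) (h : ∀ j ≤ c₀ + m,
      chainParticles a₀ c₀ n m A L j = chainParticles a₀ c₀ n m A L' j) : L = L' := by
  have key : ∀ r ≤ n, L r = L' r := by
    intro r
    induction r with
    | zero => rw [hL.1, hL'.1]; exact fun _ => rfl
    | succ r ih =>
      intro hr
      refine eq_of_onesBefore_eq (rowLen_eq_zero_of_chain hL hm _) (rowLen_zero_le_of_mem hL h0 _)
        (rowLen_eq_zero_of_chain hL' hm _) (rowLen_zero_le_of_mem hL' h0 _) fun j hj => ?_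
      have h1 := h j hj
      rw [chainParticles, chainParticles, List.map_inj_left] at h1
      have h2 := congrArg Prod.snd (h1 r (List.mem_range.2 hr))
      dsimp only at h2
      have h3 := onesBefore_le_of_isHStrip (hL.2.2 r) c₀ m j
      have h4 := onesBefore_le_of_isHStrip (hL'.2.2 r) c₀ m j
      rw [ih (by omega)] at h2 h3
      omega
  funext r
  rcases le_total r n with hr | hr
  · exact key r hr
  · rw [hL.2.1 r hr, hL'.2.1 r hr]

end Columns

/-! ### The number of puzzles as a number of tableaux -/

theorem isPiece_right_unique {x y z z' : EdgeLabel} (h : IsPiece x y z) (h' : IsPiece x y z') :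
    z = z' := by
  cases x <;> cases y <;> simp_all [IsPiece]

theorem isPiece_left_unique {x x' y z : EdgeLabel} (h : IsPiece x y z) (h' : IsPiece x' y z) :
    x = x' := by
  cases y <;> cases z <;> simp_all [IsPiece]

theorem isStrip_ofFn {a : ℕ} (x y : Fin a → EdgeLabel) (z z' : EdgeLabel) :
    IsStrip z (List.ofFn x) (List.ofFn y) z' ↔ ∃ v : Fin (a + 1) → EdgeLabel, v 0 = z ∧
      v (Fin.last a) = z' ∧ ∀ i, IsRhombus (v i.castSucc) (y i) (v i.succ) (x i) := by
  induction a generalizing z with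
  | zero =>
    simp only [List.ofFn_zero, IsStrip]
    exact ⟨fun h => ⟨fun _ => z, rfl, h, fun i => i.elim0⟩, fun ⟨v, h1, h2, _⟩ => h1.symm.trans h2⟩
  | succ a ih =>
    simp only [List.ofFn_succ, IsStrip, ih]
    constructor
    · rintro ⟨w, hw, v, rfl, hv1, hv⟩
      refine ⟨Fin.cons z v, rfl, hv1, Fin.cases ?_ fun i => ?_⟩
      · exact hw
      · exact hv i
    · rintro ⟨v, rfl, hv1, hv⟩
      exact ⟨v 1, hv 0, fun i => v i.succ, rfl, hv1, fun i => hv i.succ⟩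

namespace ParallelogramTiling

variable {a c : ℕ}

/-- The labels in column `j`, read from top to bottom. -/
def column (P : ParallelogramTiling a c) (j : Fin (c + 1)) : List EdgeLabel :=
  List.ofFn fun i => P.u i.rev j

theorem isStrip_column (P : ParallelogramTiling a c) (j : Fin c) :
    IsStrip (P.v (Fin.last a) j) (P.column j.castSucc) (P.column j.succ) (P.v 0 j) := by
  rw [column, column, isStrip_ofFn]
  refine ⟨fun i => P.v i.rev j, congrArg (P.v · j) (Fin.rev_zero a),
    congrArg (P.v · j) (Fin.rev_last a), fun i => ?_⟩
  dsimp only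
  rw [Fin.rev_castSucc, Fin.rev_succ]
  exact ⟨_, P.down i.rev j, P.up i.rev j⟩

/-- A puzzle is determined by its columns and its NW side. -/
theorem ext_of_column {P Q : ParallelogramTiling a c} (hu : ∀ j, P.column j = Q.column j)
    (hv : ∀ j, P.v (Fin.last a) j = Q.v (Fin.last a) j) : P = Q := by
  have hu' : ∀ i j, P.u i j = Q.u i j := fun i j => by
    have := congrFun (List.ofFn_injective (hu j)) i.rev
    rwa [Fin.rev_rev] at this
  have hv' : ∀ i j, P.v i j = Q.v i j := by
    intro i j
    induction i using Fin.reverseInduction with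
    | last => exact hv j
    | cast i ih =>
      have h1 := P.up i j
      rw [ih, hu' i] at h1
      have h2 := P.down i j
      rw [isPiece_right_unique h1 (Q.up i j), hu' i] at h2
      exact isPiece_left_unique h2 (Q.down i j)
  ext i j
  · exact hu' i j
  · exact hv' i j
  · have h1 := P.up i j
    rw [hv', hu'] at h1
    exact isPiece_right_unique h1 (Q.up i j)

theorem exists_of_isStrip (u : Fin a → Fin (c + 1) → EdgeLabel) (z z' : Fin c → EdgeLabel)
    (h : ∀ j : Fin c, IsStrip (z j) (List.ofFn fun i => u i.rev j.castSucc)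
      (List.ofFn fun i => u i.rev j.succ) (z' j)) :
    ∃ P : ParallelogramTiling a c, P.u = u ∧ (∀ j, P.v (Fin.last a) j = z j) ∧
      ∀ j, P.v 0 j = z' j := by
  simp only [isStrip_ofFn] at h
  choose v hv0 hv1 hv using h
  have hex : ∀ (i : Fin a) (j : Fin c), ∃ x, IsPiece (v j i.rev.succ) (u i j.castSucc) x ∧
      IsPiece (v j i.rev.castSucc) (u i j.succ) x := fun i j => by
    have := hv j i.rev
    rwa [Fin.rev_rev] at this
  choose x hx hx' using hex
  refine ⟨⟨u, fun i j => v j i.rev, x, fun i j => ?_, fun i j => ?_⟩, rfl, fun j => ?_, fun j => ?_⟩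
  · rw [Fin.rev_castSucc]
    exact hx i j
  · rw [Fin.rev_succ]
    exact hx' i j
  · exact (congrArg (v j) (Fin.rev_last a)).trans (hv0 j)
  · exact (congrArg (v j) (Fin.rev_zero a)).trans (hv1 j)

end ParallelogramTiling

theorem ofFn_eq_map_digitLabel_iff {n : ℕ} {l : List Bool} (hl : l.length = n)
    (f : Fin n → EdgeLabel) :
    List.ofFn f = l.map digitLabel ↔ ∀ j : Fin n, f j = digitLabel (l.getD j false) := by
  subst hl
  constructor
  · intro h j
    have h1 : (List.ofFn f)[(j : ℕ)]'(by simp) = f j := by simp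
    rw [← h1]
    simp [h]
  · intro h
    refine List.ext_getElem (by simp) fun j h1 h2 => ?_
    rw [List.length_map] at h2
    simp [h, h2]

theorem ofFn_rev {n : ℕ} (f : Fin n → EdgeLabel) :
    List.ofFn (fun i => f i.rev) = (List.ofFn f).reverse := by
  refine List.ext_getElem (by simp) fun j h1 h2 => ?_
  rw [List.getElem_ofFn, List.getElem_reverse, List.getElem_ofFn]
  congr 1
  ext
  simp
  omega

section Count

variable {a₀ a₁ c₀ c₁ : ℕ} {α β γ δ : List Bool}

theorem reverse_mem_binaryStrings (hα : α ∈ binaryStrings a₀ a₁) :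
    α.reverse ∈ binaryStrings a₀ a₁ := by
  rw [mem_binaryStrings] at hα ⊢
  rwa [List.count_reverse, List.count_reverse]

/-- Puzzles correspond to tableaux with a lattice word: the strings of the chain are read off
between the particles, which are the nonzero labels in the columns. The zeros appended to `β`
account for the horizontal moves of the particles. -/
theorem card_parallelogramPuzzle (hα : α ∈ binaryStrings a₀ a₁) (hβ : β ∈ binaryStrings a₀ a₁)
    (hγ : γ ∈ binaryStrings c₀ c₁) (hδ : δ ∈ binaryStrings c₀ c₁) :
    Nat.card (ParallelogramPuzzle α γ β δ) =
      pairedCount a₁ c₁ (stringDiagram α.reverse) (stringDiagram (β ++ zeros c₀))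
        (stringDiagram γ) (stringDiagram δ.reverse) := by
  have hα' := reverse_mem_binaryStrings hα
  have hδ' := reverse_mem_binaryStrings hδ
  have hm := rowLen_eq_zero_of_mem_binaryStrings hδ'
  have h0 := rowLen_le_of_mem_binaryStrings hδ' 0
  have hla := length_eq_of_mem hα
  have hlc := length_eq_of_mem hγ
  have hlb := length_eq_of_mem hβ
  have hld := length_eq_of_mem hδ'
  have hB : ∀ r < a₁, (stringDiagram (β ++ zeros c₀)).rowLen r =
      (stringDiagram β).rowLen r + c₀ := fun r hr => by
    rw [rowLen_stringDiagram_append, (mem_binaryStrings.1 hβ).2, if_pos hr,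
      List.count_replicate_self]
  have hB0 : (stringDiagram (β ++ zeros c₀)).rowLen a₁ = 0 := by
    have := rowLen_stringDiagram_count (β ++ zeros c₀)
    rw [List.count_append, (mem_binaryStrings.1 hβ).2, List.count_replicate] at this
    simpa using this
  rw [pairedCount_eq (rowLen_eq_zero_of_mem_binaryStrings hα') hB0 hm]
  have hex : ∀ L : {L // L ∈ StripChain a₁ (stringDiagram γ) (stringDiagram δ.reverse) ∧
      IsLattice a₁ (stringDiagram α.reverse) L ∧ ∀ r : Fin a₁,
        prefixRow (stringDiagram α.reverse) L c₁ r = (stringDiagram (β ++ zeros c₀)).rowLen r},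
      ∃ P : ParallelogramPuzzle α γ β δ, ∀ j : Fin (γ.length + 1), particles 0 (P.1.column j) =
        chainParticles a₀ c₀ a₁ c₁ (stringDiagram α.reverse) L.1 j := by
    rintro ⟨L, hL, hlat, hpre⟩
    obtain ⟨σ, hσ, hσ0, hσ1, hstrip⟩ := exists_columns hα' hβ hγ hδ' hL hlat
      fun r hr => (hpre ⟨r, hr⟩).trans (hB r hr)
    have hcol : ∀ j ≤ c₀ + c₁, (List.ofFn fun i : Fin α.length =>
        (σ j).getD (i.rev.rev : Fin α.length) .zero) = σ j := by
      intro j hj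
      refine List.ext_getElem (by rw [List.length_ofFn, hla, (hσ j hj).1]) fun i h1 h2 => ?_
      simp [h2]
    obtain ⟨P, hu, hz, hz'⟩ := ParallelogramTiling.exists_of_isStrip (a := α.length)
      (c := γ.length) (fun i j => (σ j).getD (i.rev : Fin α.length) .zero)
      (fun j => digitLabel (γ.getD j false)) (fun j => digitLabel (δ.reverse.getD j false))
      fun j => by
        have hj : (j : ℕ) < c₀ + c₁ := hlc ▸ j.2
        have h1 := hstrip j hj
        rw [← hcol j hj.le, ← hcol (j + 1) hj] at h1
        exact h1
    have hPcol : ∀ j : Fin (γ.length + 1), P.column j = σ j := fun j => by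
      rw [ParallelogramTiling.column, hu]
      exact hcol j (by omega)
    refine ⟨⟨P, ?_, ?_, ?_, ?_⟩, fun j => ?_⟩
    · have h1 := hPcol 0
      rw [ParallelogramTiling.column, ofFn_rev fun i => P.u i 0, Fin.val_zero, hσ0,
        List.map_reverse, List.reverse_inj] at h1
      exact h1
    · exact (ofFn_eq_map_digitLabel_iff rfl _).2 hz
    · have h1 := hPcol (Fin.last _)
      exact h1.trans ((congrArg σ hlc).trans hσ1)
    · have h1 := (ofFn_eq_map_digitLabel_iff (hld.trans hlc.symm) _).2 hz'
      rw [ParallelogramTiling.se, ofFn_rev, h1, ← List.map_reverse, List.reverse_reverse]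
    · rw [hPcol]
      exact (hσ j (by omega)).2
  choose F hF using hex
  refine (Nat.card_congr (Equiv.ofBijective F ⟨fun L L' h => Subtype.ext ?_, fun P => ?_⟩)).symm
  · refine chain_eq_of_chainParticles_eq (a₀ := a₀) (A := stringDiagram α.reverse) L.2.1 L'.2.1
      hm h0 fun j hj => ?_
    have h1 := hF L ⟨j, by omega⟩
    rw [h, hF L'] at h1
    exact h1.symm
  · obtain ⟨P, hsw, hnw, hne, hse⟩ := P
    have hz := (ofFn_eq_map_digitLabel_iff rfl _).1 hnw
    have hz' := (ofFn_eq_map_digitLabel_iff (hld.trans hlc.symm) fun j => P.v 0 j).1 (by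
      rw [ParallelogramTiling.se, ofFn_rev] at hse
      rw [← List.reverse_inj, hse, List.map_reverse, List.reverse_reverse])
    obtain ⟨L, hL, hlat, hpre, hpart⟩ := exists_chain hα' hβ hγ hδ'
      (σ := fun j => if hj : j < γ.length + 1 then P.column ⟨j, hj⟩ else []) (by
        rw [dif_pos (Nat.succ_pos _), List.map_reverse, ← hsw]
        exact ofFn_rev fun i => P.u i 0) (by
        rw [dif_pos (by omega), ← hne]
        have h1 : (⟨c₀ + c₁, by omega⟩ : Fin (γ.length + 1)) = Fin.last _ := Fin.ext hlc.symm
        rw [h1]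
        rfl) (fun j hj => by
        rw [dif_pos (by omega), dif_pos (by omega)]
        have h1 := P.isStrip_column ⟨j, by omega⟩
        rw [hz, hz'] at h1
        exact h1)
    refine ⟨⟨L, hL, hlat, fun r => (hpre r r.2).trans (hB r r.2).symm⟩, Subtype.ext ?_⟩
    refine ParallelogramTiling.ext_of_column (fun j => ?_) fun j => ?_
    · refine particles_injective (k := 0)
        (by simp [ParallelogramTiling.column]) ?_
      rw [hF, ← hpart j (by omega), dif_pos j.2]
    · rw [hz j]
      exact (ofFn_eq_map_digitLabel_iff rfl _).1 (F _).2.2.1 j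

end Count

/-! ### The formula for the number of puzzles -/

section Formula

variable {a₀ a₁ c₀ c₁ : ℕ} {α β γ δ s : List Bool}

theorem rowLen_stringDiagram_append_zeros {l : List Bool} {r : ℕ} (hr : r < l.count true) (k : ℕ) :
    (stringDiagram (l ++ zeros k)).rowLen r = (stringDiagram l).rowLen r + k := by
  rw [rowLen_stringDiagram_append, if_pos hr, List.count_replicate_self]

theorem stringDiagram_append_ones (l : List Bool) (k : ℕ) :
    stringDiagram (l ++ ones k) = stringDiagram l := by
  refine YoungDiagram.ext_rowLen fun r => ?_
  have h : (ones k).count false = 0 := by simp [List.count_replicate]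
  rw [rowLen_stringDiagram_append, h]
  split_ifs with hr
  · rfl
  · rw [YoungDiagram.rowLen_eq_zero_of_le (rowLen_stringDiagram_count l) (not_lt.1 hr)]
    have := rowLen_stringDiagram_le (ones k) (r - l.count true)
    omega

theorem append_zeros_mem {l : List Bool} {n₀ n₁ k n : ℕ} (hl : l ∈ binaryStrings n₀ n₁)
    (h : n₀ + k = n) : l ++ zeros k ∈ binaryStrings n n₁ := by
  rw [mem_binaryStrings] at hl ⊢
  simp [List.count_replicate, hl, h]

theorem append_ones_mem {l : List Bool} {n₀ n₁ k n : ℕ} (hl : l ∈ binaryStrings n₀ n₁)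
    (h : n₁ + k = n) : l ++ ones k ∈ binaryStrings n₀ n := by
  rw [mem_binaryStrings] at hl ⊢
  simp [List.count_replicate, hl, h]

theorem stringDiagram_reverse_eq_complement (hα : α ∈ binaryStrings a₀ a₁) :
    stringDiagram α.reverse = complement a₁ a₀ (stringDiagram α) := by
  rw [stringDiagram_reverse, (mem_binaryStrings.1 hα).1, (mem_binaryStrings.1 hα).2]

theorem lrCoeff_reverse (hδ : δ ∈ binaryStrings c₀ c₁) (hs : s ∈ binaryStrings c₀ c₁) :
    lrCoeff (stringDiagram γ) (stringDiagram s) (stringDiagram δ.reverse) =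
      lrNumber γ δ s.reverse := by
  rw [lrNumber, stringDiagram_reverse_eq_complement hδ, stringDiagram_reverse_eq_complement hs]
  exact lrCoeff_complement (rowLen_eq_zero_of_mem_binaryStrings hδ)
    (rowLen_le_of_mem_binaryStrings hδ 0) (rowLen_eq_zero_of_mem_binaryStrings hs)
    (rowLen_le_of_mem_binaryStrings hs 0)

/-- Duality, for the diagrams of the strings `α` and `β`: `F` is `E` with `a₀ - c₀` added to each of
the first `a₁` rows, where `a₀ - c₀` may be negative. -/
theorem lrCoeff_append_zeros (hα : α ∈ binaryStrings a₀ a₁) (hβ : β ∈ binaryStrings a₀ a₁)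
    {E F : YoungDiagram} (hE : E.rowLen a₁ = 0) (hF : F.rowLen a₁ = 0)
    (h : ∀ r < a₁, F.rowLen r + c₀ = E.rowLen r + a₀) :
    lrCoeff (stringDiagram α.reverse) E (stringDiagram (β ++ zeros c₀)) =
      lrCoeff (stringDiagram α) (stringDiagram β) F := by
  rw [stringDiagram_reverse_eq_complement hα]
  refine (lrCoeff_dual (t := (a₀ : ℤ) - c₀) (rowLen_eq_zero_of_mem_binaryStrings hα)
    (rowLen_le_of_mem_binaryStrings hα 0) (rowLen_eq_zero_of_mem_binaryStrings hβ)
    (rowLen_eq_zero_of_mem_binaryStrings (append_zeros_mem hβ rfl)) hE hF (fun r hr => ?_)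
    fun r hr => ?_).symm
  · have := h r hr
    omega
  · rw [rowLen_stringDiagram_append_zeros (by rwa [(mem_binaryStrings.1 hβ).2])]
    push_cast
    ring

theorem bounds_of_lrCoeff_append_zeros_ne_zero (hα : α ∈ binaryStrings a₀ a₁)
    (hβ : β ∈ binaryStrings a₀ a₁) {E : YoungDiagram}
    (h : lrCoeff (stringDiagram α.reverse) E (stringDiagram (β ++ zeros c₀)) ≠ 0) :
    E.rowLen a₁ = 0 ∧ ∀ r < a₁, c₀ ≤ E.rowLen r + a₀ := by
  rw [lrCoeff_comm] at h
  constructor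
  · have h1 := YoungDiagram.le_iff_rowLen.1 (le_of_lrCoeff_ne_zero h) a₁
    rw [rowLen_eq_zero_of_mem_binaryStrings (append_zeros_mem hβ rfl)] at h1
    omega
  · intro r hr
    have h1 := rowLen_le_of_lrCoeff_ne_zero h r
    rw [rowLen_stringDiagram_append_zeros (by rwa [(mem_binaryStrings.1 hβ).2])] at h1
    have h2 := rowLen_le_of_mem_binaryStrings (reverse_mem_binaryStrings hα) 0
    omega

/-- The formula for the number of puzzles that holds for all contents. It remains to find the
strings `s` with nonvanishing summand. -/
theorem card_parallelogramPuzzle_eq_sum (hα : α ∈ binaryStrings a₀ a₁)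
    (hβ : β ∈ binaryStrings a₀ a₁) (hγ : γ ∈ binaryStrings c₀ c₁) (hδ : δ ∈ binaryStrings c₀ c₁) :
    (Nat.card (ParallelogramPuzzle α γ β δ) : ℤ) = ∑ s ∈ binaryStrings c₀ c₁,
      lrCoeff (stringDiagram α.reverse) (stringDiagram s) (stringDiagram (β ++ zeros c₀)) *
        lrNumber γ δ s.reverse := by
  have hδ' := reverse_mem_binaryStrings hδ
  rw [card_parallelogramPuzzle hα hβ hγ hδ, pairedCount_eq_sum
    (rowLen_eq_zero_of_mem_binaryStrings (reverse_mem_binaryStrings hα))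
    (rowLen_eq_zero_of_mem_binaryStrings (append_zeros_mem hβ rfl))
    (rowLen_eq_zero_of_mem_binaryStrings hδ') ((binaryStrings c₀ c₁).image stringDiagram)]
  · rw [sum_image (stringDiagram_injOn c₀ c₁)]
    refine sum_congr rfl fun s hs => ?_
    rw [lrCoeff_reverse hδ hs, mul_comm]
  · intro E hE
    by_contra h
    rw [lrCoeff_comm] at h
    have h1 := YoungDiagram.le_iff_rowLen.1 (le_of_lrCoeff_ne_zero h)
    obtain ⟨l, hl, rfl⟩ := exists_stringDiagram_eq (n₀ := c₀) (n₁ := c₁) (D := E)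
      (Nat.eq_zero_of_le_zero ((h1 c₁).trans_eq (rowLen_eq_zero_of_mem_binaryStrings hδ')))
      ((h1 0).trans (rowLen_le_of_mem_binaryStrings hδ' 0))
    exact hE (mem_image_of_mem _ hl)

end Formula

end

theorem theorem3 (a₀ a₁ c₀ c₁ : ℕ) (α β γ δ : List Bool)
    (hα : α ∈ binaryStrings a₀ a₁) (hβ : β ∈ binaryStrings a₀ a₁)
    (hγ : γ ∈ binaryStrings c₀ c₁) (hδ : δ ∈ binaryStrings c₀ c₁) :
    (c₀ ≤ a₀ → c₁ < a₁ →
      (Nat.card (ParallelogramPuzzle α γ β δ) : ℤ) =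
        ∑ μ ∈ binaryStrings c₀ c₁,
          lrNumber α β (μ ++ ones (a₁ - c₁) ++ zeros (a₀ - c₀)) * lrNumber γ δ μ.reverse) ∧
    (a₁ ≤ c₁ → a₀ < c₀ →
      (Nat.card (ParallelogramPuzzle α γ β δ) : ℤ) =
        ∑ κ ∈ binaryStrings a₀ a₁,
          lrNumber α β κ.reverse * lrNumber γ δ (ones (c₁ - a₁) ++ zeros (c₀ - a₀) ++ κ)) ∧
    (c₀ ≤ a₀ → a₁ ≤ c₁ →
      (Nat.card (ParallelogramPuzzle α γ β δ) : ℤ) =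
        ∑ η ∈ binaryStrings c₀ a₁,
          lrNumber α β (η.reverse ++ zeros (a₀ - c₀)) * lrNumber γ δ (ones (c₁ - a₁) ++ η)) ∧
    (a₀ < c₀ → c₁ < a₁ →
      (Nat.card (ParallelogramPuzzle α γ β δ) : ℤ) = 0) := by
  have hcard := card_parallelogramPuzzle_eq_sum hα hβ hγ hδ
  refine ⟨fun h0 h1 => ?_, fun h1 h0 => ?_, fun h0 h1 => ?_, fun h0 h1 => ?_⟩
  · rw [hcard]
    refine Finset.sum_congr rfl fun μ hμ => ?_
    have h2 := append_ones_mem hμ (show c₁ + (a₁ - c₁) = a₁ by omega)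
    congr 1
    refine lrCoeff_append_zeros hα hβ
      (YoungDiagram.rowLen_eq_zero_of_le (rowLen_eq_zero_of_mem_binaryStrings hμ) h1.le)
      (rowLen_eq_zero_of_mem_binaryStrings (append_zeros_mem h2 rfl)) fun r hr => ?_
    rw [rowLen_stringDiagram_append_zeros (by rwa [(mem_binaryStrings.1 h2).2]),
      stringDiagram_append_ones]
    omega
  · rw [hcard]
    symm
    -- A summand vanishes unless `s` has at most `a₁` rows, the first `a₁` of which have length at
    -- least `c₀ - a₀`.
    refine Finset.sum_of_injOn (fun κ => κ.reverse ++ zeros (c₀ - a₀) ++ ones (c₁ - a₁))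
      (fun κ _ κ' _ h => by simpa using h) (fun κ hκ => ?_) (fun s hs hs' => ?_) fun κ hκ => ?_
    · exact append_ones_mem (append_zeros_mem (reverse_mem_binaryStrings hκ) (by omega)) (by omega)
    · by_contra h
      obtain ⟨h2, h3⟩ := bounds_of_lrCoeff_append_zeros_ne_zero hα hβ (left_ne_zero_of_mul h)
      have hanti : Antitone fun r => (stringDiagram s).rowLen r - (c₀ - a₀) := fun r r' hr =>
        Nat.sub_le_sub_right ((stringDiagram s).rowLen_anti r r' hr) _
      have hex : ∃ r, (stringDiagram s).rowLen r - (c₀ - a₀) = 0 := ⟨a₁, by rw [h2, Nat.zero_sub]⟩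
      obtain ⟨κ, hκ, hκs⟩ := exists_stringDiagram_eq (n₀ := a₀) (n₁ := a₁)
        (D := YoungDiagram.ofRows fun r => (stringDiagram s).rowLen r - (c₀ - a₀))
        (by rw [YoungDiagram.rowLen_ofRows hanti hex, h2, Nat.zero_sub])
        (by
          rw [YoungDiagram.rowLen_ofRows hanti hex]
          have := rowLen_le_of_mem_binaryStrings hs 0
          omega)
      have hκ' := append_zeros_mem hκ (show a₀ + (c₀ - a₀) = c₀ by omega)
      refine hs' ⟨κ.reverse, reverse_mem_binaryStrings hκ, ?_⟩
      dsimp only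
      rw [List.reverse_reverse]
      refine stringDiagram_injOn c₀ c₁ (append_ones_mem hκ' (by omega)) hs ?_
      rw [stringDiagram_append_ones]
      refine YoungDiagram.ext_rowLen fun r => ?_
      rcases lt_or_ge r a₁ with hr | hr
      · rw [rowLen_stringDiagram_append_zeros (by rwa [(mem_binaryStrings.1 hκ).2]), hκs,
          YoungDiagram.rowLen_ofRows hanti hex]
        have := h3 r hr
        omega
      · rw [YoungDiagram.rowLen_eq_zero_of_le (rowLen_eq_zero_of_mem_binaryStrings hκ') hr,
          YoungDiagram.rowLen_eq_zero_of_le h2 hr]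
    · have hκ' := reverse_mem_binaryStrings hκ
      have hκ'' := append_zeros_mem hκ' (show a₀ + (c₀ - a₀) = c₀ by omega)
      congr 1
      · rw [stringDiagram_append_ones]
        refine (lrCoeff_append_zeros hα hβ (rowLen_eq_zero_of_mem_binaryStrings hκ'')
          (rowLen_eq_zero_of_mem_binaryStrings hκ') fun r hr => ?_).symm
        rw [rowLen_stringDiagram_append_zeros (by rwa [(mem_binaryStrings.1 hκ').2])]
        omega
      · congr 1
        simp
  · rw [hcard]
    symm
    -- A summand vanishes unless `s` has at most `a₁` rows.
    refine Finset.sum_of_injOn (fun η => η.reverse ++ ones (c₁ - a₁))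
      (fun η _ η' _ h => by simpa using h) (fun η hη => ?_) (fun s hs hs' => ?_) fun η hη => ?_
    · exact append_ones_mem (reverse_mem_binaryStrings hη) (by omega)
    · by_contra h
      have h2 := (bounds_of_lrCoeff_append_zeros_ne_zero hα hβ (left_ne_zero_of_mul h)).1
      obtain ⟨η, hη, hηs⟩ := exists_stringDiagram_eq h2 (rowLen_le_of_mem_binaryStrings hs 0)
      refine hs' ⟨η.reverse, reverse_mem_binaryStrings hη, ?_⟩
      dsimp only
      rw [List.reverse_reverse]
      refine stringDiagram_injOn c₀ c₁ (append_ones_mem hη (by omega)) hs ?_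
      rw [stringDiagram_append_ones, hηs]
    · have hη' := reverse_mem_binaryStrings hη
      congr 1
      · rw [stringDiagram_append_ones]
        refine (lrCoeff_append_zeros hα hβ (rowLen_eq_zero_of_mem_binaryStrings hη')
          (rowLen_eq_zero_of_mem_binaryStrings (append_zeros_mem hη' rfl)) fun r hr => ?_).symm
        rw [rowLen_stringDiagram_append_zeros (by rwa [(mem_binaryStrings.1 hη').2])]
        omega
      · congr 1
        simp
  -- Row `c₁` of the diagram of `s` is empty, but should have length at least `c₀ - a₀`.
  · rw [hcard]
    refine Finset.sum_eq_zero fun s hs => ?_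
    by_contra h
    have h2 := (bounds_of_lrCoeff_append_zeros_ne_zero hα hβ (left_ne_zero_of_mul h)).2 c₁ h1
    rw [rowLen_eq_zero_of_mem_binaryStrings hs] at h2
    omega
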